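/- For integers $L,T\ge 1$, let $G$ be the directed $L$-by-$T$ grid with vertices $v_{l,t}$ ($1\le l\le L$, $1\le t\le T$) and arc set $A$ consisting of the downward arcs $(v_{l,t},v_{l+1,t})$, $l\le L-1$, and the forward arcs $(v_{l,t},v_{l,t+1})$, $t\le T-1$. An instance of the min-concave-cost grid flow problem consists of integer supplies $b_v$ with $\sum_v b_v=0$, capacities $U_a\in\{0,1,2,\dots\}\cup\{\infty\}$, and functions $c_a:\mathbb{R}\to\mathbb{R}$ that are concave on $\{x\in\mathbb{R}: 0\le x\le U_a\}$ ($a\in A$). The flow polyhedron $P_F$ is the set of all $x\in\mathbb{R}^{A}$ with $\sum_{a\in\delta^+(v)}x_a-\sum_{a\in\delta^-(v)}x_a=b_v$ for every vertex $v$ (where $\delta^+(v)$ and $\delta^-(v)$ are the sets of outgoing and incoming arcs of $v$) and $0\le x_a\le U_a$ for every arc $a$; the problem is to find $x\in P_F$ that minimizes $\sum_{a\in A}c_a(x_a)$. Let $K$ be the number of distinct finite values among the capacities $U_a$; the instance is capacitated if $K\ge1$. A vertex $v$ is a source if $b_v>0$ and a sink if $b_v<0$. Running time is measured on a real random access machine: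 a program is a fixed finite piece of code, independent of the instance, that works on finitely many arrays of natural numbers (indices) and of real numbers. Reading or writing an array cell, an addition, a subtraction, a comparison and a logical connective in a test each cost one step. The costs are given by an oracle, which returns $c_a(x)$ in one step, given the number of the arc $a$ and a real number $x$. The input consists of $L$, $T$, the supplies and the capacities. (1) There are a program and a constant $C$ such that, for all $L,T$ and every feasible ($P_F\neq\emptyset$) capacitated instance whose sources and sinks all lie in at most two rows, the program halts after at most $C\,L^{4KL-4K+1}\,T^{4KL+4L-4K-3}$ steps and outputs an optimal flow. (2) There is a constant $C$ such that, for all $L,T$, every capacitated instance whose sources and sinks all lie in at most two rows, and every arc $a$, the set $\{f_a : f \text{ an extreme point of } P_F\}$ has at most $C\,L^{2K}\,T^{2K+2}$ elements. -/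

import Mathlib

namespace GridFlow

/-! ### The grid and the flow problem -/

/-- Vertices `(l, t)` of the grid: row `l`, column `t` (both numbered from `0`). -/
abbrev Vertex (L T : ℕ) : Type := Fin L × Fin T

def IsForward {L T : ℕ} (u v : Vertex L T) : Prop :=
  v.1 = u.1 ∧ v.2.val = u.2.val + 1

def IsDownward {L T : ℕ} (u v : Vertex L T) : Prop :=
  v.1.val = u.1.val + 1 ∧ v.2 = u.2

instance {L T : ℕ} (u v : Vertex L T) : Decidable (IsForward u v) :=
  inferInstanceAs (Decidable (_ ∧ _))

instance {L T : ℕ} (u v : Vertex L T) : Decidable (IsDownward u v) :=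
  inferInstanceAs (Decidable (_ ∧ _))

/-- Arcs of the grid: ordered pairs (tail, head), pointing one step forward or one step down. -/
abbrev Arc (L T : ℕ) : Type :=
  {e : Vertex L T × Vertex L T // IsForward e.1 e.2 ∨ IsDownward e.1 e.2}

def Arc.tail {L T : ℕ} (a : Arc L T) : Vertex L T := a.1.1

def Arc.head {L T : ℕ} (a : Arc L T) : Vertex L T := a.1.2

/-- The interval `{x | 0 ≤ x ≤ u}` of real numbers, where `u` may be infinite. -/
def capRange (u : ℕ∞) : Set ℝ := {x | 0 ≤ x ∧ ∀ n : ℕ, u = n → x ≤ n}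

/-- An instance of the minimum-concave-cost flow problem on the `L`-by-`T` grid. -/
structure MFG (L T : ℕ) where
  b : Vertex L T → ℤ
  U : Arc L T → ℕ∞
  c : Arc L T → ℝ → ℝ
  sum_b : ∑ v, b v = 0
  concave : ∀ a, ConcaveOn ℝ (capRange (U a)) (c a)

namespace MFG

variable {L T : ℕ} (P : MFG L T)

/-- The flow polyhedron: the set of feasible flows. -/
def feasible : Set (Arc L T → ℝ) :=
  {x | (∀ v, ∑ a with a.tail = v, x a - ∑ a with a.head = v, x a = (P.b v : ℝ)) ∧
    ∀ a, x a ∈ capRange (P.U a)}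

def cost (x : Arc L T → ℝ) : ℝ := ∑ a, P.c a (x a)

def IsOptimal (x : Arc L T → ℝ) : Prop :=
  x ∈ P.feasible ∧ ∀ y ∈ P.feasible, P.cost x ≤ P.cost y

/-- The number of different finite arc capacities. -/
def K : ℕ := ((Finset.univ.image P.U).filter (· < ⊤)).card

/-- All sources and sinks lie in at most two rows. -/
def InTwoRows : Prop :=
  ∃ r₁ r₂ : Fin L, ∀ v : Vertex L T, P.b v ≠ 0 → v.1 = r₁ ∨ v.1 = r₂

/-- The values that the flow on the arc `a` takes over all extreme points. -/
def extremeValues (a : Arc L T) : Set ℝ :=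
  (fun f => f a) '' Set.extremePoints ℝ P.feasible

end MFG

/-! ### The machine: a real random access machine with a cost oracle

The memory has arrays of natural numbers (used for indices) and arrays of real numbers, each of
unbounded length. A program is a fixed finite piece of code, the same for all inputs; every
elementary operation (reading or writing a cell, addition, subtraction, comparison, a call of the
oracle, a test) is one step. There is no multiplication. -/

structure Store where
  idx : ℕ → ℕ → ℕ
  val : ℕ → ℕ → ℝ

/-- Index expressions; `sub` is truncated subtraction. -/
inductive IExp where
  | lit (n : ℕ)
  | get (a : ℕ) (i : IExp)
  | add (i j : IExp)
  | sub (i j : IExp)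

def IExp.eval (s : Store) : IExp → ℕ
  | lit n => n
  | get a i => s.idx a (i.eval s)
  | add i j => i.eval s + j.eval s
  | sub i j => i.eval s - j.eval s

def IExp.steps : IExp → ℕ
  | lit _ => 1
  | get _ i => i.steps + 1
  | add i j => i.steps + j.steps + 1
  | sub i j => i.steps + j.steps + 1

/-- Real expressions. -/
inductive RExp where
  | lit (z : ℤ)
  | get (a : ℕ) (i : IExp)
  | add (x y : RExp)
  | sub (x y : RExp)

noncomputable def RExp.eval (s : Store) : RExp → ℝ
  | lit z => z
  | get a i => s.val a (i.eval s)
  | add x y => x.eval s + y.eval s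
  | sub x y => x.eval s - y.eval s

def RExp.steps : RExp → ℕ
  | lit _ => 1
  | get _ i => i.steps + 1
  | add x y => x.steps + y.steps + 1
  | sub x y => x.steps + y.steps + 1

inductive Test where
  | ile (i j : IExp)
  | rle (x y : RExp)
  | neg (t : Test)
  | conj (t u : Test)

def Test.Holds (s : Store) : Test → Prop
  | ile i j => i.eval s ≤ j.eval s
  | rle x y => x.eval s ≤ y.eval s
  | neg t => ¬ t.Holds s
  | conj t u => t.Holds s ∧ u.Holds s

def Test.steps : Test → ℕ
  | ile i j => i.steps + j.steps + 1
  | rle x y => x.steps + y.steps + 1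
  | neg t => t.steps + 1
  | conj t u => t.steps + u.steps + 1

/-- Programs. `iset a i e` and `rset a i x` write into cell `i` of an index array or a real array;
`query a i q x` asks the oracle for the cost of flow `x` on the arc numbered `q` and writes the
answer into cell `i` of the real array `a`. -/
inductive Prog where
  | nop
  | iset (a : ℕ) (i e : IExp)
  | rset (a : ℕ) (i : IExp) (x : RExp)
  | query (a : ℕ) (i q : IExp) (x : RExp)
  | seq (p q : Prog)
  | cond (t : Test) (p q : Prog)
  | loop (t : Test) (p : Prog)

def Store.setIdx (s : Store) (a i n : ℕ) : Store :=
  { s with idx := Function.update s.idx a (Function.update (s.idx a) i n) }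

noncomputable def Store.setVal (s : Store) (a i : ℕ) (x : ℝ) : Store :=
  { s with val := Function.update s.val a (Function.update (s.val a) i x) }

/-- `Run O p s n s'`: with oracle `O`, the program `p` started in the store `s` halts after exactly
`n` steps in the store `s'`. -/
inductive Run (O : ℕ → ℝ → ℝ) : Prog → Store → ℕ → Store → Prop
  | nop (s : Store) : Run O .nop s 1 s
  | iset (a : ℕ) (i e : IExp) (s : Store) :
      Run O (.iset a i e) s (i.steps + e.steps + 1) (s.setIdx a (i.eval s) (e.eval s))
  | rset (a : ℕ) (i : IExp) (x : RExp) (s : Store) :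
      Run O (.rset a i x) s (i.steps + x.steps + 1) (s.setVal a (i.eval s) (x.eval s))
  | query (a : ℕ) (i q : IExp) (x : RExp) (s : Store) :
      Run O (.query a i q x) s (i.steps + q.steps + x.steps + 1)
        (s.setVal a (i.eval s) (O (q.eval s) (x.eval s)))
  | seq {p q : Prog} {s₁ s₂ s₃ : Store} {m n : ℕ} :
      Run O p s₁ m s₂ → Run O q s₂ n s₃ → Run O (.seq p q) s₁ (m + n) s₃
  | cond_true {t : Test} {p q : Prog} {s s' : Store} {n : ℕ} :
      t.Holds s → Run O p s n s' → Run O (.cond t p q) s (t.steps + n) s'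
  | cond_false {t : Test} {p q : Prog} {s s' : Store} {n : ℕ} :
      ¬ t.Holds s → Run O q s n s' → Run O (.cond t p q) s (t.steps + n) s'
  | loop_true {t : Test} {p : Prog} {s₁ s₂ s₃ : Store} {m n : ℕ} :
      t.Holds s₁ → Run O p s₁ m s₂ → Run O (.loop t p) s₂ n s₃ →
      Run O (.loop t p) s₁ (t.steps + m + n) s₃
  | loop_false {t : Test} {p : Prog} {s : Store} :
      ¬ t.Holds s → Run O (.loop t p) s t.steps s

/-! ### Input and output -/

/-- Vertices are numbered column by column. -/
def vertexCode {L T : ℕ} (v : Vertex L T) : ℕ := v.2.val * L + v.1.val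

/-- The forward arc and the downward arc that leave the vertex numbered `k` are numbered
`2 * k` and `2 * k + 1`. -/
def arcCode {L T : ℕ} (a : Arc L T) : ℕ :=
  2 * vertexCode a.tail + if IsDownward a.tail a.head then 1 else 0

theorem vertexCode_injective {L T : ℕ} : Function.Injective (vertexCode (L := L) (T := T)) := by
  rintro ⟨l, t⟩ ⟨l', t'⟩ h
  simp only [vertexCode] at h
  have hL : 0 < L := by have := l.2; omega
  have h1 := congrArg (· % L) h
  have h2 := congrArg (· / L) h
  simp only [Nat.mul_add_mod_self_right, Nat.mod_eq_of_lt l.2, Nat.mod_eq_of_lt l'.2] at h1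
  rw [Nat.add_comm, Nat.add_comm (t'.val * L)] at h2
  simp only [Nat.add_mul_div_right _ _ hL, Nat.div_eq_of_lt l.2, Nat.div_eq_of_lt l'.2] at h2
  ext <;> simp <;> omega

theorem arcCode_injective {L T : ℕ} : Function.Injective (arcCode (L := L) (T := T)) := by
  rintro ⟨⟨u, v⟩, h⟩ ⟨⟨u', v'⟩, h'⟩ e
  simp only [arcCode, Arc.tail, Arc.head] at e
  have hu : u = u' := by
    apply vertexCode_injective
    by_cases h1 : IsDownward u v <;> by_cases h2 : IsDownward u' v' <;> simp [h1, h2] at e <;> omega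
  subst hu
  have hv : v = v' := by
    obtain ⟨v1, v2⟩ := v
    obtain ⟨w1, w2⟩ := v'
    simp only [IsForward, IsDownward, Fin.ext_iff] at h h' e
    simp only [Prod.mk.injEq, Fin.ext_iff]
    split_ifs at e <;> omega
  subst hv
  rfl

namespace MFG

variable {L T : ℕ} (P : MFG L T)

/-- The cost oracle: on the number of an arc `a` and a real `x` it returns `c_a(x)`. -/
noncomputable def oracle : ℕ → ℝ → ℝ := Function.extend arcCode P.c 0

/-- The input: index array `0` holds `L, T`, index array `1` tells which arcs have a finite
capacity; real array `0` holds the supplies and real array `1` the finite capacities (`0` for an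
infinite one). All other cells are `0`. -/
noncomputable def input : Store where
  idx := fun k => match k with
    | 0 => fun i => if i = 0 then L else if i = 1 then T else 0
    | 1 => Function.extend arcCode (fun a => if P.U a = ⊤ then 0 else 1) 0
    | _ => 0
  val := fun k => match k with
    | 0 => Function.extend vertexCode (fun v => (P.b v : ℝ)) 0
    | 1 => Function.extend arcCode (fun a => ((P.U a).toNat : ℝ)) 0
    | _ => 0

end MFG

/-- The output: the flow on the arc `a` is read from real array `2`, at the number of `a`. -/
def output (L T : ℕ) (s : Store) : Arc L T → ℝ := fun a => s.val 2 (arcCode a)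

/-- The program `p` solves the instance `P` in at most `N` steps: it halts within `N` steps and
its output is an optimal flow. -/
def SolvesWithin (p : Prog) {L T : ℕ} (P : MFG L T) (N : ℕ) : Prop :=
  ∃ n s, Run P.oracle p P.input n s ∧ n ≤ N ∧ P.IsOptimal (output L T s)

end GridFlow

namespace GridFlow

/-! ### Reasoning about programs -/

/-! Call an arc free if its flow lies strictly between zero and the capacity, and call a flow rigid
if its free arcs support no nonzero circulation. A feasible flow that is not rigid can be moved both
ways along a circulation until some arc becomes tight. Both moves end even if capacities are
infinite, because the grid has no directed cycle. By concavity one of the two ends is no more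
expensive, so rigid flows suffice for optimality (`MFG.exists_rigid_le`); extreme points are rigid
as well (`MFG.rigid_of_extreme`).

The heart is that rigid flows take few values on an arc (`MFG.Rigid.exists_eq`). A free arc `a` is a
bridge of the graph of free arcs, and all flow lives in the strip between the two supply rows.
Filling the holes of one side of the bridge gives a set S, connected and with connected complement
in the strip, that no other free arc crosses (`exists_cut`). Conservation over S writes the flow on
`a` as the supply of S plus an integer combination of the capacities. A discrete Jordan curve
argument (`exists_potential`, `noncrossing`) restricts the traces of S on the two rows so much that
its supply is a sum of two signed prefix sums of rows (`sum_of_noncrossing`). There are at most 4T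
nonzero signed prefix sums, and each capacity has a coefficient of absolute value at most 2TL. This
gives a list of at most (4T+1)^2 (4TL+1)^K candidate values and hence the second claim.

For the first claim the grid is cut between columns. A state assigns candidates to the arcs of a cut
in the first L-1 rows; conservation forces the last row, and two consecutive states force the
downward flows between them. With M candidates, a shortest path through the M^(L-1) states of each
layer takes on the order of T L M^(2(L-1)) steps. `solveP` carries this out, and its specification
combines `candidatesP_spec` and `optimizeP_spec`.

Since M is raised to a power that grows with L, no constant factor may be lost in M itself. The
stated bound L^(2K) T^(2K+2) exceeds the count by a factor (TL)^K up to constants, which absorbs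
125^K once TL is at least 125 (`size_le_of_le`). On smaller grids K is bounded, and so is everything
else (`exists_size_le`). -/

/-- The program `p` started in `s` halts within `n` steps in a store that satisfies `Q`. -/
def Ht (O : ℕ → ℝ → ℝ) (p : Prog) (s : Store) (n : ℕ) (Q : Store → Prop) : Prop :=
  ∃ k s', Run O p s k s' ∧ k ≤ n ∧ Q s'

section Simp

variable (s : Store) (a b i n : ℕ) (x : ℝ)

@[simp] theorem Store.setIdx_idx_self : (s.setIdx a i n).idx a = Function.update (s.idx a) i n := by
  simp [Store.setIdx]

@[simp] theorem Store.setIdx_idx_ne (h : b ≠ a) : (s.setIdx a i n).idx b = s.idx b := by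
  simp [Store.setIdx, h]

@[simp] theorem Store.setIdx_val : (s.setIdx a i n).val = s.val := rfl

@[simp] theorem Store.setVal_val_self : (s.setVal a i x).val a = Function.update (s.val a) i x := by
  simp [Store.setVal]

@[simp] theorem Store.setVal_val_ne (h : b ≠ a) : (s.setVal a i x).val b = s.val b := by
  simp [Store.setVal, h]

@[simp] theorem Store.setVal_idx : (s.setVal a i x).idx = s.idx := rfl

end Simp

/-- The index array `a` is written by the program. -/
def Prog.writesI (a : ℕ) : Prog → Bool
  | .nop => false
  | .iset b _ _ => a == b
  | .rset _ _ _ => false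
  | .query _ _ _ _ => false
  | .seq p q => p.writesI a || q.writesI a
  | .cond _ p q => p.writesI a || q.writesI a
  | .loop _ p => p.writesI a

/-- The real array `a` is written by the program. -/
def Prog.writesV (a : ℕ) : Prog → Bool
  | .nop => false
  | .iset _ _ _ => false
  | .rset b _ _ => a == b
  | .query b _ _ _ => a == b
  | .seq p q => p.writesV a || q.writesV a
  | .cond _ p q => p.writesV a || q.writesV a
  | .loop _ p => p.writesV a

/-- The stores `s` and `s'` agree on all arrays that `p` does not write. -/
structure Frame (p : Prog) (s s' : Store) : Prop where
  idx (a : ℕ) (h : p.writesI a = false) : s'.idx a = s.idx a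
  val (a : ℕ) (h : p.writesV a = false) : s'.val a = s.val a

theorem Frame.refl (p : Prog) (s : Store) : Frame p s s := ⟨fun _ _ => rfl, fun _ _ => rfl⟩

/-- Because `writesI` and `writesV` compute on concrete programs, every later claim that an array is
untouched reduces to `hF.idx a rfl` or `hF.val a rfl`. -/
theorem Run.frame {O : ℕ → ℝ → ℝ} {p : Prog} {s s' : Store} {n : ℕ} (h : Run O p s n s') :
    Frame p s s' := by
  induction h with
  | nop s => exact Frame.refl _ _
  | iset a i e s =>
    exact ⟨fun b hb => by simp [Prog.writesI] at hb; simp [hb], fun b _ => by simp⟩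
  | rset a i x s =>
    exact ⟨fun b _ => by simp, fun b hb => by simp [Prog.writesV] at hb; simp [hb]⟩
  | query a i q x s =>
    exact ⟨fun b _ => by simp, fun b hb => by simp [Prog.writesV] at hb; simp [hb]⟩
  | seq _ _ h1 h2 =>
    refine ⟨fun b hb => ?_, fun b hb => ?_⟩
    · simp [Prog.writesI] at hb
      rw [h2.idx b hb.2, h1.idx b hb.1]
    · simp [Prog.writesV] at hb
      rw [h2.val b hb.2, h1.val b hb.1]
  | cond_true _ _ h1 =>
    refine ⟨fun b hb => ?_, fun b hb => ?_⟩
    · simp [Prog.writesI] at hb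
      exact h1.idx b hb.1
    · simp [Prog.writesV] at hb
      exact h1.val b hb.1
  | cond_false _ _ h1 =>
    refine ⟨fun b hb => ?_, fun b hb => ?_⟩
    · simp [Prog.writesI] at hb
      exact h1.idx b hb.2
    · simp [Prog.writesV] at hb
      exact h1.val b hb.2
  | loop_true _ _ _ h1 h2 =>
    refine ⟨fun b hb => ?_, fun b hb => ?_⟩
    · rw [h2.idx b hb, h1.idx b (by simpa [Prog.writesI] using hb)]
    · rw [h2.val b hb, h1.val b (by simpa [Prog.writesV] using hb)]
  | loop_false _ => exact Frame.refl _ _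

section Rules

variable {O : ℕ → ℝ → ℝ} {p q : Prog} {s : Store} {m n : ℕ} {Q Q' : Store → Prop}

theorem Ht.mono (h : Ht O p s m Q) (hmn : m ≤ n) (hQ : ∀ s', Frame p s s' → Q s' → Q' s') :
    Ht O p s n Q' := by
  obtain ⟨k, s', hr, hk, hq⟩ := h
  exact ⟨k, s', hr, hk.trans hmn, hQ s' hr.frame hq⟩

theorem Ht.le (h : Ht O p s m Q) (hmn : m ≤ n) : Ht O p s n Q := h.mono hmn fun _ _ h => h

theorem Ht.seq {R : Store → Prop} (h : Ht O p s m R)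
    (h' : ∀ s', Frame p s s' → R s' → Ht O q s' n Q) : Ht O (.seq p q) s (m + n) Q := by
  obtain ⟨k, s', hr, hk, hq⟩ := h
  obtain ⟨k', s'', hr', hk', hq'⟩ := h' s' hr.frame hq
  exact ⟨_, _, .seq hr hr', add_le_add hk hk', hq'⟩

theorem Ht.cond {t : Test} (h : t.Holds s → Ht O p s n Q) (h' : ¬ t.Holds s → Ht O q s n Q) :
    Ht O (.cond t p q) s (t.steps + n) Q := by
  by_cases ht : t.Holds s
  · obtain ⟨k, s', hr, hk, hq⟩ := h ht
    exact ⟨_, _, .cond_true ht hr, by omega, hq⟩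
  · obtain ⟨k, s', hr, hk, hq⟩ := h' ht
    exact ⟨_, _, .cond_false ht hr, by omega, hq⟩

end Rules

/-- The program contains no loop. -/
def Prog.loopFree : Prog → Bool
  | .seq p q => p.loopFree && q.loopFree
  | .cond _ p q => p.loopFree && q.loopFree
  | .loop _ _ => false
  | _ => true

/-- A bound for the number of steps of a loop-free program. -/
def Prog.size : Prog → ℕ
  | .nop => 1
  | .iset _ i e => i.steps + e.steps + 1
  | .rset _ i x => i.steps + x.steps + 1
  | .query _ i q x => i.steps + q.steps + x.steps + 1
  | .seq p q => p.size + q.size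
  | .cond t p q => t.steps + (p.size + q.size)
  | .loop _ _ => 0

open Classical in
/-- The effect of a loop-free program. -/
noncomputable def Prog.exec (O : ℕ → ℝ → ℝ) : Prog → Store → Store
  | .nop, s => s
  | .iset a i e, s => s.setIdx a (i.eval s) (e.eval s)
  | .rset a i x, s => s.setVal a (i.eval s) (x.eval s)
  | .query a i q x, s => s.setVal a (i.eval s) (O (q.eval s) (x.eval s))
  | .seq p q, s => q.exec O (p.exec O s)
  | .cond t p q, s => if t.Holds s then p.exec O s else q.exec O s
  | .loop _ _, s => s

/-- Straight-line code is evaluated by a function, so that its postcondition becomes a matter of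
simplification. `Prog.size` counts both branches of a conditional, which bounds whichever is taken.
-/
theorem Ht.of_exec {O : ℕ → ℝ → ℝ} {p : Prog} {s : Store} {n : ℕ} {Q : Store → Prop}
    (hp : p.loopFree = true) (hn : p.size ≤ n) (h : Q (p.exec O s)) : Ht O p s n Q := by
  suffices key : ∀ (p : Prog) (s : Store), p.loopFree = true →
      ∃ k, Run O p s k (p.exec O s) ∧ k ≤ p.size by
    obtain ⟨k, hr, hk⟩ := key p s hp
    exact ⟨k, _, hr, hk.trans hn, h⟩
  intro p
  induction p with
  | nop => exact fun s _ => ⟨1, .nop s, le_rfl⟩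
  | iset a i e => exact fun s _ => ⟨_, .iset a i e s, le_rfl⟩
  | rset a i e => exact fun s _ => ⟨_, .rset a i e s, le_rfl⟩
  | query a i q x => exact fun s _ => ⟨_, .query a i q x s, le_rfl⟩
  | seq p q hp hq =>
    intro s h
    simp only [Prog.loopFree, Bool.and_eq_true] at h
    obtain ⟨k, hr, hk⟩ := hp s h.1
    obtain ⟨k', hr', hk'⟩ := hq (p.exec O s) h.2
    exact ⟨_, .seq hr hr', add_le_add hk hk'⟩
  | cond t p q hp hq =>
    intro s h
    simp only [Prog.loopFree, Bool.and_eq_true] at h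
    by_cases ht : t.Holds s
    · obtain ⟨k, hr, hk⟩ := hp s h.1
      exact ⟨_, by simpa [Prog.exec, ht] using Run.cond_true (q := q) ht hr,
        by simp only [Prog.size]; omega⟩
    · obtain ⟨k, hr, hk⟩ := hq s h.2
      exact ⟨_, by simpa [Prog.exec, ht] using Run.cond_false (p := p) ht hr,
        by simp only [Prog.size]; omega⟩
  | loop t p _ => intro s h; simp [Prog.loopFree] at h

/-- The scalar variable stored in cell `0` of an index array. -/
abbrev IExp.var (a : ℕ) : IExp := .get a (.lit 0)

/-- The scalar variable stored in cell `0` of a real array. -/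
abbrev RExp.var (a : ℕ) : RExp := .get a (.lit 0)

/-- Run `body` for the values `0, ..., bound - 1` of the index variable `i`. -/
def Prog.forTo (i : ℕ) (bound : IExp) (body : Prog) : Prog :=
  .seq (.iset i (.lit 0) (.lit 0))
    (.loop (.ile (.add (.var i) (.lit 1)) bound)
      (.seq body (.iset i (.lit 0) (.add (.var i) (.lit 1)))))

/-- The invariant rule for counting loops. The assumption `hins` says that the invariant ignores the
loop counter. Per round, the test and the increment cost `bound.steps + 11` on top of the body. -/
theorem Ht.forTo {O : ℕ → ℝ → ℝ} {i : ℕ} {bound : IExp} {body : Prog} {s₀ : Store}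
    (N τ : ℕ) (Inv : ℕ → Store → Prop) {n : ℕ} {Q : Store → Prop}
    (hi : body.writesI i = false)
    (hb : ∀ s, Frame (.forTo i bound body) s₀ s → bound.eval s = N)
    (hins : ∀ k s v, Inv k s → Inv k (s.setIdx i 0 v))
    (h0 : Inv 0 s₀)
    (hstep : ∀ k s, k < N → Frame (.forTo i bound body) s₀ s → s.idx i 0 = k → Inv k s →
      Ht O body s τ (Inv (k + 1)))
    (hn : (N + 1) * (τ + bound.steps + 12) ≤ n)
    (hQ : ∀ s, Inv N s → Q s) :
    Ht O (.forTo i bound body) s₀ n Q := by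
  -- Induction on the number `j` of rounds that remain; the 3 steps held back pay for the initial
  -- assignment to the counter.
  suffices key : ∀ j s, j ≤ N → Frame (.forTo i bound body) s₀ s → s.idx i 0 = N - j →
      Inv (N - j) s →
      ∃ k s', Run O (.loop (.ile (.add (.var i) (.lit 1)) bound)
        (.seq body (.iset i (.lit 0) (.add (.var i) (.lit 1))))) s k s' ∧
        k ≤ (j + 1) * (τ + bound.steps + 12) - 3 ∧ Inv N s' by
    have hr := Run.iset (O := O) i (.lit 0) (.lit 0) s₀
    have hfr : Frame (.forTo i bound body) s₀ (s₀.setIdx i 0 0) := by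
      refine ⟨fun a ha => ?_, fun a _ => rfl⟩
      have : a ≠ i := by
        rintro rfl
        simp [Prog.forTo, Prog.writesI] at ha
      simp [this]
    obtain ⟨k, s', hr', hk, hI⟩ := key N (s₀.setIdx i 0 0) le_rfl hfr (by simp)
      (by simpa using hins _ _ 0 h0)
    refine ⟨_, s', .seq hr hr', ?_, hQ _ hI⟩
    simp only [IExp.steps]
    have : 3 ≤ (N + 1) * (τ + bound.steps + 12) := by nlinarith
    omega
  intro j
  induction j with
  | zero =>
    intro s _ hF hs hI
    refine ⟨_, s, .loop_false ?_, ?_, by simpa using hI⟩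
    · simp [Test.Holds, IExp.eval, hb s hF, hs]
    · simp only [Test.steps, IExp.steps]; omega
  | succ j ih =>
    intro s hj hF hs hI
    obtain ⟨k, s', hr, hk, hI'⟩ := hstep _ s (by omega) hF hs hI
    have hf := hr.frame
    have hr2 := Run.iset (O := O) i (.lit 0) (.add (.var i) (.lit 1)) s'
    have hs' : s'.idx i 0 = N - (j + 1) := by rw [hf.idx i hi, hs]
    have hF' : Frame (.forTo i bound body) s₀
        (s'.setIdx i 0 (s'.idx i 0 + 1)) := by
      refine ⟨fun a ha => ?_, fun a ha => ?_⟩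
      · have h1 := ha
        simp [Prog.forTo, Prog.writesI] at h1
        simp only [ne_eq, h1.1, not_false_eq_true, Store.setIdx_idx_ne]
        rw [hf.idx a h1.2.1, hF.idx a ha]
      · have h1 := ha
        simp [Prog.forTo, Prog.writesV] at h1
        simp only [Store.setIdx_val]
        rw [hf.val a h1, hF.val a ha]
    have e : N - (j + 1) + 1 = N - j := by omega
    obtain ⟨k', s'', hr', hk', hI''⟩ := ih (s'.setIdx i 0 (s'.idx i 0 + 1)) (by omega) hF'
      (by simp [hs', e]) (by rw [← e]; exact hins _ _ _ hI')
    refine ⟨_, s'', .loop_true ?_ (.seq hr hr2) hr', ?_, hI''⟩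
    · simp only [Test.Holds, IExp.eval, hb s hF, hs]; omega
    · simp only [Test.steps, IExp.steps]
      have : 12 ≤ (j + 1) * (τ + bound.steps + 12) := by nlinarith
      have : (j + 1 + 1) * (τ + bound.steps + 12)
        = (j + 1) * (τ + bound.steps + 12) + (τ + bound.steps + 12) := by ring
      omega

end GridFlow

namespace GridFlow

/-! ### Generating the candidate values

Index variables: `2` length of the list in real array `3`, `3` length of the list in real
array `4`, `11` the number `2 * L * T`. -/

open Prog in
/-- Append to the list `R` (real array `3`) all sums of an element of `R` and an element of the
list in real array `4`. -/
def addListP : Prog :=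
  .seq (.iset 4 (.lit 0) (.var 2))
    (forTo 8 (.var 3) (forTo 9 (.var 4)
      (.seq (.rset 3 (.var 2) (.add (.get 3 (.var 9)) (.get 4 (.var 8))))
        (.iset 2 (.lit 0) (.add (.var 2) (.lit 1))))))

/-- The result consists of blocks of length `M`: block 0 is the old list, and block `j + 1` is the
old list shifted by entry `j` of the second list. The inner loop runs to a copy of the old length,
since the length variable itself grows. -/
theorem addListP_spec {O : ℕ → ℝ → ℝ} {s : Store} {M β : ℕ} (hM : s.idx 2 0 = M)
    (hβ : s.idx 3 0 = β) :
    Ht O addListP s (60 * ((β + 1) * (M + 1))) (fun s' => s'.idx 2 0 = M * (β + 1) ∧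
      (∀ i < M, s'.val 3 i = s.val 3 i) ∧
      ∀ j < β, ∀ i < M, s'.val 3 (M * (j + 1) + i) = s.val 3 i + s.val 4 j) := by
  refine Ht.le (Ht.seq (m := 4) (n := (β + 1) * ((M + 1) * 36 + 14))
    (R := fun s' => s'.idx 4 0 = M) (Ht.of_exec rfl le_rfl ?_) ?_) ?_
  · simp [Prog.exec, IExp.eval, hM]
  · intro s₁ hF₁ h4
    refine Ht.forTo β ((M + 1) * 36) (fun k t => t.idx 2 0 = M * (k + 1) ∧
      (∀ i < M, t.val 3 i = s.val 3 i) ∧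
      ∀ j < k, ∀ i < M, t.val 3 (M * (j + 1) + i) = s.val 3 i + s.val 4 j) rfl ?_ ?_ ?_ ?_
      (by simp [IExp.steps]) (fun _ h => h)
    · intro t hF
      simp [IExp.eval, hF.idx 3 rfl, hF₁.idx 3 rfl, hβ]
    · intro k t v h
      simpa using h
    · simp [hF₁.idx 2 rfl, hM, hF₁.val 3 rfl]
    · rintro k t hk hF hk8 ⟨h2, hR, hS⟩
      refine Ht.forTo M 22 (fun i' t => t.idx 2 0 = M * (k + 1) + i' ∧
        (∀ i < M, t.val 3 i = s.val 3 i) ∧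
        (∀ j < k, ∀ i < M, t.val 3 (M * (j + 1) + i) = s.val 3 i + s.val 4 j) ∧
        ∀ i < i', t.val 3 (M * (k + 1) + i) = s.val 3 i + s.val 4 k) rfl ?_ ?_ ?_ ?_
        (by simp [IExp.steps]) ?_
      · intro u hu
        simp [IExp.eval, hu.idx 4 rfl, hF.idx 4 rfl, h4]
      · intro k t v h
        simpa using h
      · simpa [h2] using ⟨hR, hS⟩
      · rintro i' u hi' hu hi9 ⟨g2, gR, gS, gN⟩
        refine Ht.of_exec rfl (by simp [Prog.size, IExp.steps, RExp.steps]) ?_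
        have h44 : u.val 4 = s.val 4 := by rw [hu.val 4 rfl, hF.val 4 rfl, hF₁.val 4 rfl]
        have h88 : u.idx 8 0 = k := by rw [hu.idx 8 rfl, hk8]
        simp only [Prog.exec, IExp.eval, RExp.eval, Store.setVal_idx, Store.setIdx_idx_self,
          Store.setVal_val_self, Store.setIdx_val, Function.update_self, g2, hi9, h44, h88,
          gR i' hi']
        -- The cell just written lies beyond all cells that the invariant mentions, except for the
        -- new one.
        refine ⟨by ring, fun i hi => ?_, fun j hj i hi => ?_, fun i hi => ?_⟩
        · rw [Function.update_of_ne, gR i hi]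
          nlinarith
        · rw [Function.update_of_ne, gS j hj i hi]
          nlinarith
        · rcases Nat.lt_succ_iff_lt_or_eq.1 hi with hi | rfl
          · rw [Function.update_of_ne (by omega), gN i hi]
          · simp
      · rintro u ⟨g2, gR, gS, gN⟩
        refine ⟨by rw [g2]; ring, gR, fun j hj i hi => ?_⟩
        rcases Nat.lt_succ_iff_lt_or_eq.1 hj with hj | rfl
        · exact gS j hj i hi
        · exact gN i hi
  · nlinarith

open Prog in
/-- Put the positive and negative multiples `± j * u`, `1 ≤ j ≤ 2 * L * T`, of the real
variable `5` into the list in real array `4`. -/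
def multiplesP : Prog :=
  .seq (.seq (.iset 3 (.lit 0) (.lit 0)) (.rset 9 (.lit 0) (.lit 0)))
    (forTo 10 (.var 11)
      (.seq (.rset 9 (.lit 0) (.add (.var 9) (.var 5)))
      (.seq (.rset 4 (.var 3) (.var 9))
      (.seq (.rset 4 (.add (.var 3) (.lit 1)) (.sub (.lit 0) (.var 9)))
        (.iset 3 (.lit 0) (.add (.var 3) (.lit 2)))))))

/-- The machine cannot multiply, so the multiples arise by repeated addition; positive and negative
ones alternate. -/
theorem multiplesP_spec {O : ℕ → ℝ → ℝ} {s : Store} {m : ℕ} (hm : s.idx 11 0 = m) :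
    Ht O multiplesP s (60 * (m + 1)) (fun s' => s'.idx 3 0 = 2 * m ∧
      ∀ j < m, s'.val 4 (2 * j) = (j + 1) * s.val 5 0 ∧
        s'.val 4 (2 * j + 1) = -((j + 1) * s.val 5 0)) := by
  refine Ht.le (Ht.seq (m := 6) (n := (m + 1) * 50)
    (R := fun s' => s'.idx 3 0 = 0 ∧ s'.val 9 0 = 0) (Ht.of_exec rfl le_rfl ?_) ?_) ?_
  · simp [Prog.exec, IExp.eval, RExp.eval]
  · rintro s₁ hF₁ ⟨h3, h9⟩
    refine Ht.forTo m 30 (fun k t => t.idx 3 0 = 2 * k ∧ t.val 9 0 = k * s.val 5 0 ∧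
      ∀ j < k, t.val 4 (2 * j) = (j + 1) * s.val 5 0 ∧
        t.val 4 (2 * j + 1) = -((j + 1) * s.val 5 0)) rfl ?_ ?_ ?_ ?_
      (by simp [IExp.steps]) (fun _ h => ⟨h.1, h.2.2⟩)
    · intro t hF
      simp [IExp.eval, hF.idx 11 rfl, hF₁.idx 11 rfl, hm]
    · intro k t v h
      simpa using h
    · simp [h3, h9]
    · rintro k t hk hF hk10 ⟨g3, g9, gB⟩
      refine Ht.of_exec rfl (by simp [Prog.size, IExp.steps, RExp.steps]) ?_
      have h5 : t.val 5 = s.val 5 := by rw [hF.val 5 rfl, hF₁.val 5 rfl]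
      simp [Prog.exec, IExp.eval, RExp.eval, g3, g9, h5]
      refine ⟨by ring, by ring, fun j hj => ?_⟩
      rcases hj.lt_or_eq with hj | rfl
      · rw [Function.update_of_ne (by omega), Function.update_of_ne (by omega),
          Function.update_of_ne (by omega), Function.update_of_ne (by omega)]
        exact gB j hj
      · rw [Function.update_of_ne (by omega)]
        simp
        ring_nf
        simp
  · nlinarith

end GridFlow

/-! ### Prefix sums of the supplies along rows -/

namespace GridFlow

/-- The value `x` is among the first `n` entries of `f`. -/
def Listed (f : ℕ → ℝ) (n : ℕ) (x : ℝ) : Prop := ∃ j < n, f j = x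

theorem Listed.mono {f g : ℕ → ℝ} {m n : ℕ} {x : ℝ} (h : Listed f m x) (hmn : m ≤ n)
    (hfg : ∀ j < m, g j = f j) : Listed g n x := by
  obtain ⟨j, hj, rfl⟩ := h
  exact ⟨j, hj.trans_le hmn, hfg j hj⟩

/-- The sum of the supplies of the first `t` vertices in row `l`. -/
def rowPrefix (b : ℕ → ℝ) (L l t : ℕ) : ℝ := ∑ t' ∈ Finset.range t, b (t' * L + l)

open Prog in
/-- Put the nonzero prefix sums of the rows and their negatives into the list in real array `4`. -/
def prefixesP : Prog :=
  forTo 5 (.get 0 (.lit 0))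
    (.seq (.seq (.rset 5 (.lit 0) (.lit 0)) (.iset 7 (.lit 0) (.var 5)))
      (forTo 6 (.get 0 (.lit 1))
        (.seq (.rset 5 (.lit 0) (.add (.var 5) (.get 0 (.var 7))))
        (.seq (.iset 7 (.lit 0) (.add (.var 7) (.get 0 (.lit 0))))
          (.cond (.conj (.rle (.var 5) (.lit 0)) (.rle (.lit 0) (.var 5))) .nop
            (.seq (.rset 4 (.var 3) (.var 5))
            (.seq (.rset 4 (.add (.var 3) (.lit 1)) (.sub (.lit 0) (.var 5)))
              (.iset 3 (.lit 0) (.add (.var 3) (.lit 2))))))))))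

open Classical in
-- Prefix sums that vanish are skipped. Hence rows without supplies contribute nothing, and the list
-- stays short although the program is never told which two rows matter.
theorem prefixesP_spec {O : ℕ → ℝ → ℝ} {s : Store} {L T : ℕ} (hL : s.idx 0 0 = L)
    (hT : s.idx 0 1 = T) (h3 : s.idx 3 0 = 0) :
    Ht O prefixesP s (120 * ((L + 1) * (T + 1))) (fun s' =>
      s'.idx 3 0 = ∑ l ∈ Finset.range L, ∑ t ∈ Finset.range T,
        (if rowPrefix (s.val 0) L l (t + 1) = 0 then 0 else 2) ∧
      ∀ l < L, ∀ t < T, rowPrefix (s.val 0) L l (t + 1) ≠ 0 →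
        Listed (s'.val 4) (s'.idx 3 0) (rowPrefix (s.val 0) L l (t + 1)) ∧
        Listed (s'.val 4) (s'.idx 3 0) (-rowPrefix (s.val 0) L l (t + 1))) := by
  refine Ht.forTo L ((T + 1) * 80 + 10) (fun k u =>
    u.idx 3 0 = ∑ l ∈ Finset.range k, ∑ t ∈ Finset.range T,
        (if rowPrefix (s.val 0) L l (t + 1) = 0 then 0 else 2) ∧
      ∀ l < k, ∀ t < T, rowPrefix (s.val 0) L l (t + 1) ≠ 0 →
        Listed (u.val 4) (u.idx 3 0) (rowPrefix (s.val 0) L l (t + 1)) ∧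
        Listed (u.val 4) (u.idx 3 0) (-rowPrefix (s.val 0) L l (t + 1))) rfl ?_ ?_ ?_ ?_ ?_
      (fun _ h => h)
  · intro u hF
    simp [IExp.eval, hF.idx 0 rfl, hL]
  · intro k u v h
    simpa using h
  · simp [h3]
  · rintro l u hl hF hl5 ⟨g3, gB⟩
    refine Ht.le (Ht.seq (m := 7) (n := (T + 1) * 80)
      (R := fun s' => s'.idx 7 0 = l ∧ s'.val 5 0 = 0) (Ht.of_exec rfl le_rfl ?_) ?_) (by omega)
    · simp [Prog.exec, IExp.eval, RExp.eval, hl5]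
    rintro s₁ hF₁ ⟨f7, f5⟩
    refine Ht.forTo T 60 (fun k u => u.idx 7 0 = k * L + l ∧
      u.val 5 0 = rowPrefix (s.val 0) L l k ∧
      u.idx 3 0 = ∑ l ∈ Finset.range l, ∑ t ∈ Finset.range T,
        (if rowPrefix (s.val 0) L l (t + 1) = 0 then 0 else 2) + ∑ t ∈ Finset.range k,
        (if rowPrefix (s.val 0) L l (t + 1) = 0 then 0 else 2) ∧
      ∀ l' t, (l' < l ∧ t < T ∨ l' = l ∧ t < k) → rowPrefix (s.val 0) L l' (t + 1) ≠ 0 →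
        Listed (u.val 4) (u.idx 3 0) (rowPrefix (s.val 0) L l' (t + 1)) ∧
        Listed (u.val 4) (u.idx 3 0) (-rowPrefix (s.val 0) L l' (t + 1))) rfl ?_ ?_ ?_ ?_
        (by simp [IExp.steps]) ?_
    · intro u' hF'
      simp [IExp.eval, hF'.idx 0 rfl, hF₁.idx 0 rfl, hF.idx 0 rfl, hT]
    · intro k u v h
      simpa using h
    · simp only [f7, f5, hF₁.idx 3 rfl, hF₁.val 4 rfl, g3]
      refine ⟨by simp, by simp [rowPrefix], by simp, fun l' t h hne => ?_⟩
      rw [← g3]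
      exact gB l' (by omega) t (by omega) hne
    · rintro k w hk hFw hk6 ⟨e7, e5, e3, eB⟩
      refine Ht.of_exec rfl (by decide) ?_
      have hb : w.val 0 = s.val 0 := by rw [hFw.val 0 rfl, hF₁.val 0 rfl, hF.val 0 rfl]
      have h0 : w.idx 0 0 = L := by rw [hFw.idx 0 rfl, hF₁.idx 0 rfl, hF.idx 0 rfl, hL]
      have hp : rowPrefix (s.val 0) L l k + s.val 0 (k * L + l) =
          rowPrefix (s.val 0) L l (k + 1) := by
        simp [rowPrefix, Finset.sum_range_succ]
      -- Equality with zero is tested by two comparisons.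
      have hz : (rowPrefix (s.val 0) L l (k + 1) ≤ 0 ∧ 0 ≤ rowPrefix (s.val 0) L l (k + 1)) ↔
        rowPrefix (s.val 0) L l (k + 1) = 0 := le_antisymm_iff.symm
      simp only [Prog.exec, IExp.eval, RExp.eval, Test.Holds, Store.setIdx_val,
        Store.setVal_val_self, Function.update_self, Int.cast_zero, e7, e5, hb, hp, hz, h0,
        Store.setVal_idx]
      rw [Finset.sum_range_succ _ k]
      split_ifs with hzero
      · refine ⟨by simp; ring, by simp, by simp [e3], ?_⟩
        intro l' t h hne
        have := eB l' t (by
          rcases h with h | ⟨rfl, h⟩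
          · exact Or.inl h
          · refine Or.inr ⟨rfl, ?_⟩
            rcases Nat.lt_succ_iff_lt_or_eq.1 h with h | rfl
            · exact h
            · exact absurd hzero hne) hne
        simpa using this
      · refine ⟨by simp; ring, by simp, by simp [e3]; ring, ?_⟩
        intro l' t h hne
        simp
        by_cases hlt : l' = l ∧ t = k
        · obtain ⟨rfl, rfl⟩ := hlt
          refine ⟨⟨w.idx 3 0, by omega, ?_⟩, ⟨w.idx 3 0 + 1, by omega, by simp⟩⟩
          rw [Function.update_of_ne (by omega)]; simp
        · have := eB l' t (by omega) hne
          refine ⟨this.1.mono (by omega) fun j hj => ?_, this.2.mono (by omega) fun j hj => ?_⟩ <;>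
          rw [Function.update_of_ne (by omega), Function.update_of_ne (by omega)]
    · rintro u' ⟨-, -, e3, eB⟩
      refine ⟨by rw [e3, Finset.sum_range_succ], fun l' hl' t ht hne => eB l' t (by omega) hne⟩
  · simp only [IExp.steps]
    nlinarith

open Prog in
/-- Put `2 * L * T` into the index variable `11`. -/
def arcBoundP : Prog :=
  .seq (.iset 11 (.lit 0) (.lit 0))
    (forTo 5 (.get 0 (.lit 1))
      (.iset 11 (.lit 0) (.add (.var 11) (.add (.get 0 (.lit 0)) (.get 0 (.lit 0))))))

theorem arcBoundP_spec {O : ℕ → ℝ → ℝ} {s : Store} {L T : ℕ} (hL : s.idx 0 0 = L)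
    (hT : s.idx 0 1 = T) :
    Ht O arcBoundP s (40 * (T + 1)) (fun s' => s'.idx 11 0 = 2 * (T * L)) := by
  refine Ht.le (Ht.seq (m := 3) (n := (T + 1) * 24)
    (R := fun s' => s'.idx 11 0 = 0) (Ht.of_exec rfl le_rfl ?_) ?_) (by omega)
  · simp [Prog.exec, IExp.eval]
  · intro s₁ hF₁ h
    refine Ht.forTo T 10 (fun k u => u.idx 11 0 = 2 * (k * L)) rfl ?_ ?_ ?_ ?_
      (by simp [IExp.steps]) (fun _ h => h)
    · intro u hF
      simp [IExp.eval, hF.idx 0 rfl, hF₁.idx 0 rfl, hT]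
    · intro k u v h
      simpa using h
    · simp [h]
    · intro k u hk hF _ h
      refine Ht.of_exec rfl (by decide) ?_
      simp [Prog.exec, IExp.eval, h, hF.idx 0 rfl, hF₁.idx 0 rfl, hL]
      ring

end GridFlow

/-! ### Multiples of the distinct finite capacities -/

namespace GridFlow

/-- The finite capacities of the arcs with numbers less than `q`. -/
noncomputable def capsBelow (flag : ℕ → ℕ) (cap : ℕ → ℝ) (q : ℕ) : Finset ℝ :=
  ((Finset.range q).filter (1 ≤ flag ·)).image cap

theorem mem_capsBelow {flag : ℕ → ℕ} {cap : ℕ → ℝ} {q : ℕ} {x : ℝ} :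
    x ∈ capsBelow flag cap q ↔ ∃ r < q, 1 ≤ flag r ∧ cap r = x := by
  simp [capsBelow, and_assoc]

theorem capsBelow_succ_of_not {flag : ℕ → ℕ} {cap : ℕ → ℝ} {q : ℕ} (h : ¬ 1 ≤ flag q) :
    capsBelow flag cap (q + 1) = capsBelow flag cap q := by
  rw [capsBelow, Finset.range_add_one, Finset.filter_insert, if_neg h, capsBelow]

theorem capsBelow_succ {flag : ℕ → ℕ} {cap : ℕ → ℝ} {q : ℕ} (h : 1 ≤ flag q) :
    capsBelow flag cap (q + 1) = insert (cap q) (capsBelow flag cap q) := by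
  rw [capsBelow, Finset.range_add_one, Finset.filter_insert, if_pos h, Finset.image_insert,
    capsBelow]

theorem capsBelow_mono {flag : ℕ → ℕ} {cap : ℕ → ℝ} {q r : ℕ} (h : q ≤ r) :
    capsBelow flag cap q ⊆ capsBelow flag cap r := by
  intro x hx
  rw [mem_capsBelow] at hx ⊢
  obtain ⟨i, hi, h1⟩ := hx
  exact ⟨i, by omega, h1⟩

open Prog in
/-- Add to the list in real array `3` the multiples of every finite capacity. -/
def capsP : Prog :=
  forTo 12 (.var 11)
    (.seq (.iset 13 (.lit 0) (.lit 0))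
    (.seq (forTo 14 (.var 12)
        (.cond (.conj (.ile (.lit 1) (.get 1 (.var 14)))
            (.conj (.rle (.get 1 (.var 14)) (.get 1 (.var 12)))
              (.rle (.get 1 (.var 12)) (.get 1 (.var 14)))))
          (.iset 13 (.lit 0) (.lit 1)) .nop))
      (.cond (.conj (.ile (.lit 1) (.get 1 (.var 12))) (.ile (.var 13) (.lit 0)))
        (.seq (.rset 5 (.lit 0) (.get 1 (.var 12))) (.seq multiplesP addListP)) .nop)))

/-- The sign of `c` selects the block: block 0 for zero, odd-numbered blocks for positive and
even-numbered later blocks for negative multiples. -/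
theorem listed_add_int_mul {f g h : ℕ → ℝ} {M m : ℕ} {u x : ℝ} {c : ℤ} (hx : Listed f M x)
    (hc : |c| ≤ m) (h1 : ∀ i < M, g i = f i)
    (h2 : ∀ j < 2 * m, ∀ i < M, g (M * (j + 1) + i) = f i + h j)
    (h3 : ∀ j < m, h (2 * j) = (j + 1) * u ∧ h (2 * j + 1) = -((j + 1) * u)) :
    Listed g (M * (2 * m + 1)) (x + c * u) := by
  obtain ⟨i, hi, rfl⟩ := hx
  have hbd : ∀ j < 2 * m, M * (j + 1) + i < M * (2 * m + 1) := by
    intro j hj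
    have : M * (j + 1) + M ≤ M * (2 * m + 1) := by
      calc M * (j + 1) + M = M * (j + 2) := by ring
        _ ≤ _ := Nat.mul_le_mul_left _ (by omega)
    omega
  rcases lt_trichotomy c 0 with h | h | h
  · obtain ⟨j, hj⟩ : ∃ j : ℕ, c = -(j + 1 : ℤ) := ⟨(-c - 1).toNat, by omega⟩
    have hjm : j < m := by rw [hj, abs_neg, abs_of_nonneg (by omega)] at hc; omega
    refine ⟨M * (2 * j + 1 + 1) + i, hbd _ (by omega), ?_⟩
    rw [h2 _ (by omega) i hi, (h3 j hjm).2, hj]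
    push_cast
    ring
  · subst h
    refine ⟨i, by nlinarith, by simp [h1 i hi]⟩
  · obtain ⟨j, hj⟩ : ∃ j : ℕ, c = (j + 1 : ℤ) := ⟨(c - 1).toNat, by omega⟩
    have hjm : j < m := by rw [hj, abs_of_nonneg (by omega)] at hc; omega
    refine ⟨M * (2 * j + 1) + i, hbd _ (by omega), ?_⟩
    rw [h2 _ (by omega) i hi, (h3 j hjm).1, hj]
    push_cast
    ring

/-- Before a capacity is used, the earlier arcs are scanned for the same value. Each distinct value
therefore multiplies the length of the list by `2 * m + 1` only once, and the exponent is the number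
of values rather than the number of arcs. -/
theorem capsP_spec {O : ℕ → ℝ → ℝ} {s : Store} {m M₀ Mf : ℕ} (hm : s.idx 11 0 = m)
    (hM : s.idx 2 0 = M₀) (hM₀ : 1 ≤ M₀)
    (hMf : Mf = M₀ * (2 * m + 1) ^ (capsBelow (s.idx 1) (s.val 1) m).card) :
    Ht O capsP s (400 * ((m + 1) * (m + 1 + Mf))) (fun s' => s'.idx 2 0 = Mf ∧
      s'.val 3 0 = s.val 3 0 ∧
      ∀ c : ℝ → ℤ, (∀ u, |c u| ≤ m) → ∀ x, Listed (s.val 3) M₀ x →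
        Listed (s'.val 3) Mf (x + ∑ u ∈ capsBelow (s.idx 1) (s.val 1) m, c u * u)) := by
  refine Ht.forTo m (120 * (m + 1) + 120 * Mf + 60) (fun k t =>
    t.idx 2 0 = M₀ * (2 * m + 1) ^ (capsBelow (s.idx 1) (s.val 1) k).card ∧
      t.val 3 0 = s.val 3 0 ∧
      ∀ c : ℝ → ℤ, (∀ u, |c u| ≤ m) → ∀ x, Listed (s.val 3) M₀ x →
        Listed (t.val 3) (t.idx 2 0) (x + ∑ u ∈ capsBelow (s.idx 1) (s.val 1) k, c u * u))
    rfl ?_ ?_ ?_ ?_ ?_ ?_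
  · intro t hF
    simp [IExp.eval, hF.idx 11 rfl, hm]
  · intro k t v h
    simpa using h
  · simp [capsBelow, hM]
  · rintro k t hk hF hk12 ⟨g2, g0, gL⟩
    refine Ht.le (Ht.seq (m := 3) (n := 60 * (k + 1) + (60 * (m + 1) + 120 * Mf + 30))
      (R := fun s' => s'.idx 13 0 = 0) (Ht.of_exec rfl le_rfl ?_) ?_) (by omega)
    · simp [Prog.exec, IExp.eval]
    intro t₁ hF₁ h13
    refine Ht.seq (m := 60 * (k + 1)) (R := fun s' => s'.idx 13 0 = 0 ↔
      ∀ r < k, ¬ (1 ≤ s.idx 1 r ∧ s.val 1 r = s.val 1 k)) ?_ ?_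
    · refine Ht.forTo k 46 (fun q t => t.idx 13 0 = 0 ↔
        ∀ r < q, ¬ (1 ≤ s.idx 1 r ∧ s.val 1 r = s.val 1 k)) rfl ?_ ?_ ?_ ?_
        (by simp [IExp.steps]; omega) (fun _ h => h)
      · intro u hu
        simp [IExp.eval, hu.idx 12 rfl, hF₁.idx 12 rfl, hk12]
      · intro q u v h
        simpa using h
      · simp [h13]
      · intro q u hq hu hq14 h
        refine Ht.of_exec rfl (by decide) ?_
        have e1 : u.idx 1 = s.idx 1 := by rw [hu.idx 1 rfl, hF₁.idx 1 rfl, hF.idx 1 rfl]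
        have e2 : u.val 1 = s.val 1 := by rw [hu.val 1 rfl, hF₁.val 1 rfl, hF.val 1 rfl]
        have e3 : u.idx 12 0 = k := by rw [hu.idx 12 rfl, hF₁.idx 12 rfl, hk12]
        simp only [Prog.exec, IExp.eval, RExp.eval, Test.Holds, e1, e2, e3, hq14,
          ← le_antisymm_iff]
        split_ifs with hc
        · simp only [Store.setIdx_idx_self, Function.update_self, one_ne_zero, false_iff]
          intro h'
          exact h' q (by omega) hc
        · rw [h]
          refine ⟨fun h' r hr => ?_, fun h' r hr => h' r (by omega)⟩
          rcases Nat.lt_succ_iff_lt_or_eq.1 hr with hr | rfl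
          · exact h' r hr
          · exact hc
    · intro t₂ hF₂ h13'
      have e1 : t₂.idx 1 = s.idx 1 := by rw [hF₂.idx 1 rfl, hF₁.idx 1 rfl, hF.idx 1 rfl]
      have e2 : t₂.val 1 = s.val 1 := by rw [hF₂.val 1 rfl, hF₁.val 1 rfl, hF.val 1 rfl]
      have e3 : t₂.idx 12 0 = k := by rw [hF₂.idx 12 rfl, hF₁.idx 12 rfl, hk12]
      have e4 : t₂.idx 2 = t.idx 2 := by rw [hF₂.idx 2 rfl, hF₁.idx 2 rfl]
      have e5 : t₂.val 3 = t.val 3 := by rw [hF₂.val 3 rfl, hF₁.val 3 rfl]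
      have e6 : t₂.idx 11 0 = m := by rw [hF₂.idx 11 rfl, hF₁.idx 11 rfl, hF.idx 11 rfl, hm]
      refine Ht.le (Ht.cond (n := 60 * (m + 1) + 120 * Mf + 20) ?_ ?_)
        (by simp [Test.steps, IExp.steps]; omega)
      · rintro ⟨hc1, hc2⟩
        simp only [Test.Holds, IExp.eval, e1, e3] at hc1 hc2
        have hnew : s.val 1 k ∉ capsBelow (s.idx 1) (s.val 1) k := by
          rw [mem_capsBelow]
          rintro ⟨r, hr, h1⟩
          exact (h13'.1 (by omega)) r hr h1
        have hs := capsBelow_succ (cap := s.val 1) hc1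
        have hcard : (capsBelow (s.idx 1) (s.val 1) (k + 1)).card =
            (capsBelow (s.idx 1) (s.val 1) k).card + 1 := by
          rw [hs, Finset.card_insert_of_notMem hnew]
        set M := t.idx 2 0 with hMdef
        have hnext : M * (2 * m + 1) =
            M₀ * (2 * m + 1) ^ (capsBelow (s.idx 1) (s.val 1) (k + 1)).card := by
          rw [hcard, pow_succ, g2]; ring
        have hle : M * (2 * m + 1) ≤ Mf := by
          rw [hnext, hMf]
          exact Nat.mul_le_mul_left _ (Nat.pow_le_pow_right (by omega)
            (Finset.card_le_card (capsBelow_mono hk)))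
        have hM1 : 1 ≤ M := by
          rw [g2]
          exact Nat.mul_pos hM₀ (Nat.pow_pos (by omega))
        refine Ht.le (Ht.seq (m := 10) (n := 60 * (m + 1) + 60 * ((2 * m + 1) * (M + 1)))
          (R := fun s' => s'.val 5 0 = s.val 1 k) (Ht.of_exec rfl (by decide) ?_) ?_) (by nlinarith)
        · simp [Prog.exec, IExp.eval, RExp.eval, e2, e3]
        intro t₃ hF₃ h5
        refine Ht.seq (multiplesP_spec (m := m) (by rw [hF₃.idx 11 rfl, e6])) ?_
        rintro t₄ hF₄ ⟨h3, hB⟩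
        refine (addListP_spec (M := M) (β := 2 * m) (by rw [hF₄.idx 2 rfl, hF₃.idx 2 rfl, e4])
          h3).mono le_rfl ?_
        rintro t₅ hF₅ ⟨k2, kR, kS⟩
        have e7 : t₄.val 3 = t.val 3 := by rw [hF₄.val 3 rfl, hF₃.val 3 rfl, e5]
        rw [e7] at kR kS
        refine ⟨by rw [k2, hnext], by rw [kR 0 (by omega), g0], fun c hc x hx => ?_⟩
        have hl := gL c hc x hx
        rw [hs, Finset.sum_insert hnew, k2, add_comm (c _ * _ : ℝ), ← add_assoc]
        refine listed_add_int_mul hl (hc _) kR kS fun j hj => ?_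
        rw [← h5]
        exact hB j hj
      · intro hc
        simp only [Test.Holds, IExp.eval, e1, e3] at hc
        refine Ht.of_exec rfl (by simp [Prog.size]) ?_
        -- The test fails either for an infinite capacity or for one that has occurred before;
        -- neither changes the set of values.
        have hs : capsBelow (s.idx 1) (s.val 1) (k + 1) = capsBelow (s.idx 1) (s.val 1) k := by
          by_cases h1 : 1 ≤ s.idx 1 k
          · rw [capsBelow_succ h1, Finset.insert_eq_of_mem]
            by_contra hmem
            rw [mem_capsBelow] at hmem
            push Not at hmem
            refine hc ⟨h1, le_of_eq (h13'.2 fun r hr h => hmem r hr h.1 h.2)⟩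
          · exact capsBelow_succ_of_not h1
        simp only [Prog.exec, e4, e5, hs]
        exact ⟨g2, g0, gL⟩
  · simp only [IExp.steps]
    nlinarith
  · rintro t ⟨g2, g0, gL⟩
    rw [← hMf] at g2
    rw [g2] at gL
    exact ⟨g2, g0, gL⟩

end GridFlow

/-! ### The complete candidate list -/

namespace GridFlow

/-- The real number `x` is zero, or up to sign a prefix sum of the supplies in a row. -/
def IsPrefix (b : ℕ → ℝ) (L T : ℕ) (x : ℝ) : Prop :=
  x = 0 ∨ ∃ l < L, ∃ t < T, x = rowPrefix b L l (t + 1) ∨ x = -rowPrefix b L l (t + 1)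

open Classical in
/-- Twice the number of nonzero prefix sums. -/
noncomputable def prefixCount (b : ℕ → ℝ) (L T : ℕ) : ℕ :=
  ∑ l ∈ Finset.range L, ∑ t ∈ Finset.range T, (if rowPrefix b L l (t + 1) = 0 then 0 else 2)

theorem listed_add {f g h : ℕ → ℝ} {M β : ℕ} {x y : ℝ} (hx : Listed f M x)
    (hy : y = 0 ∨ Listed h β y) (h1 : ∀ i < M, g i = f i)
    (h2 : ∀ j < β, ∀ i < M, g (M * (j + 1) + i) = f i + h j) :
    Listed g (M * (β + 1)) (x + y) := by
  obtain ⟨i, hi, rfl⟩ := hx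
  rcases hy with rfl | ⟨j, hj, rfl⟩
  · exact ⟨i, by nlinarith, by simp [h1 i hi]⟩
  · refine ⟨M * (j + 1) + i, ?_, h2 j hj i hi⟩
    have : M * (j + 1) + M ≤ M * (β + 1) := by
      calc M * (j + 1) + M = M * (j + 2) := by ring
        _ ≤ _ := Nat.mul_le_mul_left _ (by omega)
    omega

open Prog in
/-- Put the list of candidate values into real array `3`; there are none but `0` if the grid has
a single row. -/
def candidatesP : Prog :=
  .seq (.iset 2 (.lit 0) (.lit 1))
    (.cond (.ile (.get 0 (.lit 0)) (.lit 1)) .nop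
      (.seq arcBoundP (.seq prefixesP (.seq addListP (.seq addListP capsP)))))

/-- In a single row, conservation determines the flow. The list is then the one cell that is already
present, and there is only one state, the empty tuple. -/
theorem candidatesP_spec_one {O : ℕ → ℝ → ℝ} {s : Store} (hL : s.idx 0 0 ≤ 1) :
    Ht O candidatesP s 20 (fun s' => s'.idx 2 0 = 1 ∧ s'.val 3 0 = s.val 3 0) := by
  refine Ht.le (Ht.seq (m := 3) (n := 10) (R := fun s' => s'.idx 2 0 = 1)
    (Ht.of_exec rfl le_rfl ?_) ?_) (by omega)
  · simp [Prog.exec, IExp.eval]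
  · intro s₁ hF₁ h2
    refine Ht.le (Ht.cond (n := 1) ?_ ?_) (by simp [Test.steps, IExp.steps])
    · intro _
      refine Ht.of_exec rfl le_rfl ?_
      simp [Prog.exec, h2, hF₁.val 3 rfl]
    · intro h
      exact absurd (by simpa [Test.Holds, IExp.eval, hF₁.idx 0 rfl] using hL) h

/-- The initial cell `0` is the starting list; adding the prefix sums twice and then the multiples
of each capacity gives the length `M`. The presence of a finite capacity yields `2 * m + 1 ≤ M`, so
that the quadratic scan over the arcs is absorbed by `T * L * M`. -/
theorem candidatesP_spec {O : ℕ → ℝ → ℝ} {s : Store} {L T m M : ℕ} (hL : s.idx 0 0 = L)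
    (hT : s.idx 0 1 = T) (hL2 : 2 ≤ L) (h3 : s.idx 3 0 = 0) (hR : s.val 3 0 = 0)
    (hT1 : 1 ≤ T) (hm : m = 2 * (T * L))
    (hK : 1 ≤ (capsBelow (s.idx 1) (s.val 1) m).card)
    (hM : M = (prefixCount (s.val 0) L T + 1) ^ 2 *
      (2 * m + 1) ^ (capsBelow (s.idx 1) (s.val 1) m).card) :
    Ht O candidatesP s (10000 * (T * L * M)) (fun s' => s'.idx 2 0 = M ∧ s'.val 3 0 = 0 ∧
      ∀ x y, IsPrefix (s.val 0) L T x → IsPrefix (s.val 0) L T y →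
        ∀ c : ℝ → ℤ, (∀ u, |c u| ≤ m) → Listed (s'.val 3) M
          (x + y + ∑ u ∈ capsBelow (s.idx 1) (s.val 1) m, c u * u)) := by
  set β := prefixCount (s.val 0) L T with hβ
  refine Ht.le (Ht.seq (m := 3) (n := 4 + (40 * (T + 1) + (120 * ((L + 1) * (T + 1)) +
    (60 * ((β + 1) * (1 + 1)) + (60 * ((β + 1) * (1 * (β + 1) + 1)) +
    400 * ((m + 1) * (m + 1 + M)))))))
    (R := fun s' => s'.idx 2 0 = 1) (Ht.of_exec rfl le_rfl ?_) ?_) ?_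
  · simp [Prog.exec, IExp.eval]
  · intro s₁ hF₁ h2
    refine Ht.cond ?_ ?_
    · intro h
      simp [Test.Holds, IExp.eval, hF₁.idx 0 rfl] at h
      omega
    intro _
    refine Ht.seq (arcBoundP_spec (L := L) (T := T) (by rw [hF₁.idx 0 rfl, hL])
      (by rw [hF₁.idx 0 rfl, hT])) ?_
    intro s₂ hF₂ h11
    refine Ht.seq (prefixesP_spec (L := L) (T := T) (by rw [hF₂.idx 0 rfl, hF₁.idx 0 rfl, hL])
      (by rw [hF₂.idx 0 rfl, hF₁.idx 0 rfl, hT]) (by rw [hF₂.idx 3 rfl, hF₁.idx 3 rfl, h3])) ?_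
    rintro s₃ hF₃ ⟨b3, bB⟩
    have hb : s₂.val 0 = s.val 0 := by rw [hF₂.val 0 rfl, hF₁.val 0 rfl]
    rw [hb] at b3 bB
    have b3 : s₃.idx 3 0 = β := by rw [b3, hβ]; rfl
    rw [b3] at bB
    have hW : ∀ x, IsPrefix (s.val 0) L T x → x = 0 ∨ Listed (s₃.val 4) β x := by
      rintro x (rfl | ⟨l, hl, t, ht, hx⟩)
      · exact Or.inl rfl
      · by_cases h0 : rowPrefix (s.val 0) L l (t + 1) = 0
        · left
          rcases hx with rfl | rfl <;> simp [h0]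
        · right
          rcases hx with rfl | rfl
          · exact (bB l hl t ht h0).1
          · exact (bB l hl t ht h0).2
    refine Ht.seq (addListP_spec (M := 1) (β := β) (by rw [hF₃.idx 2 rfl, hF₂.idx 2 rfl, h2]) b3) ?_
    rintro s₄ hF₄ ⟨c2, cR, cS⟩
    refine Ht.seq (addListP_spec (M := 1 * (β + 1)) (β := β) c2 (by rw [hF₄.idx 3 rfl, b3])) ?_
    rintro s₅ hF₅ ⟨d2, dR, dS⟩
    have f1 : s₅.idx 1 = s.idx 1 := by
      rw [hF₅.idx 1 rfl, hF₄.idx 1 rfl, hF₃.idx 1 rfl, hF₂.idx 1 rfl, hF₁.idx 1 rfl]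
    have f2 : s₅.val 1 = s.val 1 := by
      rw [hF₅.val 1 rfl, hF₄.val 1 rfl, hF₃.val 1 rfl, hF₂.val 1 rfl, hF₁.val 1 rfl]
    have f11 : s₅.idx 11 0 = m := by
      rw [hF₅.idx 11 rfl, hF₄.idx 11 rfl, hF₃.idx 11 rfl, h11, hm]
    have f3 : s₃.val 3 0 = 0 := by
      rw [hF₃.val 3 rfl, hF₂.val 3 rfl, hF₁.val 3 rfl, hR]
    have f4 : s₄.val 4 = s₃.val 4 := hF₄.val 4 rfl
    refine (capsP_spec (m := m) (Mf := M) f11 d2 (by nlinarith) ?_).mono le_rfl ?_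
    · rw [hM, f1, f2]; ring
    · rintro s₆ - ⟨e2, e0, eL⟩
      rw [f1, f2] at eL
      refine ⟨e2, ?_, fun x y hx hy c hc => eL c hc _ ?_⟩
      · rw [e0, dR 0 (by omega), cR 0 (by omega), f3]
      · refine listed_add (h := s₃.val 4) ?_ (hW y hy) dR (by rw [← f4]; exact dS)
        have := listed_add (f := s₃.val 3) (M := 1) (x := 0) ⟨0, by omega, f3⟩ (hW x hx) cR cS
        simpa using this
  · have hTL : 1 ≤ T * L := Nat.mul_pos hT1 (by omega)
    have h1 : (2 * m + 1) ≤ (2 * m + 1) ^ (capsBelow (s.idx 1) (s.val 1) m).card :=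
      Nat.le_self_pow (by omega) _
    have h2 : (2 * m + 1) ≤ M := by
      rw [hM]
      exact h1.trans (Nat.le_mul_of_pos_left _ (by positivity))
    have h3 : (β + 1) ^ 2 ≤ M := by
      rw [hM]
      exact Nat.le_mul_of_pos_right _ (by positivity)
    have h4 : M ≤ T * L * M := Nat.le_mul_of_pos_left _ hTL
    have h5 : T ≤ T * L := Nat.le_mul_of_pos_right _ (by omega)
    have h6 : L ≤ T * L := Nat.le_mul_of_pos_left _ (by omega)
    have h7 : β ≤ (β + 1) ^ 2 := by nlinarith
    have h8 : (m + 1) * (m + 1 + M) ≤ (3 * (T * L)) * (2 * M) :=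
      Nat.mul_le_mul (by omega) (by omega)
    have e1 : (L + 1) * (T + 1) = T * L + L + T + 1 := by ring
    have e2 : (β + 1) * (1 * (β + 1) + 1) = (β + 1) ^ 2 + β + 1 := by ring
    have e3 : (3 * (T * L)) * (2 * M) = 6 * (T * L * M) := by ring
    rw [e1, e2]
    omega

end GridFlow

namespace GridFlow

/-! ### The table of states

A state is a tuple of `L - 1` candidate values, numbered by its digits to the base `M`. Index
variable `15` holds the number of states. -/

open Prog in
/-- Put `M ^ (L - 1)` into the index variable `15`. -/
def powerP : Prog :=
  .seq (.iset 15 (.lit 0) (.lit 1))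
    (forTo 16 (.sub (.get 0 (.lit 0)) (.lit 1))
      (.seq (.iset 17 (.lit 0) (.lit 0))
      (.seq (forTo 18 (.var 2) (.iset 17 (.lit 0) (.add (.var 17) (.var 15))))
        (.iset 15 (.lit 0) (.var 17)))))

/-- Without multiplication, each power is formed by adding up `M` copies of the previous one. -/
theorem powerP_spec {O : ℕ → ℝ → ℝ} {s : Store} {L M : ℕ} (hL : s.idx 0 0 = L)
    (hM : s.idx 2 0 = M) :
    Ht O powerP s (60 * ((L - 1 + 1) * (M + 1))) (fun s' => s'.idx 15 0 = M ^ (L - 1)) := by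
  refine Ht.le (Ht.seq (m := 3) (n := (L - 1 + 1) * ((M + 1) * 21 + 26))
    (R := fun s' => s'.idx 15 0 = 1) (Ht.of_exec rfl le_rfl ?_) ?_) ?_
  · simp [Prog.exec, IExp.eval]
  · intro s₁ hF₁ h
    refine Ht.forTo (L - 1) ((M + 1) * 21 + 10) (fun k u => u.idx 15 0 = M ^ k) rfl ?_ ?_ ?_ ?_
      (by simp [IExp.steps]) (fun _ h => h)
    · intro u hF
      simp [IExp.eval, hF.idx 0 rfl, hF₁.idx 0 rfl, hL]
    · intro k u v h
      simpa using h
    · simp [h]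
    · intro k u hk hF _ h
      refine Ht.le (Ht.seq (m := 3) (n := (M + 1) * 21 + 4)
        (R := fun s' => s'.idx 17 0 = 0) (Ht.of_exec rfl le_rfl ?_) ?_) (by omega)
      · simp [Prog.exec, IExp.eval]
      intro s₂ hF₂ h17
      refine Ht.seq (m := (M + 1) * 21) (R := fun s' => s'.idx 17 0 = M * M ^ k) ?_ ?_
      · refine Ht.forTo M 7 (fun j u => u.idx 17 0 = j * M ^ k) rfl ?_ ?_ ?_ ?_
          (by simp [IExp.steps]) (fun _ h => h)
        · intro w hw
          simp [IExp.eval, hw.idx 2 rfl, hF₂.idx 2 rfl, hF.idx 2 rfl, hF₁.idx 2 rfl, hM]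
        · intro k u v h
          simpa using h
        · simp [h17]
        · intro j w hj hw _ hj'
          refine Ht.of_exec rfl (by decide) ?_
          simp [Prog.exec, IExp.eval, hj', hw.idx 15 rfl, hF₂.idx 15 rfl, h]
          ring
      · intro s₃ hF₃ h'
        refine Ht.of_exec rfl (by decide) ?_
        simp [Prog.exec, IExp.eval, h', pow_succ]
        ring
  · nlinarith

/-- The digit number `l` of `s` to the base `M`. -/
def digit (M s l : ℕ) : ℕ := s / M ^ l % M

open Prog in
/-- Fill real array `6` with the states: cells `s * L, ..., s * L + L - 2` hold the tuple numbered
`s`, and cell `s * L + L - 1` minus its sum. -/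
def statesP : Prog :=
  forTo 21 (.var 15)
    (.seq (.seq (.iset 22 (.lit 0) (.lit 1)) (.rset 10 (.lit 0) (.lit 0)))
    (.seq (forTo 23 (.sub (.get 0 (.lit 0)) (.lit 1))
        (.seq (.rset 6 (.add (.var 20) (.var 23)) (.get 3 (.get 19 (.add (.var 20) (.var 23)))))
        (.seq (.rset 10 (.lit 0) (.sub (.var 10) (.get 6 (.add (.var 20) (.var 23)))))
        (.seq (.iset 24 (.lit 0) (.add (.get 19 (.add (.var 20) (.var 23))) (.var 22)))
          (.cond (.ile (.var 2) (.var 24))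
            (.seq (.iset 19 (.add (.add (.var 20) (.get 0 (.lit 0))) (.var 23)) (.lit 0))
              (.iset 22 (.lit 0) (.lit 1)))
            (.seq (.iset 19 (.add (.add (.var 20) (.get 0 (.lit 0))) (.var 23)) (.var 24))
              (.iset 22 (.lit 0) (.lit 0))))))))
      (.seq (.rset 6 (.add (.var 20) (.sub (.get 0 (.lit 0)) (.lit 1))) (.var 10))
        (.iset 20 (.lit 0) (.add (.var 20) (.get 0 (.lit 0)))))))

theorem digit_lt {M s l : ℕ} (hM : 1 ≤ M) : digit M s l < M := Nat.mod_lt _ hM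

/-- The rule for carrying: when one is added to `s`, position `l` receives a carry exactly if all
lower digits are `M - 1`, that is, if `M ^ l` divides `s + 1`. Here the carry is passed on; the
companion `digit_succ_of_lt` treats the case in which it stops. -/
theorem digit_succ_of_le {M s l c : ℕ} (hM : 1 ≤ M) (hc : c = if M ^ l ∣ s + 1 then 1 else 0)
    (h : M ≤ digit M s l + c) : digit M (s + 1) l = 0 ∧ M ^ (l + 1) ∣ s + 1 := by
  have hlt := digit_lt (s := s) (l := l) hM
  split_ifs at hc with hd
  · subst hc
    have h2 : (s + 1) / M ^ l = s / M ^ l + 1 := by rw [Nat.succ_div, if_pos hd]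
    have h3 : M ∣ (s + 1) / M ^ l := by
      rw [h2]
      refine Nat.dvd_of_mod_eq_zero ?_
      unfold digit at h hlt
      have h4 : s / M ^ l % M + 1 = M := by omega
      rw [Nat.add_mod]
      -- To the base 1 the number one is not a digit, so this case is separate.
      rcases Nat.lt_or_ge 1 M with h5 | h5
      · rw [Nat.mod_eq_of_lt h5, h4, Nat.mod_self]
      · have : M = 1 := by omega
        subst this
        simp [Nat.mod_one]
    refine ⟨Nat.mod_eq_zero_of_dvd h3, ?_⟩
    rw [pow_succ]
    exact (Nat.dvd_div_iff_mul_dvd hd).1 h3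
  · omega

theorem digit_succ_of_lt {M s l c : ℕ} (hc : c = if M ^ l ∣ s + 1 then 1 else 0)
    (h : digit M s l + c < M) : digit M (s + 1) l = digit M s l + c ∧ ¬ M ^ (l + 1) ∣ s + 1 := by
  have h2 : (s + 1) / M ^ l = s / M ^ l + c := by rw [Nat.succ_div, hc]
  have h3 : digit M (s + 1) l = digit M s l + c := by
    have := Nat.mod_add_div (s / M ^ l) M
    unfold digit at h ⊢
    rw [h2]
    conv_lhs => rw [← this]
    rw [show s / M ^ l % M + M * (s / M ^ l / M) + c = s / M ^ l % M + c + M * (s / M ^ l / M)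
      by ring, Nat.add_mul_mod_self_left, Nat.mod_eq_of_lt h]
  refine ⟨h3, fun hd => ?_⟩
  have hd' : M ^ l ∣ s + 1 := (pow_dvd_pow M (Nat.le_succ l)).trans hd
  rw [if_pos hd'] at hc
  have : digit M (s + 1) l = 0 := by
    rw [digit]
    refine Nat.mod_eq_zero_of_dvd ?_
    rw [Nat.dvd_div_iff_mul_dvd hd', ← pow_succ]
    exact hd
  omega

/-- Division is not available, so the digits of each state are obtained from those of its
predecessor by adding one with carry. They are kept in index array `19`, whose first row is zero by
default. The last cell of a state is minus the sum of the others because the total flow through a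
cut does not depend on the state. -/
theorem statesP_spec {O : ℕ → ℝ → ℝ} {s : Store} {L M S : ℕ} (hL : s.idx 0 0 = L)
    (hL1 : 1 ≤ L) (hM1 : 1 ≤ M)
    (hM : s.idx 2 0 = M) (hS : s.idx 15 0 = S) (h20 : s.idx 20 0 = 0) (h19 : s.idx 19 = 0) :
    Ht O statesP s (200 * ((S + 1) * L)) (fun s' => ∀ k < S,
      (∀ l < L - 1, s'.val 6 (k * L + l) = s.val 3 (digit M k l)) ∧
      s'.val 6 (k * L + (L - 1)) = -∑ l ∈ Finset.range (L - 1), s.val 3 (digit M k l)) := by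
  refine Ht.forTo S (100 * L + 30) (fun n t => t.idx 20 0 = n * L ∧
    (∀ l < L - 1, t.idx 19 (n * L + l) = digit M n l) ∧
    ∀ k < n, (∀ l < L - 1, t.val 6 (k * L + l) = s.val 3 (digit M k l)) ∧
      t.val 6 (k * L + (L - 1)) = -∑ l ∈ Finset.range (L - 1), s.val 3 (digit M k l))
      rfl ?_ ?_ ?_ ?_ ?_ (fun _ h => h.2.2)
  · intro t hF
    simp [IExp.eval, hF.idx 15 rfl, hS]
  · intro k t v h
    simpa using h
  · simp [h20, h19, digit]
  · rintro n t hn hF - ⟨g20, g19, gV⟩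
    refine Ht.le (Ht.seq (m := 6) (n := 100 * L + 20)
      (R := fun s' => s'.idx 22 0 = 1 ∧ s'.val 10 0 = 0) (Ht.of_exec rfl le_rfl ?_) ?_)
      (by omega)
    · simp [Prog.exec, IExp.eval, RExp.eval]
    rintro t₁ hF₁ ⟨h22, h10⟩
    -- The blocks of different states are disjoint, so writing state `n` leaves the earlier ones
    -- intact.
    have hp : ∀ k l l', k < n → l < L → k * L + l ≠ n * L + l' := by
      intro k l l' hk hl
      have : (k + 1) * L ≤ n * L := Nat.mul_le_mul_right _ hk
      have : (k + 1) * L = k * L + L := by ring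
      omega
    refine Ht.seq (m := 100 * L) (R := fun u =>
      (∀ l < L - 1, u.idx 19 (n * L + L + l) = digit M (n + 1) l) ∧
      u.val 10 0 = -∑ l ∈ Finset.range (L - 1), s.val 3 (digit M n l) ∧
      (∀ k < n, (∀ l < L - 1, u.val 6 (k * L + l) = s.val 3 (digit M k l)) ∧
      u.val 6 (k * L + (L - 1)) = -∑ l ∈ Finset.range (L - 1), s.val 3 (digit M k l)) ∧
      ∀ l < L - 1, u.val 6 (n * L + l) = s.val 3 (digit M n l)) ?_ ?_
    · refine Ht.forTo (L - 1) 82 (fun j u =>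
        u.idx 22 0 = (if M ^ j ∣ n + 1 then 1 else 0) ∧
        (∀ l < L - 1, u.idx 19 (n * L + l) = digit M n l) ∧
        (∀ l < j, u.idx 19 (n * L + L + l) = digit M (n + 1) l) ∧
        u.val 10 0 = -∑ l ∈ Finset.range j, s.val 3 (digit M n l) ∧
        (∀ k < n, (∀ l < L - 1, u.val 6 (k * L + l) = s.val 3 (digit M k l)) ∧
        u.val 6 (k * L + (L - 1)) = -∑ l ∈ Finset.range (L - 1), s.val 3 (digit M k l)) ∧
        ∀ l < j, u.val 6 (n * L + l) = s.val 3 (digit M n l)) rfl ?_ ?_ ?_ ?_ ?_ ?_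
      · intro u hu
        simp [IExp.eval, hu.idx 0 rfl, hF₁.idx 0 rfl, hF.idx 0 rfl, hL]
      · intro k u v h
        simpa using h
      · simp only [h22, h10, hF₁.idx 19 rfl, hF₁.val 6 rfl]
        simpa using ⟨g19, gV⟩
      · rintro j u hj hu hj23 ⟨f22, f19, f19', f10, fV, fV'⟩
        have e20 : u.idx 20 0 = n * L := by rw [hu.idx 20 rfl, hF₁.idx 20 rfl, g20]
        have e0 : u.idx 0 0 = L := by rw [hu.idx 0 rfl, hF₁.idx 0 rfl, hF.idx 0 rfl, hL]
        have e2 : u.idx 2 0 = M := by rw [hu.idx 2 rfl, hF₁.idx 2 rfl, hF.idx 2 rfl, hM]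
        have e3 : u.val 3 = s.val 3 := by rw [hu.val 3 rfl, hF₁.val 3 rfl, hF.val 3 rfl]
        have fj := f19 j hj
        refine Ht.of_exec rfl (by decide) ?_
        generalize hc : (if M ^ j ∣ n + 1 then 1 else 0) = c at f22
        simp [Prog.exec, IExp.eval, RExp.eval, Test.Holds, e20, e0, e2, e3, fj, f22, hj23, f10]
        have hval : (∀ k < n, (∀ l < L - 1, Function.update (u.val 6) (n * L + j)
            (s.val 3 (digit M n j)) (k * L + l) = s.val 3 (digit M k l)) ∧
            Function.update (u.val 6) (n * L + j) (s.val 3 (digit M n j)) (k * L + (L - 1)) =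
              -∑ l ∈ Finset.range (L - 1), s.val 3 (digit M k l)) ∧
            ∀ l < j + 1, Function.update (u.val 6) (n * L + j)
              (s.val 3 (digit M n j)) (n * L + l) = s.val 3 (digit M n l) := by
          refine ⟨fun k hk => ⟨fun l hl => ?_, ?_⟩, fun l hl => ?_⟩
          · rw [Function.update_of_ne (hp _ _ _ hk (by omega)), (fV k hk).1 l hl]
          · rw [Function.update_of_ne (hp _ _ _ hk (by omega)), (fV k hk).2]
          · rcases Nat.lt_succ_iff_lt_or_eq.1 hl with hl | rfl
            · rw [Function.update_of_ne (by omega), fV' l hl]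
            · simp
        have hsum : -∑ l ∈ Finset.range j, s.val 3 (digit M n l) - s.val 3 (digit M n j) =
            -∑ l ∈ Finset.range (j + 1), s.val 3 (digit M n l) := by
          rw [Finset.sum_range_succ]; ring
        by_cases hle : M ≤ digit M n j + c
        · rw [if_pos hle]
          obtain ⟨hd1, hd2⟩ := digit_succ_of_le hM1 hc.symm hle
          refine ⟨by simp [hd2], fun l hl => ?_, fun l hl => ?_, by simpa using hsum,
            by simpa using hval.1, by simpa [Nat.lt_succ_iff] using hval.2⟩
          · simp
            rw [Function.update_of_ne (by omega), f19 l hl]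
          · simp
            rcases hl.lt_or_eq with hl | rfl
            · rw [Function.update_of_ne (by omega), f19' l hl]
            · simp [hd1]
        · rw [if_neg hle]
          obtain ⟨hd1, hd2⟩ := digit_succ_of_lt hc.symm (not_le.1 hle)
          refine ⟨by simp [hd2], fun l hl => ?_, fun l hl => ?_, by simpa using hsum,
            by simpa using hval.1, by simpa [Nat.lt_succ_iff] using hval.2⟩
          · simp
            rw [Function.update_of_ne (by omega), f19 l hl]
          · simp
            rcases hl.lt_or_eq with hl | rfl
            · rw [Function.update_of_ne (by omega), f19' l hl]
            · simp [hd1]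
      · simp only [IExp.steps]
        rw [Nat.sub_add_cancel hL1]
        omega
      · rintro u ⟨-, -, f19', f10, fV, fV'⟩
        exact ⟨f19', f10, fV, fV'⟩
    · rintro u hu ⟨f19, f10, fV, fV'⟩
      have e20 : u.idx 20 0 = n * L := by rw [hu.idx 20 rfl, hF₁.idx 20 rfl, g20]
      have e0 : u.idx 0 0 = L := by rw [hu.idx 0 rfl, hF₁.idx 0 rfl, hF.idx 0 rfl, hL]
      refine Ht.of_exec rfl (by decide) ?_
      simp [Prog.exec, IExp.eval, RExp.eval, e20, e0, f10]
      refine ⟨by ring, fun l hl => ?_, fun k hk => ?_⟩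
      · rw [add_one_mul, f19 l hl]
      · rcases hk.lt_or_eq with hk | rfl
        · refine ⟨fun l hl => ?_, ?_⟩
          · rw [Function.update_of_ne (hp _ _ _ hk (by omega)), (fV k hk).1 l hl]
          · rw [Function.update_of_ne (hp _ _ _ hk (by omega)), (fV k hk).2]
        · refine ⟨fun l hl => ?_, by simp⟩
          rw [Function.update_of_ne (by omega), fV' l hl]
  · simp only [IExp.steps]
    nlinarith

end GridFlow

namespace GridFlow

/-! ### The dynamic program

A layer is a cut between two columns. The flow on the arcs of a layer is described by a state;
real array `7` holds the offsets that have to be added to the last entries of the states. -/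

open Prog in
/-- Put the total supply of the first `t` columns into cell `t * L + L - 1` of real array `7`. -/
def totalsP : Prog :=
  .seq (.rset 5 (.lit 0) (.lit 0))
  (.seq (.iset 7 (.lit 0) (.lit 0))
    (forTo 25 (.get 0 (.lit 1))
      (.seq (forTo 26 (.get 0 (.lit 0))
          (.seq (.rset 5 (.lit 0) (.add (.var 5) (.get 0 (.var 7))))
            (.iset 7 (.lit 0) (.add (.var 7) (.lit 1)))))
        (.rset 7 (.add (.var 7) (.sub (.get 0 (.lit 0)) (.lit 1))) (.var 5)))))

/-- The flow through the cut before column `t` has to equal the supply of the columns to its left.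
This offset, independent of the state, is credited to the last row. -/
theorem totalsP_spec {O : ℕ → ℝ → ℝ} {s : Store} {L T : ℕ} (hL : s.idx 0 0 = L)
    (hT : s.idx 0 1 = T) (hL1 : 1 ≤ L) (h7 : s.val 7 = 0) :
    Ht O totalsP s (60 * ((T + 1) * (L + 1))) (fun s' => ∀ t ≤ T, ∀ l < L, s'.val 7 (t * L + l) =
      if l = L - 1 then ∑ q ∈ Finset.range (t * L), s.val 0 q else 0) := by
  refine Ht.le (Ht.seq (m := 3) (n := 3 + (T + 1) * ((L + 1) * 30 + 30))
    (R := fun s' => s'.val 5 0 = 0) (Ht.of_exec rfl le_rfl ?_) ?_) ?_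
  · simp [Prog.exec, IExp.eval, RExp.eval]
  · intro s₁ hF₁ h5
    refine Ht.seq (R := fun s' => s'.idx 7 0 = 0) (Ht.of_exec rfl le_rfl ?_) ?_
    · simp [Prog.exec, IExp.eval]
    intro s₂ hF₂ h7'
    refine Ht.forTo T ((L + 1) * 30 + 15) (fun k u => u.idx 7 0 = k * L ∧
      u.val 5 0 = ∑ q ∈ Finset.range (k * L), s.val 0 q ∧
      (∀ c, (k + 1) * L ≤ c → u.val 7 c = 0) ∧ ∀ t ≤ k, ∀ l < L, u.val 7 (t * L + l) =
      if l = L - 1 then ∑ q ∈ Finset.range (t * L), s.val 0 q else 0) rfl ?_ ?_ ?_ ?_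
      (by simp [IExp.steps]) (fun _ h => h.2.2.2)
    · intro u hF
      simp [IExp.eval, hF.idx 0 rfl, hF₂.idx 0 rfl, hF₁.idx 0 rfl, hT]
    · intro k u v h
      simpa using h
    · have : s₂.val 7 = 0 := by rw [hF₂.val 7 rfl, hF₁.val 7 rfl, h7]
      simp [h7', hF₂.val 5 rfl, h5, this]
    · rintro k u hk hF - ⟨g7, g5, gz, gA⟩
      have eL : ∀ w : Store, w.idx 0 = u.idx 0 → w.idx 0 0 = L := by
        intro w hw
        rw [hw, hF.idx 0 rfl, hF₂.idx 0 rfl, hF₁.idx 0 rfl, hL]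
      refine Ht.le (Ht.seq (m := (L + 1) * 30) (n := 15) (R := fun w => w.idx 7 0 = k * L + L ∧
        w.val 5 0 = ∑ q ∈ Finset.range (k * L + L), s.val 0 q) ?_ ?_) (by omega)
      · refine Ht.forTo L 16 (fun j w => w.idx 7 0 = k * L + j ∧
          w.val 5 0 = ∑ q ∈ Finset.range (k * L + j), s.val 0 q) rfl ?_ ?_ ?_ ?_
          (by simp only [IExp.steps]; omega) (fun _ h => h)
        · intro w hw
          simp [IExp.eval, eL w (hw.idx 0 rfl)]
        · intro k u v h
          simpa using h
        · simpa using ⟨g7, g5⟩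
        · rintro j w hj hw - ⟨e7, e5⟩
          refine Ht.of_exec rfl (by decide) ?_
          have hb : w.val 0 = s.val 0 := by rw [hw.val 0 rfl, hF.val 0 rfl, hF₂.val 0 rfl, hF₁.val 0 rfl]
          simp [Prog.exec, IExp.eval, RExp.eval, e7, e5, hb, ← add_assoc,
            Finset.sum_range_succ]
      · rintro w hw ⟨e7, e5⟩
        refine Ht.of_exec rfl (by decide) ?_
        simp only [Prog.exec, IExp.eval, RExp.eval, e7, e5, eL w (hw.idx 0 rfl), Store.setVal_idx,
          Store.setVal_val_self, hw.val 7 rfl]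
        have e : (k + 1) * L = k * L + L := by ring
        refine ⟨e.symm, ?_, fun c hc => ?_, fun t ht l hl => ?_⟩
        · simp [e, e5]
        · rw [Function.update_of_ne, gz c]
          · nlinarith
          · have : (k + 1 + 1) * L = k * L + L + L := by ring
            omega
        · rcases ht.lt_or_eq with ht | rfl
          · rw [Function.update_of_ne, gA t (by omega) l hl]
            have : (t + 1) * L ≤ (k + 1) * L := Nat.mul_le_mul_right _ ht
            have : (t + 1) * L = t * L + L := by ring
            omega
          · rw [e]
            split_ifs with h
            · subst h
              simp
            · rw [Function.update_of_ne (by omega), gz _ (by omega)]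
  · nlinarith

/-- The data of the dynamic program. -/
structure Tables where
  L : ℕ
  b : ℕ → ℝ
  flag : ℕ → ℕ
  cap : ℕ → ℝ
  V : ℕ → ℝ
  A : ℕ → ℝ
  O : ℕ → ℝ → ℝ

namespace Tables

variable (D : Tables)

/-- The flow that enters the vertex `(l, t)` from the left if layer `t` is in state `s`. -/
def entry (t s l : ℕ) : ℝ := D.V (s * D.L + l) + D.A (t * D.L + l)

/-- The flow that leaves the vertex `(l, t)` downwards if the layers before and after column `t` are
in the states `s` and `s'`. -/
def vert (t s s' l : ℕ) : ℝ :=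
  ∑ i ∈ Finset.range (l + 1), (D.b (t * D.L + i) + D.entry t s i - D.entry (t + 1) s' i)

/-- The number `x` satisfies the bounds of the arc numbered `q`. -/
def InCap (q : ℕ) (x : ℝ) : Prop := 0 ≤ x ∧ (1 ≤ D.flag q → x ≤ D.cap q)

/-- The flows on the arcs that leave the vertex `(l, t)` satisfy the bounds. -/
def VertexOk (t s s' l : ℕ) : Prop :=
  D.InCap (2 * (t * D.L + l)) (D.entry (t + 1) s' l) ∧
    D.InCap (2 * (t * D.L + l) + 1) (D.vert t s s' l)

/-- The cost of the arcs that leave the vertex `(l, t)`. -/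
def vertexCost (t s s' l : ℕ) : ℝ :=
  D.O (2 * (t * D.L + l)) (D.entry (t + 1) s' l) +
    D.O (2 * (t * D.L + l) + 1) (D.vert t s s' l)

/-- The transition from `s` to `s'` in column `t` is feasible. -/
def TransOk (t s s' : ℕ) : Prop := ∀ l < D.L, D.VertexOk t s s' l

/-- The cost of the transition from `s` to `s'` in column `t`. -/
def transCost (t s s' : ℕ) : ℝ := ∑ l ∈ Finset.range D.L, D.vertexCost t s s' l

/-- The arrays that hold the data. -/
structure Stored (O : ℕ → ℝ → ℝ) (s : Store) : Prop where
  hL : s.idx 0 0 = D.L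
  hb : s.val 0 = D.b
  hflag : s.idx 1 = D.flag
  hcap : s.val 1 = D.cap
  hV : s.val 6 = D.V
  hA : s.val 7 = D.A
  hO : O = D.O

variable {D} in
theorem Stored.congr {O : ℕ → ℝ → ℝ} {s s' : Store} (h : D.Stored O s) (h0 : s'.idx 0 = s.idx 0)
    (h1 : s'.val 0 = s.val 0) (h2 : s'.idx 1 = s.idx 1) (h3 : s'.val 1 = s.val 1)
    (h4 : s'.val 6 = s.val 6) (h5 : s'.val 7 = s.val 7) : D.Stored O s' :=
  ⟨by rw [h0, h.hL], by rw [h1, h.hb], by rw [h2, h.hflag], by rw [h3, h.hcap], by rw [h4, h.hV],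
    by rw [h5, h.hA], h.hO⟩

end Tables

/-- The bounds of the arc numbered `q` for the value `x`. -/
def capTest (q : IExp) (x : RExp) : Test :=
  .conj (.rle (.lit 0) x) (.neg (.conj (.ile (.lit 1) (.get 1 q)) (.neg (.rle x (.get 1 q)))))

open Prog in
/-- Compute into `14` and `12` the flows on the arcs that leave the vertex in row `37`. -/
def flowsP : Prog :=
  .seq (.iset 42 (.lit 0) (.add (.var 28) (.var 37)))
  (.seq (.rset 14 (.lit 0) (.add (.get 6 (.add (.var 33) (.var 37)))
      (.get 7 (.add (.var 42) (.get 0 (.lit 0))))))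
    (.rset 12 (.lit 0) (.add (.var 12) (.sub (.add (.get 0 (.var 42))
      (.add (.get 6 (.add (.var 35) (.var 37))) (.get 7 (.var 42)))) (.var 14)))))

/-- Going down a column, the downward flow is a running sum of supply plus inflow minus outflow, so
each vertex costs constant time. -/
theorem flowsP_spec {O : ℕ → ℝ → ℝ} {D : Tables} {u : Store} {t s s' l : ℕ}
    (hD : D.Stored O u) (h28 : u.idx 28 0 = t * D.L) (h33 : u.idx 33 0 = s' * D.L)
    (h35 : u.idx 35 0 = s * D.L) (h37 : u.idx 37 0 = l)
    (h12 : u.val 12 0 = ∑ i ∈ Finset.range l,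
      (D.b (t * D.L + i) + D.entry t s i - D.entry (t + 1) s' i)) :
    Ht O flowsP u 50 (fun w => w.idx 42 0 = t * D.L + l ∧
      w.val 14 0 = D.entry (t + 1) s' l ∧ w.val 12 0 = D.vert t s s' l) := by
  refine Ht.of_exec rfl (by decide) ?_
  have e : t * D.L + l + D.L = (t + 1) * D.L + l := by ring
  simp [flowsP, Prog.exec, IExp.eval, RExp.eval, h28, h33, h35, h37, h12, hD.hL, hD.hV,
    hD.hA, hD.hb, e, Tables.vert, Finset.sum_range_succ]
  simp only [Tables.entry]
  exact ⟨trivial, by ring⟩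

open Prog in
/-- Test the transition from the state at `35` to the state at `33` in the column at `28`, and add
its cost to `13`. -/
def transP : Prog :=
  .seq (.seq (.iset 36 (.lit 0) (.lit 1)) (.rset 12 (.lit 0) (.lit 0)))
    (forTo 37 (.get 0 (.lit 0))
      (.seq flowsP
        (.seq (.cond (.conj (capTest (.add (.var 42) (.var 42)) (.var 14))
            (capTest (.add (.add (.var 42) (.var 42)) (.lit 1)) (.var 12))) .nop
            (.iset 36 (.lit 0) (.lit 0)))
        (.seq (.query 15 (.lit 0) (.add (.var 42) (.var 42)) (.var 14))
        (.seq (.rset 13 (.lit 0) (.add (.var 13) (.var 15)))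
        (.seq (.query 15 (.lit 0) (.add (.add (.var 42) (.var 42)) (.lit 1)) (.var 12))
          (.rset 13 (.lit 0) (.add (.var 13) (.var 15)))))))))

/-- A transition takes time linear in `D.L`. The cost is accumulated even after a bound has failed;
the flag in variable `36` decides later whether it is used. -/
theorem transP_spec {O : ℕ → ℝ → ℝ} {D : Tables} {u : Store} {t s s' : ℕ}
    (hD : D.Stored O u) (h28 : u.idx 28 0 = t * D.L) (h33 : u.idx 33 0 = s' * D.L)
    (h35 : u.idx 35 0 = s * D.L) :
    Ht O transP u (220 * (D.L + 1)) (fun w => (1 ≤ w.idx 36 0 ↔ D.TransOk t s s') ∧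
      w.val 13 0 = u.val 13 0 + D.transCost t s s') := by
  refine Ht.le (Ht.seq (m := 6) (n := (D.L + 1) * 210)
    (R := fun s' => s'.idx 36 0 = 1 ∧ s'.val 12 0 = 0) (Ht.of_exec rfl le_rfl ?_) ?_) (by omega)
  · simp [Prog.exec, IExp.eval, RExp.eval]
  rintro u₁ hF₁ ⟨h36, h12⟩
  refine Ht.forTo D.L 190 (fun j w => (1 ≤ w.idx 36 0 ↔ ∀ l < j, D.VertexOk t s s' l) ∧
    w.val 12 0 = ∑ i ∈ Finset.range j,
      (D.b (t * D.L + i) + D.entry t s i - D.entry (t + 1) s' i) ∧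
    w.val 13 0 = u.val 13 0 + ∑ l ∈ Finset.range j, D.vertexCost t s s' l)
    rfl ?_ ?_ ?_ ?_ (by simp only [IExp.steps]; omega) (fun _ h => ⟨h.1, h.2.2⟩)
  · intro w hw
    simp [IExp.eval, hw.idx 0 rfl, hF₁.idx 0 rfl, hD.hL]
  · intro k u v h
    simpa using h
  · simp [h36, h12, hF₁.val 13 rfl]
  · rintro j w hj hw hj37 ⟨g36, g12, g13⟩
    have hDw : D.Stored O w := hD.congr (by rw [hw.idx 0 rfl, hF₁.idx 0 rfl]) (by rw [hw.val 0 rfl, hF₁.val 0 rfl])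
      (by rw [hw.idx 1 rfl, hF₁.idx 1 rfl]) (by rw [hw.val 1 rfl, hF₁.val 1 rfl]) (by rw [hw.val 6 rfl, hF₁.val 6 rfl])
      (by rw [hw.val 7 rfl, hF₁.val 7 rfl])
    refine Ht.le (Ht.seq (n := 140) (flowsP_spec (t := t) (s := s) (s' := s') hDw
      (by rw [hw.idx 28 rfl, hF₁.idx 28 rfl, h28]) (by rw [hw.idx 33 rfl, hF₁.idx 33 rfl, h33])
      (by rw [hw.idx 35 rfl, hF₁.idx 35 rfl, h35]) hj37 g12) ?_) (by omega)
    rintro x hx ⟨x42, x14, x12⟩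
    refine Ht.of_exec rfl (by decide) ?_
    have x1 : x.idx 1 = D.flag := by rw [hx.idx 1 rfl, hDw.hflag]
    have x2 : x.val 1 = D.cap := by rw [hx.val 1 rfl, hDw.hcap]
    have x36 : x.idx 36 = w.idx 36 := hx.idx 36 rfl
    have x13 : x.val 13 = w.val 13 := hx.val 13 rfl
    have ht : (Test.conj (capTest (.add (.var 42) (.var 42)) (.var 14))
        (capTest (.add (.add (.var 42) (.var 42)) (.lit 1)) (.var 12))).Holds x ↔
        D.VertexOk t s s' j := by
      simp [Test.Holds, capTest, IExp.eval, RExp.eval, x1, x2, x42, x14, x12, Tables.VertexOk,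
        Tables.InCap, ← two_mul]
    -- The oracle calls that follow the capacity test are the same for both outcomes and are
    -- analysed once.
    have hc : ∀ y : Store, y.val = x.val → y.idx 42 = x.idx 42 →
        (y.idx 36 = x.idx 36 ∧ D.VertexOk t s s' j ∨ y.idx 36 0 = 0 ∧ ¬ D.VertexOk t s s' j) →
        (fun w => (1 ≤ w.idx 36 0 ↔ ∀ l < j + 1, D.VertexOk t s s' l) ∧
          w.val 12 0 = ∑ i ∈ Finset.range (j + 1),
            (D.b (t * D.L + i) + D.entry t s i - D.entry (t + 1) s' i) ∧
          w.val 13 0 = u.val 13 0 + ∑ l ∈ Finset.range (j + 1), D.vertexCost t s s' l)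
        (Prog.exec O (.seq (.query 15 (.lit 0) (.add (.var 42) (.var 42)) (.var 14))
        (.seq (.rset 13 (.lit 0) (.add (.var 13) (.var 15)))
        (.seq (.query 15 (.lit 0) (.add (.add (.var 42) (.var 42)) (.lit 1)) (.var 12))
          (.rset 13 (.lit 0) (.add (.var 13) (.var 15)))))) y) := by
      intro y hyv hyi hy36
      simp [Prog.exec, IExp.eval, RExp.eval, hyv, hyi, x42, x14, x12, x13, g13]
      refine ⟨?_, by rw [Tables.vert, Finset.sum_sub_distrib], ?_⟩
      · rcases hy36 with ⟨h, hok⟩ | ⟨h, hok⟩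
        · rw [h, x36, g36]
          refine ⟨fun h' l hl => ?_, fun h' l hl => h' l (by omega)⟩
          rcases hl.lt_or_eq with hl | rfl
          · exact h' l hl
          · exact hok
        · rw [h]
          exact ⟨fun h0 => absurd h0 (by omega), fun h' => absurd (h' j le_rfl) hok⟩
      · rw [Finset.sum_range_succ, Tables.vertexCost, ← hD.hO, two_mul]
        ring
    unfold Prog.exec
    simp only [Prog.exec] at hc ⊢
    by_cases hok : D.VertexOk t s s' j
    · rw [if_pos (ht.2 hok)]
      exact hc x rfl rfl (Or.inl ⟨rfl, hok⟩)
    · rw [if_neg (fun h => hok (ht.1 h))]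
      exact hc _ (by simp) (by simp) (Or.inr ⟨by simp [IExp.eval], hok⟩)

end GridFlow

/-! ### Relaxation of one transition and the invariant of the tables -/

namespace GridFlow

namespace Tables

variable (D : Tables)

/-- The entries of the arrays for layer `t + 1` and state `s'` are correct, when the predecessors
`s < n` have been considered. Index array `29` marks the reachable states, real array `11` holds
their costs, and index arrays `30` and `41` the predecessor and its position. -/
structure CellOk (S : ℕ) (u : Store) (t s' n : ℕ) : Prop where
  reached : 1 ≤ u.idx 29 ((t + 1) * S + s') → u.idx 30 ((t + 1) * S + s') < n ∧
    1 ≤ u.idx 29 (t * S + u.idx 30 ((t + 1) * S + s')) ∧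
    D.TransOk t (u.idx 30 ((t + 1) * S + s')) s' ∧
    u.val 11 ((t + 1) * S + s') = u.val 11 (t * S + u.idx 30 ((t + 1) * S + s')) +
      D.transCost t (u.idx 30 ((t + 1) * S + s')) s' ∧
    u.idx 41 ((t + 1) * S + s') = u.idx 30 ((t + 1) * S + s') * D.L
  best : ∀ s < n, 1 ≤ u.idx 29 (t * S + s) → D.TransOk t s s' →
    1 ≤ u.idx 29 ((t + 1) * S + s') ∧
    u.val 11 ((t + 1) * S + s') ≤ u.val 11 (t * S + s) + D.transCost t s s'

/-- The two stores have the same entries of the arrays of the dynamic program up to cell `c`. -/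
structure SameBelow (u u' : Store) (c : ℕ) : Prop where
  h29 : ∀ i < c, u'.idx 29 i = u.idx 29 i
  h30 : ∀ i < c, u'.idx 30 i = u.idx 30 i
  h41 : ∀ i < c, u'.idx 41 i = u.idx 41 i
  h11 : ∀ i < c, u'.val 11 i = u.val 11 i

variable {D}

/-- The condition refers only to the cell itself and, because `n ≤ S`, to cells of the preceding
layer. All of these lie before `c`. -/
theorem CellOk.congr {S : ℕ} {u u' : Store} {t s' n c : ℕ} (h : D.CellOk S u t s' n)
    (hu : SameBelow u u' c) (hn : n ≤ S) (hc : (t + 1) * S + s' < c) : D.CellOk S u' t s' n := by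
  have hS : (t + 1) * S = t * S + S := by ring
  refine ⟨fun hr => ?_, fun s hs hr hok => ?_⟩
  · rw [hu.h29 _ hc] at hr
    obtain ⟨h1, h2⟩ := h.reached hr
    rw [hu.h30 _ hc, hu.h29 _ (by omega), hu.h41 _ hc, hu.h11 _ hc, hu.h11 _ (by omega)]
    exact ⟨h1, h2⟩
  · rw [hu.h29 _ (by omega)] at hr
    rw [hu.h29 _ hc, hu.h11 _ hc, hu.h11 _ (by omega)]
    exact h.best s hs hr hok

variable (D)

/-- The arrays of the dynamic program are correct for all cells before `c`. -/
structure Filled (S : ℕ) (u : Store) (c : ℕ) : Prop where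
  start : 1 ≤ u.idx 29 0 ∧ u.val 11 0 = 0 ∧ ∀ i, 0 < i → i < S → u.idx 29 i = 0
  cell : ∀ t s', s' < S → (t + 1) * S + s' < c → D.CellOk S u t s' S

variable {D}

theorem Filled.congr {S : ℕ} {u u' : Store} {c : ℕ} (h : D.Filled S u c)
    (hu : SameBelow u u' c) (hS : S ≤ c) (hS1 : 1 ≤ S) : D.Filled S u' c := by
  refine ⟨⟨?_, ?_, fun i hi hi' => ?_⟩, fun t s' hs' hc =>
    (h.cell t s' hs' hc).congr hu le_rfl hc⟩
  · rw [hu.h29 _ (by omega)]; exact h.start.1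
  · rw [hu.h11 _ (by omega)]; exact h.start.2.1
  · rw [hu.h29 _ (by omega)]; exact h.start.2.2 i hi hi'

end Tables

/-- The cell of the state at `32` in the layer after the column at `27`. -/
abbrev targetCell : IExp := .add (.add (.var 27) (.var 15)) (.var 32)

open Prog in
/-- Consider the state at `34` as a predecessor of the state at `32`. -/
def relaxP : Prog :=
  .cond (.ile (.lit 1) (.get 29 (.add (.var 27) (.var 34))))
    (.seq (.rset 13 (.lit 0) (.get 11 (.add (.var 27) (.var 34))))
    (.seq transP
      (.cond (.conj (.ile (.lit 1) (.var 36)) (.neg (.conj (.ile (.lit 1) (.get 29 targetCell))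
          (.rle (.get 11 targetCell) (.var 13)))))
        (.seq (.iset 29 targetCell (.lit 1))
        (.seq (.rset 11 targetCell (.var 13))
        (.seq (.iset 30 targetCell (.var 34)) (.iset 41 targetCell (.var 35)))))
        .nop)))
    .nop

/-- The usual relaxation of shortest paths: the entry is replaced if it is unmarked or strictly more
expensive than the new one. The position of the predecessor is stored along with its number, as the
product with `D.L` could not be recomputed in one step. -/
theorem relaxP_spec {O : ℕ → ℝ → ℝ} {D : Tables} {u : Store} {S t s s' : ℕ}
    (hD : D.Stored O u) (h28 : u.idx 28 0 = t * D.L) (h33 : u.idx 33 0 = s' * D.L)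
    (h35 : u.idx 35 0 = s * D.L) (h27 : u.idx 27 0 = t * S) (h15 : u.idx 15 0 = S)
    (h32 : u.idx 32 0 = s') (h34 : u.idx 34 0 = s) (hs : s < S)
    (hcell : D.CellOk S u t s' s) (hz : ∀ c, (t + 1) * S + s' < c → u.idx 29 c = 0) :
    Ht O relaxP u (220 * (D.L + 1) + 150) (fun w => D.CellOk S w t s' (s + 1) ∧
      Tables.SameBelow u w ((t + 1) * S + s') ∧ ∀ c, (t + 1) * S + s' < c → w.idx 29 c = 0) := by
  have hS : (t + 1) * S = t * S + S := by ring
  have hrefl : Tables.SameBelow u u ((t + 1) * S + s') :=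
    ⟨fun _ _ => rfl, fun _ _ => rfl, fun _ _ => rfl, fun _ _ => rfl⟩
  refine Ht.le (Ht.cond (n := 220 * (D.L + 1) + 140) ?_ ?_)
    (by simp only [Test.steps, IExp.steps]; omega)
  · intro hr
    simp only [Test.Holds, IExp.eval, h27, h34] at hr
    refine Ht.le (Ht.seq (m := 10) (n := 220 * (D.L + 1) + 130)
      (R := fun w => w.val 13 0 = u.val 11 (t * S + s)) (Ht.of_exec rfl (by decide) ?_) ?_)
      (by omega)
    · simp [Prog.exec, IExp.eval, RExp.eval, h27, h34]
    intro u₁ hF₁ h13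
    refine Ht.seq (transP_spec (t := t) (s := s) (s' := s') (hD.congr (hF₁.idx 0 rfl) (hF₁.val 0 rfl)
      (hF₁.idx 1 rfl) (hF₁.val 1 rfl) (hF₁.val 6 rfl) (hF₁.val 7 rfl)) (by rw [hF₁.idx 28 rfl, h28])
      (by rw [hF₁.idx 33 rfl, h33]) (by rw [hF₁.idx 35 rfl, h35])) ?_
    rintro v hF₂ ⟨g36, g13⟩
    rw [h13] at g13
    have v29 : v.idx 29 = u.idx 29 := by rw [hF₂.idx 29 rfl, hF₁.idx 29 rfl]
    have v30 : v.idx 30 = u.idx 30 := by rw [hF₂.idx 30 rfl, hF₁.idx 30 rfl]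
    have v41 : v.idx 41 = u.idx 41 := by rw [hF₂.idx 41 rfl, hF₁.idx 41 rfl]
    have v11 : v.val 11 = u.val 11 := by rw [hF₂.val 11 rfl, hF₁.val 11 rfl]
    have v27 : v.idx 27 0 = t * S := by rw [hF₂.idx 27 rfl, hF₁.idx 27 rfl, h27]
    have v15 : v.idx 15 0 = S := by rw [hF₂.idx 15 rfl, hF₁.idx 15 rfl, h15]
    have v32 : v.idx 32 0 = s' := by rw [hF₂.idx 32 rfl, hF₁.idx 32 rfl, h32]
    have v34 : v.idx 34 0 = s := by rw [hF₂.idx 34 rfl, hF₁.idx 34 rfl, h34]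
    have v35 : v.idx 35 0 = s * D.L := by rw [hF₂.idx 35 rfl, hF₁.idx 35 rfl, h35]
    refine Ht.le (Ht.cond (n := 80) ?_ ?_)
      (show _ ≤ 130 by simp [Test.steps, IExp.steps, RExp.steps])
    · intro hc
      simp only [Test.Holds, IExp.eval, RExp.eval, v27, v15, v32, v29, v11, g36, g13, ← hS] at hc
      -- The cell that is written belongs to layer `t + 1`, so the marks and costs of layer `t`
      -- survive.
      have hne : ∀ i < S, t * S + i ≠ (t + 1) * S + s' := fun i hi => by omega
      refine Ht.of_exec rfl (by decide) ?_
      generalize hw : Prog.exec O _ v = w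
      have w29 : w.idx 29 = Function.update (u.idx 29) ((t + 1) * S + s') 1 := by
        rw [← hw]; simp [Prog.exec, IExp.eval, v29, v27, v15, v32, ← hS]
      have w30 : w.idx 30 = Function.update (u.idx 30) ((t + 1) * S + s') s := by
        rw [← hw]; simp [Prog.exec, IExp.eval, v30, v27, v15, v32, v34, ← hS]
      have w41 : w.idx 41 = Function.update (u.idx 41) ((t + 1) * S + s') (s * D.L) := by
        rw [← hw]; simp [Prog.exec, IExp.eval, v41, v27, v15, v32, v35, ← hS]
      have w11 : w.val 11 = Function.update (u.val 11) ((t + 1) * S + s')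
          (u.val 11 (t * S + s) + D.transCost t s s') := by
        rw [← hw]; simp [Prog.exec, IExp.eval, RExp.eval, v11, v27, v15, v32, g13, ← hS]
      refine ⟨⟨fun _ => ?_, fun r hr' hrr hok => ?_⟩, ⟨?_, ?_, ?_, ?_⟩, ?_⟩
      · simp only [w29, w30, w41, w11, Function.update_self, Function.update_of_ne (hne s hs)]
        exact ⟨by omega, hr, hc.1, trivial, trivial⟩
      · simp only [w29, w11, Function.update_self, Function.update_of_ne (hne r (by omega))] at hrr ⊢
        refine ⟨le_rfl, ?_⟩
        rcases Nat.lt_succ_iff_lt_or_eq.1 hr' with hr' | rfl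
        · obtain ⟨h1, h2⟩ := hcell.best r hr' hrr hok
          have h3 := fun h => hc.2 ⟨h1, h⟩
          exact (not_le.1 h3).le.trans h2
        · exact le_rfl
      · intro i hi; rw [w29, Function.update_of_ne hi.ne]
      · intro i hi; rw [w30, Function.update_of_ne hi.ne]
      · intro i hi; rw [w41, Function.update_of_ne hi.ne]
      · intro i hi; rw [w11, Function.update_of_ne hi.ne]
      · intro i hi; rw [w29, Function.update_of_ne hi.ne', hz i hi]
    · intro hc
      simp only [Test.Holds, IExp.eval, RExp.eval, v27, v15, v32, v29, v11, g36, g13, ← hS] at hc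
      refine Ht.of_exec rfl (by decide) ?_
      rw [Prog.exec]
      have hvu : Tables.SameBelow u v ((t + 1) * S + s' + 1) :=
        ⟨fun i _ => by rw [v29], fun i _ => by rw [v30], fun i _ => by rw [v41],
          fun i _ => by rw [v11]⟩
      have hcell' := hcell.congr hvu hs.le (Nat.lt_succ_self _)
      refine ⟨⟨fun h => ?_, fun r hr' hrr hok => ?_⟩, ⟨fun i _ => by rw [v29],
        fun i _ => by rw [v30], fun i _ => by rw [v41], fun i _ => by rw [v11]⟩,
        fun c hc => by rw [v29, hz c hc]⟩
      · obtain ⟨h1, h2⟩ := hcell'.reached h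
        exact ⟨by omega, h2⟩
      · rcases Nat.lt_succ_iff_lt_or_eq.1 hr' with hr' | rfl
        · exact hcell'.best r hr' hrr hok
        · by_contra hcon
          refine hc ⟨hok, fun h => hcon ?_⟩
          rw [v29, v11]
          exact h
  · intro hr
    simp only [Test.Holds, IExp.eval, h27, h34] at hr
    refine Ht.of_exec rfl (by simp [Prog.size]) ⟨⟨fun h => ?_, fun r hr' hrr hok => ?_⟩, hrefl, hz⟩
    · obtain ⟨h1, h2⟩ := hcell.reached h
      exact ⟨by simp only [Prog.exec]; omega, h2⟩
    · rcases Nat.lt_succ_iff_lt_or_eq.1 hr' with hr' | rfl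
      · exact hcell.best r hr' hrr hok
      · exact absurd hrr hr

end GridFlow

/-! ### Sweeping over states and layers, and tracing back -/

namespace GridFlow

open Prog in
/-- Consider all predecessors of the state at `32`. -/
def cellP : Prog :=
  .seq (.iset 35 (.lit 0) (.lit 0))
    (forTo 34 (.var 15) (.seq relaxP (.iset 35 (.lit 0) (.add (.var 35) (.get 0 (.lit 0))))))

/-- By `hz` the cell starts unmarked, so with no predecessor considered its condition holds
vacuously. Relaxing all `S` predecessors completes it. -/
theorem cellP_spec {O : ℕ → ℝ → ℝ} {D : Tables} {u : Store} {S t j : ℕ}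
    (hD : D.Stored O u) (h28 : u.idx 28 0 = t * D.L) (h33 : u.idx 33 0 = j * D.L)
    (h27 : u.idx 27 0 = t * S) (h15 : u.idx 15 0 = S) (h32 : u.idx 32 0 = j) (hj : j < S)
    (hfill : D.Filled S u ((t + 1) * S + j))
    (hz : ∀ c, (t + 1) * S + j ≤ c → u.idx 29 c = 0) :
    Ht O cellP u (400 * ((S + 1) * (D.L + 1)) + 3) (fun w =>
      D.Filled S w ((t + 1) * S + j + 1) ∧ ∀ c, (t + 1) * S + j + 1 ≤ c → w.idx 29 c = 0) := by
  have hS1 : 1 ≤ S := by omega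
  have hSc : S ≤ (t + 1) * S + j := by nlinarith
  refine Ht.le (Ht.seq (m := 3) (n := 400 * ((S + 1) * (D.L + 1)))
    (R := fun y => y.idx 35 0 = 0) (Ht.of_exec rfl le_rfl ?_) ?_) (by omega)
  · simp [Prog.exec, IExp.eval]
  intro x₁ hx₁ x35
  refine Ht.forTo S (220 * (D.L + 1) + 157) (fun n y => D.Filled S y ((t + 1) * S + j) ∧
    (n ≤ S → D.CellOk S y t j n) ∧ (∀ c, (t + 1) * S + j < c → y.idx 29 c = 0) ∧
    y.idx 35 0 = n * D.L) rfl ?_ ?_ ?_ ?_ (by simp only [IExp.steps]; nlinarith) ?_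
  · intro y hy
    simp [IExp.eval, hy.idx 15 rfl, hx₁.idx 15 rfl, h15]
  · rintro k y v ⟨h1, h2, h3⟩
    refine ⟨h1.congr ⟨?_, ?_, ?_, ?_⟩ hSc hS1, fun hk => (h2 hk).congr
      (c := (t + 1) * S + j + 1) ⟨?_, ?_, ?_, ?_⟩ hk (Nat.lt_succ_self _), ?_⟩
    iterate 8 simp
    simpa using h3
  · refine ⟨hfill.congr ⟨?_, ?_, ?_, ?_⟩ hSc hS1, fun _ => ⟨?_, ?_⟩, ?_, by simp [x35]⟩
    · intro i _; rw [hx₁.idx 29 rfl]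
    · intro i _; rw [hx₁.idx 30 rfl]
    · intro i _; rw [hx₁.idx 41 rfl]
    · intro i _; rw [hx₁.val 11 rfl]
    · intro h
      rw [hx₁.idx 29 rfl, hz _ le_rfl] at h
      omega
    · intro s hs
      omega
    · intro c hc; rw [hx₁.idx 29 rfl, hz c hc.le]
  · rintro n y hn hy hn34 ⟨yfill, ycell, yz, y35⟩
    refine Ht.le (Ht.seq (n := 7) (relaxP_spec (t := t) (s := n) (s' := j) (S := S) ?_ ?_ ?_ y35
      ?_ ?_ ?_ hn34 hn (ycell hn.le) yz) ?_) (by omega)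
    · exact hD.congr (by rw [hy.idx 0 rfl, hx₁.idx 0 rfl]) (by rw [hy.val 0 rfl, hx₁.val 0 rfl])
        (by rw [hy.idx 1 rfl, hx₁.idx 1 rfl]) (by rw [hy.val 1 rfl, hx₁.val 1 rfl]) (by rw [hy.val 6 rfl, hx₁.val 6 rfl])
        (by rw [hy.val 7 rfl, hx₁.val 7 rfl])
    · rw [hy.idx 28 rfl, hx₁.idx 28 rfl, h28]
    · rw [hy.idx 33 rfl, hx₁.idx 33 rfl, h33]
    · rw [hy.idx 27 rfl, hx₁.idx 27 rfl, h27]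
    · rw [hy.idx 15 rfl, hx₁.idx 15 rfl, h15]
    · rw [hy.idx 32 rfl, hx₁.idx 32 rfl, h32]
    · rintro y' hy' ⟨ycell', ysame, yz'⟩
      have e0 : y'.idx 0 0 = D.L := by rw [hy'.idx 0 rfl, hy.idx 0 rfl, hx₁.idx 0 rfl, hD.hL]
      have e35 : y'.idx 35 0 = n * D.L := by rw [hy'.idx 35 rfl, y35]
      refine Ht.of_exec rfl (by decide) ?_
      refine ⟨(yfill.congr ysame hSc hS1).congr ⟨?_, ?_, ?_, ?_⟩ hSc hS1, fun hk =>
        ycell'.congr (c := (t + 1) * S + j + 1) ⟨?_, ?_, ?_, ?_⟩ hk (Nat.lt_succ_self _), ?_, ?_⟩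
      iterate 8 simp [Prog.exec]
      · simpa [Prog.exec] using yz'
      · simp [Prog.exec, IExp.eval, e0, e35]
        ring
  · rintro y ⟨yfill, ycell, yz, -⟩
    refine ⟨⟨yfill.start, fun t' s' hs' hc => ?_⟩, fun c hc => yz c hc⟩
    rcases Nat.lt_succ_iff_lt_or_eq.1 hc with h | h
    · exact yfill.cell t' s' hs' h
    -- The number of a cell determines its layer and its state, so the new cell is the one just
    -- treated.
    · have h1 : t' = t := by
        have := congrArg (· / S) h
        simp only [Nat.add_comm ((t' + 1) * S), Nat.add_comm ((t + 1) * S),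
          Nat.add_mul_div_right _ _ hS1, Nat.div_eq_of_lt hs', Nat.div_eq_of_lt hj] at this
        omega
      subst h1
      have h2 : s' = j := by omega
      subst h2
      exact ycell le_rfl

open Prog in
/-- Fill the layer after the column at `27`. -/
def layerP : Prog :=
  .seq (.iset 33 (.lit 0) (.lit 0))
    (forTo 32 (.var 15) (.seq cellP (.iset 33 (.lit 0) (.add (.var 33) (.get 0 (.lit 0))))))

theorem layerP_spec {O : ℕ → ℝ → ℝ} {D : Tables} {u : Store} {S t : ℕ}
    (hD : D.Stored O u) (h28 : u.idx 28 0 = t * D.L) (hS1 : 1 ≤ S)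
    (h27 : u.idx 27 0 = t * S) (h15 : u.idx 15 0 = S) (hfill : D.Filled S u ((t + 1) * S))
    (hz : ∀ c, (t + 1) * S ≤ c → u.idx 29 c = 0) :
    Ht O layerP u (500 * ((S + 1) * ((S + 1) * (D.L + 1)))) (fun w =>
      D.Filled S w ((t + 1) * S + S) ∧ ∀ c, (t + 1) * S + S ≤ c → w.idx 29 c = 0) := by
  have hSc : ∀ j, S ≤ (t + 1) * S + j := fun j => by nlinarith
  have h1 : 1 ≤ (S + 1) * (D.L + 1) := Nat.succ_le_of_lt (by positivity)
  refine Ht.le (Ht.seq (m := 3) (n := (S + 1) * (400 * ((S + 1) * (D.L + 1)) + 30))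
    (R := fun x => x.idx 33 0 = 0) (Ht.of_exec rfl le_rfl ?_) ?_) (by nlinarith)
  · simp [Prog.exec, IExp.eval]
  intro w₁ hw₁ g33
  refine Ht.forTo S (400 * ((S + 1) * (D.L + 1)) + 16) (fun j x => D.Filled S x ((t + 1) * S + j) ∧
    (∀ c, (t + 1) * S + j ≤ c → x.idx 29 c = 0) ∧ x.idx 33 0 = j * D.L) rfl ?_ ?_ ?_ ?_
    (by simp [IExp.steps]) (fun _ h => ⟨h.1, h.2.1⟩)
  · intro x hx
    simp [IExp.eval, hx.idx 15 rfl, hw₁.idx 15 rfl, h15]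
  · rintro k w v ⟨h1, h2, h3⟩
    refine ⟨h1.congr ⟨?_, ?_, ?_, ?_⟩ (hSc _) hS1, ?_⟩
    iterate 4 simp
    simpa using ⟨h2, h3⟩
  · refine ⟨hfill.congr ⟨?_, ?_, ?_, ?_⟩ (hSc 0) hS1, ?_, by simp [g33]⟩
    · intro i _; rw [hw₁.idx 29 rfl]
    · intro i _; rw [hw₁.idx 30 rfl]
    · intro i _; rw [hw₁.idx 41 rfl]
    · intro i _; rw [hw₁.val 11 rfl]
    · intro c hc; rw [hw₁.idx 29 rfl, hz c hc]
  · rintro j x hj hx hj32 ⟨xfill, xz, x33⟩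
    refine Ht.le (Ht.seq (n := 7) (cellP_spec (t := t) (j := j) (S := S) ?_ ?_ x33 ?_ ?_ hj32 hj
      xfill xz) ?_) (by omega)
    · exact hD.congr (by rw [hx.idx 0 rfl, hw₁.idx 0 rfl]) (by rw [hx.val 0 rfl, hw₁.val 0 rfl])
        (by rw [hx.idx 1 rfl, hw₁.idx 1 rfl]) (by rw [hx.val 1 rfl, hw₁.val 1 rfl]) (by rw [hx.val 6 rfl, hw₁.val 6 rfl])
        (by rw [hx.val 7 rfl, hw₁.val 7 rfl])
    · rw [hx.idx 28 rfl, hw₁.idx 28 rfl, h28]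
    · rw [hx.idx 27 rfl, hw₁.idx 27 rfl, h27]
    · rw [hx.idx 15 rfl, hw₁.idx 15 rfl, h15]
    · rintro y hy ⟨yfill, yz⟩
      have e0 : y.idx 0 0 = D.L := by rw [hy.idx 0 rfl, hx.idx 0 rfl, hw₁.idx 0 rfl, hD.hL]
      have e33 : y.idx 33 0 = j * D.L := by rw [hy.idx 33 rfl, x33]
      refine Ht.of_exec rfl (by decide) ?_
      refine ⟨Tables.Filled.congr (u := y) yfill ⟨?_, ?_, ?_, ?_⟩ (hSc _) hS1, ?_, ?_⟩
      iterate 4 simp [Prog.exec]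
      · intro c hc
        simpa [Prog.exec] using yz c hc
      · simp [Prog.exec, IExp.eval, e0, e33]
        ring

open Prog in
/-- Fill the arrays of the dynamic program. -/
def dpP : Prog :=
  .seq (.iset 29 (.lit 0) (.lit 1))
    (forTo 31 (.get 0 (.lit 1))
      (.seq layerP
        (.seq (.iset 27 (.lit 0) (.add (.var 27) (.var 15)))
          (.iset 28 (.lit 0) (.add (.var 28) (.get 0 (.lit 0)))))))

/-- In layer 0 only state 0 is marked, at cost zero, since nothing enters the first column. The work
is one transition for every column and every pair of states. -/
theorem dpP_spec {O : ℕ → ℝ → ℝ} {D : Tables} {u : Store} {S T : ℕ}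
    (hD : D.Stored O u) (hT : u.idx 0 1 = T) (h15 : u.idx 15 0 = S) (hS1 : 1 ≤ S)
    (h28 : u.idx 28 0 = 0) (h27 : u.idx 27 0 = 0) (h29 : u.idx 29 = 0) (h11 : u.val 11 0 = 0) :
    Ht O dpP u (600 * ((T + 1) * ((S + 1) * ((S + 1) * (D.L + 1))))) (fun w =>
      D.Filled S w ((T + 1) * S) ∧ w.idx 27 0 = T * S ∧ w.idx 28 0 = T * D.L) := by
  have h1 : 1 ≤ (S + 1) * ((S + 1) * (D.L + 1)) := Nat.succ_le_of_lt (by positivity)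
  refine Ht.le (Ht.seq (m := 3) (n := (T + 1) * (500 * ((S + 1) * ((S + 1) * (D.L + 1))) + 34))
    (R := fun w => w.idx 29 = Function.update (0 : ℕ → ℕ) 0 1) (Ht.of_exec rfl le_rfl ?_) ?_)
    (by have := Nat.mul_le_mul_left (T + 1) h1; ring_nf at this ⊢; omega)
  · simp [Prog.exec, IExp.eval, h29]
  intro u₁ hF₁ h29'
  refine Ht.forTo T (500 * ((S + 1) * ((S + 1) * (D.L + 1))) + 20) (fun t w =>
    D.Filled S w ((t + 1) * S) ∧ (∀ c, (t + 1) * S ≤ c → w.idx 29 c = 0) ∧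
      w.idx 27 0 = t * S ∧ w.idx 28 0 = t * D.L) rfl ?_ ?_ ?_ ?_
      (by simp [IExp.steps]) (fun _ h => ⟨h.1, h.2.2⟩)
  · intro w hF
    simp [IExp.eval, hF.idx 0 rfl, hF₁.idx 0 rfl, hT]
  · rintro k w v ⟨h1, h2, h3⟩
    refine ⟨h1.congr ⟨?_, ?_, ?_, ?_⟩ (by nlinarith) hS1, ?_⟩
    iterate 4 simp
    simpa using ⟨h2, h3⟩
  · refine ⟨⟨⟨by simp [h29'], by rw [hF₁.val 11 rfl, h11], ?_⟩, ?_⟩, ?_, ?_⟩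
    · intro i hi _
      simp [h29', hi.ne']
    · intro t s' _ h
      nlinarith
    · intro c hc
      have : c ≠ 0 := by omega
      simp [h29', this]
    · simp [hF₁.idx 27 rfl, hF₁.idx 28 rfl, h27, h28]
  · rintro t w ht hF - ⟨hfill, hz, g27, g28⟩
    have e : (t + 1 + 1) * S = (t + 1) * S + S := by ring
    refine Ht.seq (layerP_spec (t := t) (S := S) ?_ g28 hS1 g27 ?_ hfill hz) ?_
    · exact hD.congr (by rw [hF.idx 0 rfl, hF₁.idx 0 rfl]) (by rw [hF.val 0 rfl, hF₁.val 0 rfl])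
        (by rw [hF.idx 1 rfl, hF₁.idx 1 rfl]) (by rw [hF.val 1 rfl, hF₁.val 1 rfl]) (by rw [hF.val 6 rfl, hF₁.val 6 rfl])
        (by rw [hF.val 7 rfl, hF₁.val 7 rfl])
    · rw [hF.idx 15 rfl, hF₁.idx 15 rfl, h15]
    · rintro x hx ⟨xfill, xz⟩
      have e0 : x.idx 0 0 = D.L := by rw [hx.idx 0 rfl, hF.idx 0 rfl, hF₁.idx 0 rfl, hD.hL]
      have e15 : x.idx 15 0 = S := by rw [hx.idx 15 rfl, hF.idx 15 rfl, hF₁.idx 15 rfl, h15]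
      have e27 : x.idx 27 0 = t * S := by rw [hx.idx 27 rfl, g27]
      have e28 : x.idx 28 0 = t * D.L := by rw [hx.idx 28 rfl, g28]
      refine Ht.of_exec rfl (by decide) ?_
      rw [e]
      refine ⟨xfill.congr ⟨?_, ?_, ?_, ?_⟩ (by nlinarith) hS1, ?_, ?_⟩
      iterate 4 simp [Prog.exec]
      · intro c hc
        simpa [Prog.exec] using xz c hc
      · simp [Prog.exec, IExp.eval, e0, e15, e27, e28]
        constructor <;> ring

/-- The state of layer `T - k` on the path that is traced back from state `0` of layer `T`. -/
def backState (prev : ℕ → ℕ) (S T : ℕ) : ℕ → ℕ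
  | 0 => 0
  | k + 1 => prev ((T - k) * S + backState prev S T k)

open Prog in
/-- Trace back the optimal path, and write the flow. -/
def traceP : Prog :=
  .seq (.seq (.iset 38 (.lit 0) (.lit 0)) (.iset 33 (.lit 0) (.lit 0)))
    (forTo 39 (.get 0 (.lit 1))
      (.seq (.seq (.iset 35 (.lit 0) (.get 41 (.add (.var 27) (.var 38))))
        (.seq (.iset 38 (.lit 0) (.get 30 (.add (.var 27) (.var 38))))
        (.seq (.iset 27 (.lit 0) (.sub (.var 27) (.var 15)))
        (.seq (.iset 28 (.lit 0) (.sub (.var 28) (.get 0 (.lit 0))))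
          (.rset 12 (.lit 0) (.lit 0))))))
      (.seq (forTo 37 (.get 0 (.lit 0))
          (.seq flowsP
          (.seq (.rset 2 (.add (.var 42) (.var 42)) (.var 14))
            (.rset 2 (.add (.add (.var 42) (.var 42)) (.lit 1)) (.var 12)))))
        (.iset 33 (.lit 0) (.var 35)))))

/-- The tables keep only costs and predecessors; the arc flows are recomputed from consecutive
states on the way back. -/
theorem traceP_spec {O : ℕ → ℝ → ℝ} {D : Tables} {u : Store} {S T : ℕ}
    (hD : D.Stored O u) (hT : u.idx 0 1 = T) (h15 : u.idx 15 0 = S)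
    (h28 : u.idx 28 0 = T * D.L) (h27 : u.idx 27 0 = T * S)
    (hptr : ∀ k < T, u.idx 41 ((T - k) * S + backState (u.idx 30) S T k) =
      backState (u.idx 30) S T (k + 1) * D.L) :
    Ht O traceP u (300 * ((T + 1) * (D.L + 1))) (fun w => ∀ t < T, ∀ l < D.L,
      w.val 2 (2 * (t * D.L + l)) = D.entry (t + 1) (backState (u.idx 30) S T (T - (t + 1))) l ∧
      w.val 2 (2 * (t * D.L + l) + 1) = D.vert t (backState (u.idx 30) S T (T - t))
        (backState (u.idx 30) S T (T - (t + 1))) l) := by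
  set ρ := backState (u.idx 30) S T with hρ
  refine Ht.le (Ht.seq (m := 6) (n := (T + 1) * ((D.L + 1) * 110 + 70))
    (R := fun w => w.idx 38 0 = 0 ∧ w.idx 33 0 = 0) (Ht.of_exec rfl le_rfl ?_) ?_) (by nlinarith)
  · simp [Prog.exec, IExp.eval]
  rintro u₁ hF₁ ⟨g38, g33⟩
  refine Ht.forTo T ((D.L + 1) * 110 + 50) (fun k w => w.idx 38 0 = ρ k ∧ w.idx 33 0 = ρ k * D.L ∧
    w.idx 27 0 = (T - k) * S ∧ w.idx 28 0 = (T - k) * D.L ∧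
    ∀ t, t < T → T - k ≤ t → ∀ l < D.L,
      w.val 2 (2 * (t * D.L + l)) = D.entry (t + 1) (ρ (T - (t + 1))) l ∧
      w.val 2 (2 * (t * D.L + l) + 1) = D.vert t (ρ (T - t)) (ρ (T - (t + 1))) l)
    rfl ?_ ?_ ?_ ?_ (by simp only [IExp.steps]; nlinarith)
    (fun _ h t ht => h.2.2.2.2 t ht (by omega))
  · intro w hF
    simp [IExp.eval, hF.idx 0 rfl, hF₁.idx 0 rfl, hT]
  · intro k u v h
    simpa using h
  · simp only [hρ, backState, g38, g33, hF₁.idx 27 rfl, hF₁.idx 28 rfl, h27, h28]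
    simp
    intro t h1 h2
    omega
  · rintro k w hk hF - ⟨w38, w33, w27, w28, wout⟩
    have p1 : (T - k) * S - S = (T - (k + 1)) * S := by
      rw [← Nat.sub_one_mul]; congr 1
    have p2 : (T - k) * D.L - D.L = (T - (k + 1)) * D.L := by
      rw [← Nat.sub_one_mul]; congr 1
    have q30 : w.idx 30 = u.idx 30 := by rw [hF.idx 30 rfl, hF₁.idx 30 rfl]
    have q41 : w.idx 41 = u.idx 41 := by rw [hF.idx 41 rfl, hF₁.idx 41 rfl]
    have q15 : w.idx 15 0 = S := by rw [hF.idx 15 rfl, hF₁.idx 15 rfl, h15]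
    have q0 : w.idx 0 0 = D.L := by rw [hF.idx 0 rfl, hF₁.idx 0 rfl, hD.hL]
    refine Ht.le (Ht.seq (m := 40) (n := (D.L + 1) * 110 + 5) (R := fun x =>
      x.idx 35 0 = ρ (k + 1) * D.L ∧ x.idx 38 0 = ρ (k + 1) ∧ x.idx 27 0 = (T - (k + 1)) * S ∧
      x.idx 28 0 = (T - (k + 1)) * D.L ∧ x.val 12 0 = 0) (Ht.of_exec rfl (by decide) ?_) ?_)
      (by omega)
    · simp [Prog.exec, IExp.eval, RExp.eval, w38, w27, w28, q30, q41, q15, q0, p1, p2,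
        hptr k hk]
      rfl
    rintro x hx ⟨x35, x38, x27, x28, x12⟩
    have x33 : x.idx 33 0 = ρ k * D.L := by rw [hx.idx 33 rfl, w33]
    have e1 : T - (k + 1) + 1 = T - k := by omega
    have e2 : T - (T - (k + 1)) = k + 1 := by omega
    have e3 : T - (T - (k + 1) + 1) = k := by omega
    set t₀ := T - (k + 1) with ht₀
    refine Ht.seq (m := (D.L + 1) * 110) (R := fun y => ∀ t, t < T → t₀ ≤ t → ∀ l < D.L,
      y.val 2 (2 * (t * D.L + l)) = D.entry (t + 1) (ρ (T - (t + 1))) l ∧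
      y.val 2 (2 * (t * D.L + l) + 1) = D.vert t (ρ (T - t)) (ρ (T - (t + 1))) l) ?_ ?_
    · refine Ht.forTo D.L 90 (fun j y => y.val 12 0 = ∑ i ∈ Finset.range j,
          (D.b (t₀ * D.L + i) + D.entry t₀ (ρ (k + 1)) i - D.entry (t₀ + 1) (ρ k) i) ∧
        ∀ t, t < T → t₀ ≤ t → ∀ l < D.L, (t₀ < t ∨ l < j) →
        y.val 2 (2 * (t * D.L + l)) = D.entry (t + 1) (ρ (T - (t + 1))) l ∧
        y.val 2 (2 * (t * D.L + l) + 1) = D.vert t (ρ (T - t)) (ρ (T - (t + 1))) l)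
        rfl ?_ ?_ ?_ ?_ (by simp only [IExp.steps]; omega)
        (fun _ h t h1 h2 l hl => h.2 t h1 h2 l hl (Or.inr hl))
      · intro y hy
        simp [IExp.eval, hy.idx 0 rfl, hx.idx 0 rfl, q0]
      · intro k u v h
        simpa using h
      · refine ⟨by simp [x12], fun t h1 h2 l hl h => ?_⟩
        rw [hx.val 2 rfl]
        exact wout t h1 (by omega) l hl
      · rintro j y hj hy hj37 ⟨y12, yout⟩
        have hDy : D.Stored O y := hD.congr
          (by rw [hy.idx 0 rfl, hx.idx 0 rfl, hF.idx 0 rfl, hF₁.idx 0 rfl])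
          (by rw [hy.val 0 rfl, hx.val 0 rfl, hF.val 0 rfl, hF₁.val 0 rfl])
          (by rw [hy.idx 1 rfl, hx.idx 1 rfl, hF.idx 1 rfl, hF₁.idx 1 rfl])
          (by rw [hy.val 1 rfl, hx.val 1 rfl, hF.val 1 rfl, hF₁.val 1 rfl])
          (by rw [hy.val 6 rfl, hx.val 6 rfl, hF.val 6 rfl, hF₁.val 6 rfl])
          (by rw [hy.val 7 rfl, hx.val 7 rfl, hF.val 7 rfl, hF₁.val 7 rfl])
        refine Ht.le (Ht.seq (n := 40) (flowsP_spec (t := t₀) (s := ρ (k + 1)) (s' := ρ k) hDy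
          (by rw [hy.idx 28 rfl, x28]) (by rw [hy.idx 33 rfl, x33]) (by rw [hy.idx 35 rfl, x35]) hj37 y12)
          ?_) (by omega)
        rintro z hz ⟨z42, z14, z12⟩
        refine Ht.of_exec rfl (by decide) ?_
        have z2 : z.val 2 = y.val 2 := hz.val 2 rfl
        simp only [Prog.exec, IExp.eval, RExp.eval, z42, z14, z12, z2, Store.setVal_idx,
          Store.setVal_val_self, ne_eq, Nat.reduceEqDiff, not_false_eq_true, Store.setVal_val_ne,
          ← two_mul]
        refine ⟨rfl, fun t h1 h2 l hl h => ?_⟩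
        by_cases htl : t = t₀ ∧ l = j
        · obtain ⟨rfl, rfl⟩ := htl
          rw [Function.update_self, Function.update_of_ne (by omega), Function.update_self, e2, e3]
          exact ⟨rfl, rfl⟩
        -- The two cells written belong to a single vertex; all other vertices keep their output.
        · have hne : t * D.L + l ≠ t₀ * D.L + j := by
            intro heq
            rcases h2.lt_or_eq with h2 | h2
            · have : (t₀ + 1) * D.L ≤ t * D.L := Nat.mul_le_mul_right _ h2
              have : (t₀ + 1) * D.L = t₀ * D.L + D.L := by ring
              omega
            · rw [← h2] at heq
              exact htl ⟨h2.symm, by omega⟩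
          rw [Function.update_of_ne (by omega), Function.update_of_ne (by omega),
            Function.update_of_ne (by omega), Function.update_of_ne (by omega)]
          exact yout t h1 h2 l hl (by omega)
    · intro y hy hout
      refine Ht.of_exec rfl (by decide) ?_
      simp [Prog.exec, IExp.eval, hy.idx 38 rfl, x38, hy.idx 27 rfl, x27, hy.idx 28 rfl, x28, hy.idx 35 rfl, x35]
      exact hout

end GridFlow

/-! ### Optimality of the traced sequence of states -/

namespace GridFlow

namespace Tables

variable (D : Tables)

/-- The state table and the offsets are those of the candidate list `R` of length `M`. -/
structure Ready (R : ℕ → ℝ) (M S T : ℕ) : Prop where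
  hV : ∀ k < S, (∀ l < D.L - 1, D.V (k * D.L + l) = R (digit M k l)) ∧
    D.V (k * D.L + (D.L - 1)) = -∑ l ∈ Finset.range (D.L - 1), R (digit M k l)
  hA : ∀ t ≤ T, ∀ l < D.L, D.A (t * D.L + l) =
    if l = D.L - 1 then ∑ q ∈ Finset.range (t * D.L), D.b q else 0

/-- A feasible sequence of states. -/
structure IsPath (S T : ℕ) (σ : ℕ → ℕ) : Prop where
  first : σ 0 = 0
  last : σ T = 0
  lt : ∀ t ≤ T, σ t < S
  trans : ∀ t < T, D.TransOk t (σ t) (σ (t + 1))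

/-- The cost of a sequence of states. -/
def pathCost (T : ℕ) (σ : ℕ → ℕ) : ℝ :=
  ∑ t ∈ Finset.range T, D.transCost t (σ t) (σ (t + 1))

variable {D}

/-- Bellman's induction along the layers: no feasible sequence of states beats the table. -/
theorem Filled.le_path {S T : ℕ} {u : Store} (h : D.Filled S u ((T + 1) * S)) {σ : ℕ → ℕ}
    (hσ : D.IsPath S T σ) : ∀ t ≤ T, 1 ≤ u.idx 29 (t * S + σ t) ∧
      u.val 11 (t * S + σ t) ≤ D.pathCost t σ := by
  intro t
  induction t with
  | zero =>
    intro _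
    simpa [hσ.first, pathCost, h.start.2.1] using h.start.1
  | succ t ih =>
    intro ht
    obtain ⟨h1, h2⟩ := ih (by omega)
    have hlt := hσ.lt (t + 1) ht
    have hc : (t + 1) * S + σ (t + 1) < (T + 1) * S := by
      have : (t + 1 + 1) * S ≤ (T + 1) * S := Nat.mul_le_mul_right _ (by omega)
      have : (t + 1 + 1) * S = (t + 1) * S + S := by ring
      omega
    obtain ⟨h3, h4⟩ := (h.cell t _ hlt hc).best (σ t) (hσ.lt t (by omega)) h1
      (hσ.trans t (by omega))
    refine ⟨h3, h4.trans ?_⟩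
    rw [pathCost, Finset.sum_range_succ]
    exact add_le_add_left h2 _

/-- The converse of `Filled.le_path`: following the predecessors gives feasible transitions whose
costs add up exactly to the table entry. -/
theorem Filled.back {S T : ℕ} {u : Store} (h : D.Filled S u ((T + 1) * S)) (hS : 1 ≤ S)
    (hr : 1 ≤ u.idx 29 (T * S)) : ∀ k ≤ T, backState (u.idx 30) S T k < S ∧
      1 ≤ u.idx 29 ((T - k) * S + backState (u.idx 30) S T k) ∧
      u.val 11 (T * S) = u.val 11 ((T - k) * S + backState (u.idx 30) S T k) +
        ∑ i ∈ Finset.range k, D.transCost (T - (i + 1)) (backState (u.idx 30) S T (i + 1))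
          (backState (u.idx 30) S T i) ∧
      (∀ i < k, D.TransOk (T - (i + 1)) (backState (u.idx 30) S T (i + 1))
        (backState (u.idx 30) S T i)) ∧
      ∀ i < k, u.idx 41 ((T - i) * S + backState (u.idx 30) S T i) =
        backState (u.idx 30) S T (i + 1) * D.L := by
  intro k
  induction k with
  | zero => exact fun _ => ⟨hS, by simpa [backState] using hr, by simp [backState], by simp, by simp⟩
  | succ k ih =>
    intro hk
    obtain ⟨h1, h2, h3, h4, h5⟩ := ih (by omega)
    have e : T - k = T - (k + 1) + 1 := by omega
    have hc : (T - (k + 1) + 1) * S + backState (u.idx 30) S T k < (T + 1) * S := by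
      have : (T - (k + 1) + 1 + 1) * S ≤ (T + 1) * S := Nat.mul_le_mul_right _ (by omega)
      have : (T - (k + 1) + 1 + 1) * S = (T - (k + 1) + 1) * S + S := by ring
      omega
    rw [e] at h2
    obtain ⟨g1, g2, g3, g4, g5⟩ := (h.cell _ _ h1 hc).reached h2
    have hb : backState (u.idx 30) S T (k + 1) =
        u.idx 30 ((T - (k + 1) + 1) * S + backState (u.idx 30) S T k) := by
      rw [backState, e]
    rw [← hb] at g1 g2 g3 g4 g5
    refine ⟨g1, g2, ?_, fun i hi => ?_, fun i hi => ?_⟩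
    · rw [h3, e, g4, Finset.sum_range_succ]
      ring
    · rcases Nat.lt_succ_iff_lt_or_eq.1 hi with hi | rfl
      · exact h4 i hi
      · exact g3
    · rcases Nat.lt_succ_iff_lt_or_eq.1 hi with hi | rfl
      · exact h5 i hi
      · rw [e, g5]

end Tables

/-- The part of the algorithm that follows the generation of the candidate values. -/
def optimizeP : Prog :=
  .seq powerP (.seq statesP (.seq totalsP (.seq dpP traceP)))

/-- The state table and the offsets exist only once the program has built them, hence `hpath` speaks
of all data `D` that fit the candidate list. It ensures that the final state is marked, so that
tracing back makes sense. -/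
theorem optimizeP_spec {O : ℕ → ℝ → ℝ} {s : Store} {L T M S : ℕ} (hL : s.idx 0 0 = L)
    (hT : s.idx 0 1 = T) (hL1 : 1 ≤ L) (hT1 : 1 ≤ T) (hM : s.idx 2 0 = M) (hM1 : 1 ≤ M)
    (hS : S = M ^ (L - 1)) (hMS : M ≤ S) (h19 : s.idx 19 = 0) (h20 : s.idx 20 0 = 0)
    (h27 : s.idx 27 0 = 0) (h28 : s.idx 28 0 = 0) (h29 : s.idx 29 = 0) (h7 : s.val 7 = 0)
    (h11 : s.val 11 0 = 0)
    (hpath : ∀ D : Tables, D.L = L → D.b = s.val 0 → D.flag = s.idx 1 → D.cap = s.val 1 →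
      D.O = O → D.Ready (s.val 3) M S T → ∃ σ, D.IsPath S T σ) :
    Ht O optimizeP s (20000 * (T * L * S ^ 2)) (fun w => ∃ D : Tables, D.L = L ∧ D.b = s.val 0 ∧
      D.flag = s.idx 1 ∧ D.cap = s.val 1 ∧ D.O = O ∧ D.Ready (s.val 3) M S T ∧
      ∃ ρ, D.IsPath S T ρ ∧ (∀ σ, D.IsPath S T σ → D.pathCost T ρ ≤ D.pathCost T σ) ∧
      ∀ t < T, ∀ l < L, w.val 2 (2 * (t * L + l)) = D.entry (t + 1) (ρ (t + 1)) l ∧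
        w.val 2 (2 * (t * L + l) + 1) = D.vert t (ρ t) (ρ (t + 1)) l) := by
  have hS1 : 1 ≤ S := hM1.trans hMS
  refine Ht.le (Ht.seq (n := 200 * ((S + 1) * L) + (60 * ((T + 1) * (L + 1)) +
    (600 * ((T + 1) * ((S + 1) * ((S + 1) * (L + 1)))) + 300 * ((T + 1) * (L + 1)))))
    (powerP_spec hL hM) ?_) ?_
  · intro s₁ hF₁ g15
    rw [← hS] at g15
    refine Ht.seq (statesP_spec (L := L) (M := M) (S := S) (by rw [hF₁.idx 0 rfl, hL]) hL1 hM1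
      (by rw [hF₁.idx 2 rfl, hM]) g15 (by rw [hF₁.idx 20 rfl, h20]) (by rw [hF₁.idx 19 rfl, h19])) ?_
    intro s₂ hF₂ hV
    refine Ht.seq (totalsP_spec (L := L) (T := T) (by rw [hF₂.idx 0 rfl, hF₁.idx 0 rfl, hL])
      (by rw [hF₂.idx 0 rfl, hF₁.idx 0 rfl, hT]) hL1 (by rw [hF₂.val 7 rfl, hF₁.val 7 rfl, h7])) ?_
    intro s₃ hF₃ hA
    let D : Tables := ⟨L, s.val 0, s.idx 1, s.val 1, s₂.val 6, s₃.val 7, O⟩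
    have hDs : D.Stored O s₃ := ⟨by rw [hF₃.idx 0 rfl, hF₂.idx 0 rfl, hF₁.idx 0 rfl, hL],
      by rw [hF₃.val 0 rfl, hF₂.val 0 rfl, hF₁.val 0 rfl], by rw [hF₃.idx 1 rfl, hF₂.idx 1 rfl, hF₁.idx 1 rfl],
      by rw [hF₃.val 1 rfl, hF₂.val 1 rfl, hF₁.val 1 rfl], by rw [hF₃.val 6 rfl], rfl, rfl⟩
    have hready : D.Ready (s.val 3) M S T := by
      rw [hF₁.val 3 rfl] at hV
      rw [hF₂.val 0 rfl, hF₁.val 0 rfl] at hA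
      exact ⟨hV, hA⟩
    refine Ht.seq (dpP_spec (S := S) (T := T) hDs (by rw [hF₃.idx 0 rfl, hF₂.idx 0 rfl, hF₁.idx 0 rfl, hT])
      (by rw [hF₃.idx 15 rfl, hF₂.idx 15 rfl, g15]) hS1 (by rw [hF₃.idx 28 rfl, hF₂.idx 28 rfl, hF₁.idx 28 rfl, h28])
      (by rw [hF₃.idx 27 rfl, hF₂.idx 27 rfl, hF₁.idx 27 rfl, h27])
      (by rw [hF₃.idx 29 rfl, hF₂.idx 29 rfl, hF₁.idx 29 rfl, h29])
      (by rw [hF₃.val 11 rfl, hF₂.val 11 rfl, hF₁.val 11 rfl, h11])) ?_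
    rintro s₄ hF₄ ⟨hfill, k27, k28⟩
    obtain ⟨σ₀, hσ₀⟩ := hpath D rfl rfl rfl rfl rfl hready
    have hr : 1 ≤ s₄.idx 29 (T * S) := by
      simpa [hσ₀.last] using (hfill.le_path hσ₀ T le_rfl).1
    have hback := hfill.back hS1 hr
    obtain ⟨b1, b2, b3, b4, b5⟩ := hback T le_rfl
    rw [Nat.sub_self, Nat.zero_mul, Nat.zero_add] at b2 b3
    -- The trace ends in a marked state of layer 0, and state 0 is the only one.
    have b0 : backState (s₄.idx 30) S T T = 0 := by
      by_contra hne
      have := hfill.start.2.2 _ (Nat.pos_of_ne_zero hne) b1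
      omega
    rw [b0, hfill.start.2.1, zero_add] at b3
    have hρ : D.IsPath S T (fun t => backState (s₄.idx 30) S T (T - t)) := by
      refine ⟨by simpa using b0, by simp [backState], fun t _ => (hback (T - t) (by omega)).1,
        fun t ht => ?_⟩
      have := b4 (T - (t + 1)) (by omega)
      rw [show T - (T - (t + 1) + 1) = t by omega, show T - (t + 1) + 1 = T - t by omega] at this
      exact this
    refine (traceP_spec (S := S) (T := T) (hDs.congr (hF₄.idx 0 rfl) (hF₄.val 0 rfl) (hF₄.idx 1 rfl)
      (hF₄.val 1 rfl) (hF₄.val 6 rfl) (hF₄.val 7 rfl)) (by rw [hF₄.idx 0 rfl, hF₃.idx 0 rfl, hF₂.idx 0 rfl, hF₁.idx 0 rfl, hT])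
      (by rw [hF₄.idx 15 rfl, hF₃.idx 15 rfl, hF₂.idx 15 rfl, g15]) k28 k27 b5).mono le_rfl ?_
    intro w _ hw
    refine ⟨D, rfl, rfl, rfl, rfl, rfl, hready, _, hρ, fun σ hσ => ?_, hw⟩
    have h1 := (hfill.le_path hσ T le_rfl).2
    rw [hσ.last, Nat.add_zero, b3] at h1
    refine le_trans (le_of_eq ?_) h1
    -- The trace sums the costs from the last column backwards.
    rw [Tables.pathCost, ← Finset.sum_range_reflect]
    refine Finset.sum_congr rfl fun i hi => ?_
    rw [Finset.mem_range] at hi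
    rw [show T - 1 - i = T - (i + 1) by omega, show T - (T - (i + 1)) = i + 1 by omega,
      show T - (T - (i + 1) + 1) = i by omega]
  · have hX : 1 ≤ T * L * S ^ 2 := Nat.succ_le_of_lt (by positivity)
    have a1 : (L - 1 + 1) * (M + 1) ≤ 2 * (T * L * S ^ 2) := by
      rw [Nat.sub_add_cancel hL1]
      calc L * (M + 1) ≤ (T * L) * (2 * S ^ 2) := Nat.mul_le_mul (by nlinarith) (by nlinarith)
        _ = _ := by ring
    have a2 : (S + 1) * L ≤ 2 * (T * L * S ^ 2) := by
      calc (S + 1) * L ≤ (2 * S ^ 2) * (T * L) := Nat.mul_le_mul (by nlinarith) (by nlinarith)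
        _ = _ := by ring
    have a3 : (T + 1) * (L + 1) ≤ 4 * (T * L * S ^ 2) := by
      calc (T + 1) * (L + 1) ≤ (2 * T) * (2 * L) := Nat.mul_le_mul (by omega) (by omega)
        _ = (4 * (T * L)) * 1 := by ring
        _ ≤ (4 * (T * L)) * S ^ 2 := Nat.mul_le_mul_left _ (by nlinarith)
        _ = _ := by ring
    have a4 : (T + 1) * ((S + 1) * ((S + 1) * (L + 1))) ≤ 16 * (T * L * S ^ 2) := by
      calc (T + 1) * ((S + 1) * ((S + 1) * (L + 1))) ≤
          (2 * T) * ((2 * S) * ((2 * S) * (2 * L))) :=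
            Nat.mul_le_mul (by omega) (Nat.mul_le_mul (by omega) (Nat.mul_le_mul (by omega)
              (by omega)))
        _ = _ := by ring
    omega

end GridFlow

namespace GridFlow

/-! ### Flows in coordinates -/

variable {L T : ℕ}

/-- The net outflow at a vertex. -/
def div (x : Arc L T → ℝ) (v : Vertex L T) : ℝ :=
  ∑ a with a.tail = v, x a - ∑ a with a.head = v, x a

/-- Summation by parts. It is used with a height function to exclude circulations, with monotone
potentials to confine the flow to a strip, and with the indicator of a cut. -/
theorem sum_mul_div (φ : Vertex L T → ℝ) (x : Arc L T → ℝ) :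
    ∑ v, φ v * div x v = ∑ a, x a * (φ a.tail - φ a.head) := by
  have h : ∀ g : Arc L T → Vertex L T, ∑ v, φ v * ∑ a with g a = v, x a = ∑ a, x a * φ (g a) := by
    intro g
    rw [← Finset.sum_fiberwise (s := Finset.univ) (g := g)]
    refine Finset.sum_congr rfl fun v _ => ?_
    rw [Finset.mul_sum]
    refine Finset.sum_congr rfl fun a ha => ?_
    rw [(Finset.mem_filter.1 ha).2, mul_comm]
  simp only [div, mul_sub, Finset.sum_sub_distrib, h]

theorem div_add (x y : Arc L T → ℝ) (v : Vertex L T) : div (x + y) v = div x v + div y v := by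
  simp only [div, Pi.add_apply, Finset.sum_add_distrib]; ring

theorem div_smul (c : ℝ) (x : Arc L T → ℝ) (v : Vertex L T) : div (c • x) v = c * div x v := by
  simp only [div, Pi.smul_apply, smul_eq_mul, ← Finset.mul_sum]; ring

theorem div_sub (x y : Arc L T → ℝ) (v : Vertex L T) : div (x - y) v = div x v - div y v := by
  simp only [div, Pi.sub_apply, Finset.sum_sub_distrib]; ring

/-- The forward arc that leaves `(l, t)`. -/
def fwdArc (l t : ℕ) (hl : l < L) (ht : t + 1 < T) : Arc L T :=
  ⟨((⟨l, hl⟩, ⟨t, by omega⟩), (⟨l, hl⟩, ⟨t + 1, ht⟩)), Or.inl ⟨rfl, rfl⟩⟩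

/-- The downward arc that leaves `(l, t)`. -/
def downArc (l t : ℕ) (hl : l + 1 < L) (ht : t < T) : Arc L T :=
  ⟨((⟨l, by omega⟩, ⟨t, ht⟩), (⟨l + 1, hl⟩, ⟨t, ht⟩)), Or.inr ⟨rfl, rfl⟩⟩

theorem arcCode_fwdArc (l t : ℕ) (hl : l < L) (ht : t + 1 < T) :
    arcCode (fwdArc l t hl ht) = 2 * (t * L + l) := by
  simp [arcCode, fwdArc, Arc.tail, Arc.head, IsDownward, vertexCode]

theorem arcCode_downArc (l t : ℕ) (hl : l + 1 < L) (ht : t < T) :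
    arcCode (downArc l t hl ht) = 2 * (t * L + l) + 1 := by
  simp [arcCode, downArc, Arc.tail, Arc.head, IsDownward, vertexCode]

theorem Arc.eq_fwdArc_or_downArc (a : Arc L T) :
    (∃ l t hl ht, a = fwdArc l t hl ht) ∨ ∃ l t hl ht, a = downArc l t hl ht := by
  obtain ⟨⟨⟨⟨l, hl⟩, ⟨t, ht⟩⟩, ⟨⟨l', hl'⟩, ⟨t', ht'⟩⟩⟩, h⟩ := a
  simp only [IsForward, IsDownward, Fin.mk.injEq] at h
  rcases h with ⟨rfl, rfl⟩ | ⟨rfl, rfl⟩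
  · exact Or.inl ⟨l', t, hl, ht', rfl⟩
  · exact Or.inr ⟨l, t', hl', ht', rfl⟩

theorem code_inj {l l' t t' : ℕ} (hl : l < L) (hl' : l' < L) (h : t * L + l = t' * L + l') :
    l = l' ∧ t = t' := by
  have hL : 0 < L := by omega
  have h2 := congrArg (· / L) h
  simp only [Nat.add_comm (_ * L), Nat.add_mul_div_right _ _ hL, Nat.div_eq_of_lt hl,
    Nat.div_eq_of_lt hl'] at h2
  have h3 : t = t' := by omega
  subst h3
  exact ⟨by omega, rfl⟩

theorem arcCode_lt (a : Arc L T) : arcCode a < 2 * (T * L) := by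
  have key : ∀ l t, l < L → t < T → t * L + l < T * L := by
    intro l t hl ht
    have : (t + 1) * L ≤ T * L := Nat.mul_le_mul_right _ ht
    have : (t + 1) * L = t * L + L := by ring
    omega
  rcases a.eq_fwdArc_or_downArc with ⟨l, t, hl, ht, rfl⟩ | ⟨l, t, hl, ht, rfl⟩
  · rw [arcCode_fwdArc]
    have := key l t hl (by omega)
    omega
  · rw [arcCode_downArc]
    have := key l t (by omega) ht
    omega

theorem card_arc_le : Fintype.card (Arc L T) ≤ 2 * (T * L) := by
  rw [← Finset.card_univ, ← Finset.card_image_of_injective _ (arcCode_injective (L := L) (T := T)),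
    ← Finset.card_range (2 * (T * L))]
  refine Finset.card_le_card fun n hn => ?_
  obtain ⟨a, -, rfl⟩ := Finset.mem_image.1 hn
  exact Finset.mem_range.2 (arcCode_lt a)

/-- A family indexed by arcs as a family indexed by the numbers of the arcs. -/
noncomputable def code {β : Type*} [Zero β] (x : Arc L T → β) : ℕ → β := Function.extend arcCode x 0

theorem code_arcCode {β : Type*} [Zero β] (x : Arc L T → β) (a : Arc L T) :
    code x (arcCode a) = x a := arcCode_injective.extend_apply _ _ _

theorem code_of_notMem {β : Type*} [Zero β] (x : Arc L T → β) {n : ℕ}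
    (h : ∀ a : Arc L T, arcCode a ≠ n) : code x n = 0 :=
  Function.extend_apply' _ _ _ (by rintro ⟨a, ha⟩; exact h a ha)

theorem sum_filter_code {p : Arc L T → Prop} [DecidablePred p] {s : Finset ℕ} {f : Arc L T → ℝ}
    {g : ℕ → ℝ} (hp : ∀ a, p a ↔ arcCode a ∈ s) (hf : ∀ a, g (arcCode a) = f a)
    (hg : ∀ n, (∀ a : Arc L T, arcCode a ≠ n) → g n = 0) :
    ∑ a with p a, f a = ∑ n ∈ s, g n := by
  rw [← Finset.sum_subset (s₁ := (Finset.univ.filter p).image arcCode)]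
  · rw [Finset.sum_image (fun a _ b _ h => arcCode_injective h)]
    exact Finset.sum_congr rfl fun a _ => (hf a).symm
  · intro n hn
    obtain ⟨a, ha, rfl⟩ := Finset.mem_image.1 hn
    exact (hp a).1 (Finset.mem_filter.1 ha).2
  · intro n hn hn'
    refine hg n fun a ha => hn' ?_
    subst ha
    exact Finset.mem_image_of_mem _ (Finset.mem_filter.2 ⟨Finset.mem_univ _, (hp a).2 hn⟩)

/-- The flow that enters the vertex `(l, t)` from the left. -/
noncomputable def hor (x : Arc L T → ℝ) (l : ℕ) : ℕ → ℝ
  | 0 => 0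
  | t + 1 => code x (2 * (t * L + l))

/-- The flow that enters the vertex `(l, t)` from above. -/
noncomputable def ver (x : Arc L T → ℝ) : ℕ → ℕ → ℝ
  | 0, _ => 0
  | l + 1, t => code x (2 * (t * L + l) + 1)

theorem hor_fwdArc (x : Arc L T → ℝ) {l t : ℕ} (hl : l < L) (ht : t + 1 < T) :
    hor x l (t + 1) = x (fwdArc l t hl ht) := by
  rw [hor, ← arcCode_fwdArc l t hl ht, code_arcCode]

theorem ver_downArc (x : Arc L T → ℝ) {l t : ℕ} (hl : l + 1 < L) (ht : t < T) :
    ver x (l + 1) t = x (downArc l t hl ht) := by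
  rw [ver, ← arcCode_downArc l t hl ht, code_arcCode]

/-- Numbers of forward arcs out of the last column belong to no arc. Extending flows by zero there,
and likewise below the last row, makes conservation one formula valid at every vertex. -/
theorem code_fwd_last {β : Type*} [Zero β] (x : Arc L T → β) {l t : ℕ} (hl : l < L)
    (ht : T ≤ t + 1) : code x (2 * (t * L + l)) = 0 := by
  refine code_of_notMem x fun a ha => ?_
  rcases a.eq_fwdArc_or_downArc with ⟨l', t', hl', ht', rfl⟩ | ⟨l', t', hl', ht', rfl⟩
  · rw [arcCode_fwdArc] at ha
    have := code_inj hl' hl (by omega : t' * L + l' = t * L + l)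
    omega
  · rw [arcCode_downArc] at ha
    omega

theorem code_down_last {β : Type*} [Zero β] (x : Arc L T → β) {l t : ℕ} (hl : l + 1 = L) :
    code x (2 * (t * L + l) + 1) = 0 := by
  refine code_of_notMem x fun a ha => ?_
  rcases a.eq_fwdArc_or_downArc with ⟨l', t', hl', ht', rfl⟩ | ⟨l', t', hl', ht', rfl⟩
  · rw [arcCode_fwdArc] at ha
    omega
  · rw [arcCode_downArc] at ha
    have := code_inj (by omega : l' < L) (by omega) (by omega : t' * L + l' = t * L + l)
    omega

theorem hor_last (x : Arc L T → ℝ) {l : ℕ} (hl : l < L) : hor x l T = 0 := by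
  cases T with
  | zero => rfl
  | succ t => exact code_fwd_last x hl le_rfl

theorem ver_last (x : Arc L T → ℝ) (t : ℕ) : ver x L t = 0 := by
  cases L with
  | zero => rfl
  | succ l => exact code_down_last x rfl

theorem Arc.tail_eq_iff (a : Arc L T) {l t : ℕ} (hl : l < L) (ht : t < T) :
    a.tail = (⟨l, hl⟩, ⟨t, ht⟩) ↔
      arcCode a ∈ ({2 * (t * L + l), 2 * (t * L + l) + 1} : Finset ℕ) := by
  rcases a.eq_fwdArc_or_downArc with ⟨l', t', hl', ht', rfl⟩ | ⟨l', t', hl', ht', rfl⟩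
  · rw [arcCode_fwdArc]
    simp only [Arc.tail, fwdArc, Prod.mk.injEq, Fin.mk.injEq, Finset.mem_insert,
      Finset.mem_singleton]
    constructor
    · rintro ⟨rfl, rfl⟩; simp
    · intro h
      exact code_inj hl' hl (by omega)
  · rw [arcCode_downArc]
    simp only [Arc.tail, downArc, Prod.mk.injEq, Fin.mk.injEq, Finset.mem_insert,
      Finset.mem_singleton]
    constructor
    · rintro ⟨rfl, rfl⟩; simp
    · intro h
      exact code_inj (by omega) hl (by omega)

/-- The numbers of the arcs that enter the vertex `(l, t)`. -/
def enteringCodes (L : ℕ) : ℕ → ℕ → Finset ℕ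
  | 0, 0 => ∅
  | l + 1, 0 => {2 * (0 * L + l) + 1}
  | 0, t + 1 => {2 * (t * L + 0)}
  | l + 1, t + 1 => {2 * (t * L + (l + 1)), 2 * ((t + 1) * L + l) + 1}

theorem mem_enteringCodes {l t n : ℕ} : n ∈ enteringCodes L l t ↔
    (∃ t', t = t' + 1 ∧ n = 2 * (t' * L + l)) ∨ ∃ l', l = l' + 1 ∧ n = 2 * (t * L + l') + 1 := by
  rcases l with _ | l <;> rcases t with _ | t <;> simp [enteringCodes]

theorem Arc.head_eq_iff (a : Arc L T) {l t : ℕ} (hl : l < L) (ht : t < T) :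
    a.head = (⟨l, hl⟩, ⟨t, ht⟩) ↔ arcCode a ∈ enteringCodes L l t := by
  rw [mem_enteringCodes]
  rcases a.eq_fwdArc_or_downArc with ⟨l', t', hl', ht', rfl⟩ | ⟨l', t', hl', ht', rfl⟩
  · rw [arcCode_fwdArc]
    simp only [Arc.head, fwdArc, Prod.mk.injEq, Fin.mk.injEq]
    constructor
    · rintro ⟨rfl, rfl⟩; exact Or.inl ⟨t', rfl, rfl⟩
    · rintro (⟨t'', rfl, h⟩ | ⟨l'', rfl, h⟩)
      · have := code_inj hl' hl (by omega : t' * L + l' = t'' * L + l)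
        omega
      · omega
  · rw [arcCode_downArc]
    simp only [Arc.head, downArc, Prod.mk.injEq, Fin.mk.injEq]
    constructor
    · rintro ⟨rfl, rfl⟩; exact Or.inr ⟨l', rfl, rfl⟩
    · rintro (⟨t'', rfl, h⟩ | ⟨l'', rfl, h⟩)
      · omega
      · have := code_inj (by omega) (by omega) (by omega : t' * L + l' = t * L + l'')
        omega

/-- At the border there are fewer entering arcs, and `hor` and `ver` supply the missing terms as
zeros. -/
theorem div_eq (x : Arc L T → ℝ) {l t : ℕ} (hl : l < L) (ht : t < T) :
    div x (⟨l, hl⟩, ⟨t, ht⟩) = hor x l (t + 1) + ver x (l + 1) t - hor x l t - ver x l t := by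
  have h1 := sum_filter_code (f := x) (g := code x) (fun a => a.tail_eq_iff hl ht)
    (code_arcCode x) (fun n hn => code_of_notMem x hn)
  have h2 := sum_filter_code (f := x) (g := code x) (fun a => a.head_eq_iff hl ht)
    (code_arcCode x) (fun n hn => code_of_notMem x hn)
  rw [div, h1, h2, Finset.sum_pair (by omega)]
  have h3 : ∑ n ∈ enteringCodes L l t, code x n = hor x l t + ver x l t := by
    rcases l with _ | l <;> rcases t with _ | t
    · simp [enteringCodes, hor, ver]
    · simp [enteringCodes, hor, ver]
    · simp [enteringCodes, hor, ver]
    · rw [enteringCodes, Finset.sum_pair (by omega)]; rfl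
  rw [h3, hor, ver]
  ring

theorem sum_range_two_mul (g : ℕ → ℝ) (n : ℕ) :
    ∑ q ∈ Finset.range (2 * n), g q = ∑ q ∈ Finset.range n, (g (2 * q) + g (2 * q + 1)) := by
  induction n with
  | zero => simp
  | succ n ih =>
    rw [Finset.sum_range_succ, ← ih, show 2 * (n + 1) = 2 * n + 1 + 1 by ring,
      Finset.sum_range_succ, Finset.sum_range_succ]
    ring

theorem sum_range_mul_eq (g : ℕ → ℝ) (L T : ℕ) :
    ∑ q ∈ Finset.range (T * L), g q =
      ∑ t ∈ Finset.range T, ∑ l ∈ Finset.range L, g (t * L + l) := by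
  induction T with
  | zero => simp
  | succ T ih => rw [Finset.sum_range_succ, ← ih, add_one_mul, Finset.sum_range_add]

theorem MFG.cost_eq (P : MFG L T) (x : Arc L T → ℝ) (X : ℕ → ℝ) (hX : ∀ a, X (arcCode a) = x a) :
    P.cost x = ∑ t ∈ Finset.range T, ∑ l ∈ Finset.range L,
      (P.oracle (2 * (t * L + l)) (X (2 * (t * L + l))) +
        P.oracle (2 * (t * L + l) + 1) (X (2 * (t * L + l) + 1))) := by
  have h := sum_filter_code (L := L) (T := T) (p := fun _ => True) (s := Finset.range (2 * (T * L)))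
    (f := fun a => P.c a (x a)) (g := fun n => P.oracle n (X n)) (fun a => by simp [arcCode_lt a])
    (fun a => by rw [MFG.oracle, arcCode_injective.extend_apply, hX])
    (fun n hn => by
      rw [MFG.oracle, Function.extend_apply' _ _ _ (by rintro ⟨a, ha⟩; exact hn a ha)]; rfl)
  rw [Finset.filter_true, sum_range_two_mul, sum_range_mul_eq] at h
  exact h

end GridFlow

namespace GridFlow

/-! ### Rigid flows -/

variable {L T : ℕ}

/-- A nonnegative circulation on the grid vanishes, as the grid has no directed cycle. -/
theorem eq_zero_of_circulation {z : Arc L T → ℝ} (hz : ∀ v, div z v = 0) (h0 : ∀ a, 0 ≤ z a) :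
    z = 0 := by
  -- Along every arc the sum of row and column grows by one, so this potential turns conservation
  -- into the vanishing of the sum of all arc flows.
  have h := sum_mul_div (fun v : Vertex L T => -((v.1.val : ℝ) + v.2.val)) z
  simp only [hz, mul_zero, Finset.sum_const_zero] at h
  have h1 : ∀ a : Arc L T, z a * (-((a.tail.1.val : ℝ) + a.tail.2.val) -
      -((a.head.1.val : ℝ) + a.head.2.val)) = z a := by
    intro a
    rcases a.eq_fwdArc_or_downArc with ⟨l, t, hl, ht, rfl⟩ | ⟨l, t, hl, ht, rfl⟩
    · simp only [Arc.tail, Arc.head, fwdArc]; push_cast; ring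
    · simp only [Arc.tail, Arc.head, downArc]; push_cast; ring
  simp only [h1] at h
  funext a
  exact (Finset.sum_eq_zero_iff_of_nonneg fun a _ => h0 a).1 h.symm a (Finset.mem_univ a)

namespace MFG

variable (P : MFG L T)

/-- The flow on the arc `a` is neither zero nor equal to the capacity. -/
def Free (x : Arc L T → ℝ) (a : Arc L T) : Prop := 0 < x a ∧ ∀ n : ℕ, P.U a = n → x a < n

/-- No nonzero circulation is supported by the free arcs. -/
def Rigid (x : Arc L T → ℝ) : Prop :=
  ∀ z : Arc L T → ℝ, (∀ v, div z v = 0) → (∀ a, z a ≠ 0 → P.Free x a) → z = 0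

variable {P}

theorem div_of_feasible {x : Arc L T → ℝ} (hx : x ∈ P.feasible) (v : Vertex L T) :
    div x v = P.b v := hx.1 v

/-- One moves along the circulation until the first bound is met. Some arc must block: otherwise `z`
would be nonnegative, hence zero by `eq_zero_of_circulation`. -/
theorem exists_step {x z : Arc L T → ℝ} (hx : x ∈ P.feasible) (hz : ∀ v, div z v = 0)
    (hs : ∀ a, z a ≠ 0 → P.Free x a) (hne : z ≠ 0) :
    ∃ r : ℝ, 0 < r ∧ x + r • z ∈ P.feasible ∧ ∃ a, P.Free x a ∧ ¬ P.Free (x + r • z) a := by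
  classical
  -- The arcs of `B` limit the step, and `r` is the step length at which each of them becomes tight.
  let B : Finset (Arc L T) := Finset.univ.filter fun a => z a < 0 ∨ 0 < z a ∧ P.U a ≠ ⊤
  let r : Arc L T → ℝ := fun a =>
    if z a < 0 then x a / (-z a) else (((P.U a).toNat : ℝ) - x a) / z a
  have hB : B.Nonempty := by
    by_contra hB
    refine hne (eq_zero_of_circulation hz fun a => ?_)
    by_contra ha
    exact hB ⟨a, by simp only [B, Finset.mem_filter, Finset.mem_univ, true_and]; left; linarith⟩
  obtain ⟨a, ha, hmin⟩ := Finset.exists_min_image B r hB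
  have hpos : ∀ a ∈ B, 0 < r a := by
    intro a ha
    simp only [B, Finset.mem_filter, Finset.mem_univ, true_and] at ha
    simp only [r]
    split_ifs with h
    · exact div_pos (hs a h.ne).1 (by linarith)
    · have ha := ha.resolve_left h
      have hf := (hs a ha.1.ne').2 (P.U a).toNat (ENat.natCast_toNat ha.2).symm
      exact div_pos (by linarith) ha.1
  refine ⟨r a, hpos a ha, ⟨fun v => ?_, fun e => ?_⟩, a, ?_, ?_⟩
  · have : div (x + r a • z) v = P.b v := by
      rw [div_add, div_smul, hz, div_of_feasible hx]; ring
    exact this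
  · have hxe := hx.2 e
    rcases lt_trichotomy (z e) 0 with h | h | h
    · have hm := hmin e (by simp only [B, Finset.mem_filter, Finset.mem_univ, true_and]; left; exact h)
      have hr : r e = x e / (-z e) := if_pos h
      rw [hr, le_div_iff₀ (by linarith)] at hm
      have := mul_pos (hpos a ha) (neg_pos.2 h)
      refine ⟨by simp only [Pi.add_apply, Pi.smul_apply, smul_eq_mul]; linarith, fun n hn => ?_⟩
      have := hxe.2 n hn
      simp only [Pi.add_apply, Pi.smul_apply, smul_eq_mul]
      linarith
    · simpa [h] using hxe
    · have := mul_pos (hpos a ha) h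
      refine ⟨by have := hxe.1; simp only [Pi.add_apply, Pi.smul_apply, smul_eq_mul]; linarith,
        fun n hn => ?_⟩
      have hm := hmin e (by
        simp only [B, Finset.mem_filter, Finset.mem_univ, true_and]
        exact Or.inr ⟨h, by rw [hn]; exact ENat.natCast_ne_top n⟩)
      have hr : r e = ((n : ℝ) - x e) / z e := by
        simp only [r, if_neg h.not_gt, hn, ENat.toNat_natCast]
      rw [hr, le_div_iff₀ h] at hm
      simp only [Pi.add_apply, Pi.smul_apply, smul_eq_mul]
      linarith
  · simp only [B, Finset.mem_filter, Finset.mem_univ, true_and] at ha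
    exact hs a (by rcases ha with h | h; exacts [h.ne, h.1.ne'])
  · simp only [B, Finset.mem_filter, Finset.mem_univ, true_and] at ha
    rintro ⟨h1, h2⟩
    simp only [Pi.add_apply, Pi.smul_apply, smul_eq_mul] at h1 h2
    by_cases h : z a < 0
    · have hr : r a = x a / (-z a) := if_pos h
      have : r a * z a = - x a := by
        have := h.ne
        rw [hr, div_neg, neg_mul, div_mul_cancel₀ _ this]
      linarith
    · have ha := ha.resolve_left h
      have hr : r a = (((P.U a).toNat : ℝ) - x a) / z a := if_neg h
      have h3 : r a * z a = ((P.U a).toNat : ℝ) - x a := by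
        rw [hr]; field_simp [ha.1.ne']
      have := h2 (P.U a).toNat (ENat.natCast_toNat ha.2).symm
      linarith

/-- Stepping along `z` and along `-z` places `x` strictly inside a segment whose two ends each have
strictly fewer free arcs. -/
theorem exists_steps {x : Arc L T → ℝ} (hx : x ∈ P.feasible) (hr : ¬ P.Rigid x) :
    ∃ y ∈ P.feasible, ∃ y' ∈ P.feasible, ∃ p q : ℝ, 0 < p ∧ 0 < q ∧ p + q = 1 ∧
      p • y + q • y' = x ∧ y ≠ x ∧
      (∃ a, P.Free x a ∧ ¬ P.Free y a) ∧ (∃ a, P.Free x a ∧ ¬ P.Free y' a) ∧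
      ∀ a, ¬ P.Free x a → ¬ P.Free y a ∧ ¬ P.Free y' a := by
  simp only [Rigid, not_forall] at hr
  obtain ⟨z, hz, hs, hne⟩ := hr
  obtain ⟨r, hr, hf, hfree⟩ := exists_step hx hz hs hne
  obtain ⟨r', hr', hf', hfree'⟩ := exists_step (z := -z) hx
    (fun v => by rw [← neg_one_smul ℝ z, div_smul, hz, mul_zero])
    (fun a ha => hs a (by simpa using ha)) (by simpa using hne)
  refine ⟨_, hf, _, hf', r' / (r + r'), r / (r + r'), by positivity, by positivity,
    by field_simp; ring, ?_, ?_, hfree, hfree', fun a ha => ?_⟩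
  · funext a
    simp only [Pi.add_apply, Pi.smul_apply, smul_eq_mul, Pi.neg_apply]
    field_simp
    ring
  · intro h
    have : r • z = 0 := by simpa using h
    exact hne ((smul_eq_zero.1 this).resolve_left hr.ne')
  · have hza : z a = 0 := by
      by_contra h
      exact ha (hs a h)
    simp only [Free, Pi.add_apply, Pi.smul_apply, Pi.neg_apply, hza, neg_zero, smul_zero, add_zero]
    exact ⟨ha, ha⟩

theorem cost_combination {y y' : Arc L T → ℝ} (hy : y ∈ P.feasible) (hy' : y' ∈ P.feasible)
    {p q : ℝ} (hp : 0 < p) (hq : 0 < q) (hpq : p + q = 1) :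
    p * P.cost y + q * P.cost y' ≤ P.cost (p • y + q • y') := by
  simp only [cost, Finset.mul_sum, ← Finset.sum_add_distrib]
  exact Finset.sum_le_sum fun a _ => (P.concave a).2 (hy.2 a) (hy'.2 a) hp.le hq.le hpq

/-- Induction on the number of free arcs; by concavity one end of the segment from `exists_steps` is
no more expensive. Neither continuity of the costs nor the existence of an optimum is needed. -/
theorem exists_rigid_le {x : Arc L T → ℝ} (hx : x ∈ P.feasible) :
    ∃ y ∈ P.feasible, P.Rigid y ∧ P.cost y ≤ P.cost x := by
  classical
  induction hn : (Finset.univ.filter (P.Free x)).card using Nat.strong_induction_on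
    generalizing x with
  | _ n ih =>
    by_cases hr : P.Rigid x
    · exact ⟨x, hx, hr, le_rfl⟩
    obtain ⟨y, hy, y', hy', p, q, hp, hq, hpq, hsum, -, h1, h2, h3⟩ := exists_steps hx hr
    have hlt : ∀ w, (∃ a, P.Free x a ∧ ¬ P.Free w a) → (∀ a, ¬ P.Free x a → ¬ P.Free w a) →
        (Finset.univ.filter (P.Free w)).card < n := by
      rintro w ⟨a, ha, ha'⟩ hw
      rw [← hn]
      refine Finset.card_lt_card ⟨fun e he => ?_, fun h => ?_⟩
      · simp only [Finset.mem_filter, Finset.mem_univ, true_and] at he ⊢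
        by_contra hc
        exact hw e hc he
      · have := h (Finset.mem_filter.2 ⟨Finset.mem_univ a, ha⟩)
        simp only [Finset.mem_filter, Finset.mem_univ, true_and] at this
        exact ha' this
    have hc := cost_combination hy hy' hp hq hpq
    rw [hsum] at hc
    have hor : P.cost y ≤ P.cost x ∨ P.cost y' ≤ P.cost x := by
      by_contra hcon
      push Not at hcon
      have := mul_lt_mul_of_pos_left hcon.1 hp
      have := mul_lt_mul_of_pos_left hcon.2 hq
      have : p * P.cost x + q * P.cost x = P.cost x := by rw [← add_mul, hpq, one_mul]
      linarith
    rcases hor with h | h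
    · obtain ⟨w, hw, hwr, hwc⟩ := ih _ (hlt y h1 fun a ha => (h3 a ha).1) hy rfl
      exact ⟨w, hw, hwr, hwc.trans h⟩
    · obtain ⟨w, hw, hwr, hwc⟩ := ih _ (hlt y' h2 fun a ha => (h3 a ha).2) hy' rfl
      exact ⟨w, hw, hwr, hwc.trans h⟩

/-- A flow that is not rigid lies strictly inside a segment of feasible flows, again by
`exists_steps`. -/
theorem rigid_of_extreme {x : Arc L T → ℝ} (hx : x ∈ Set.extremePoints ℝ P.feasible) :
    P.Rigid x := by
  by_contra hr
  obtain ⟨y, hy, y', hy', p, q, hp, hq, hpq, hsum, hne, -⟩ := exists_steps hx.1 hr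
  exact hne (hx.2 hy hy' ⟨p, q, hp, hq, hpq, hsum⟩)

end MFG

end GridFlow

namespace GridFlow

/-! ### Connected sets in the grid -/

variable {L T : ℕ}

/-- The vertices `u` and `v` are joined by an undirected path of arcs in `E`. -/
def Linked (E : Set (Arc L T)) : Vertex L T → Vertex L T → Prop :=
  Relation.ReflTransGen fun u v =>
    ∃ a ∈ E, a.tail = u ∧ a.head = v ∨ a.tail = v ∧ a.head = u

theorem Linked.symm {E : Set (Arc L T)} {u v : Vertex L T} (h : Linked E u v) : Linked E v u := by
  induction h with
  | refl => exact .refl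
  | tail _ hstep ih =>
    obtain ⟨a, ha, h⟩ := hstep
    exact .head ⟨a, ha, h.symm⟩ ih

theorem Linked.mono {E F : Set (Arc L T)} (hEF : E ⊆ F) {u v : Vertex L T} (h : Linked E u v) :
    Linked F u v := by
  induction h with
  | refl => exact .refl
  | tail _ hstep ih =>
    obtain ⟨a, ha, h⟩ := hstep
    exact .tail ih ⟨a, hEF ha, h⟩

theorem div_single (a : Arc L T) (w : Vertex L T) :
    div (Pi.single a (1 : ℝ)) w =
      (if a.tail = w then 1 else 0) - (if a.head = w then 1 else 0) := by
  simp [div]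

/-- The unit flow along a path. -/
theorem Linked.exists_flow {E : Set (Arc L T)} {u v : Vertex L T} (h : Linked E u v) :
    ∃ p : Arc L T → ℝ, (∀ a, p a ≠ 0 → a ∈ E) ∧
      ∀ w, div p w = (if u = w then 1 else 0) - (if v = w then 1 else 0) := by
  induction h with
  | refl => exact ⟨0, fun a ha => absurd rfl ha, fun w => by simp [div]⟩
  | @tail v v' _ hstep ih =>
    obtain ⟨p, hp, hdiv⟩ := ih
    obtain ⟨a, ha, hor⟩ := hstep
    rcases hor with ⟨rfl, rfl⟩ | ⟨rfl, rfl⟩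
    · refine ⟨p + Pi.single a 1, fun e he => ?_, fun w => ?_⟩
      · by_cases hea : e = a
        · exact hea ▸ ha
        · exact hp e (by simpa [hea] using he)
      · rw [div_add, hdiv, div_single]; ring
    · refine ⟨p - Pi.single a 1, fun e he => ?_, fun w => ?_⟩
      · by_cases hea : e = a
        · exact hea ▸ ha
        · exact hp e (by simpa [hea] using he)
      · rw [div_sub, hdiv, div_single]; ring

/-- The net outflow in coordinates. -/
noncomputable def netOut (p : Arc L T → ℝ) (l t : ℕ) : ℝ :=
  hor p l (t + 1) + ver p (l + 1) t - hor p l t - ver p l t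

theorem sum_netOut_column (p : Arc L T → ℝ) (l t : ℕ) :
    ∑ i ∈ Finset.range l, netOut p i t =
      ∑ i ∈ Finset.range l, hor p i (t + 1) - ∑ i ∈ Finset.range l, hor p i t + ver p l t := by
  induction l with
  | zero => simp [ver]
  | succ l ih =>
    rw [Finset.sum_range_succ, ih, Finset.sum_range_succ, Finset.sum_range_succ, netOut]
    ring

/-- Conservation over the first `t` columns, by telescoping. It serves both the discrete Jordan
argument and the forced last row of the dynamic program. -/
theorem sum_netOut_columns (p : Arc L T → ℝ) (t : ℕ) :
    ∑ j ∈ Finset.range t, ∑ i ∈ Finset.range L, netOut p i j =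
      ∑ i ∈ Finset.range L, hor p i t := by
  induction t with
  | zero => simp [hor]
  | succ t ih => rw [Finset.sum_range_succ, ih, sum_netOut_column, ver_last]; ring

/-- A flow inside `S` does not use the arcs at a vertex outside `S`. -/
theorem flow_eq_zero_of_notMem {S : Set (Vertex L T)} {p : Arc L T → ℝ}
    (hp : ∀ a, p a ≠ 0 → a.tail ∈ S ∧ a.head ∈ S) {l t : ℕ} (hl : l < L) (ht : t < T)
    (hS : ((⟨l, hl⟩, ⟨t, ht⟩) : Vertex L T) ∉ S) :
    hor p l t = 0 ∧ hor p l (t + 1) = 0 ∧ ver p l t = 0 ∧ ver p (l + 1) t = 0 := by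
  refine ⟨?_, ?_, ?_, ?_⟩
  · cases t with
    | zero => rfl
    | succ t =>
      rw [hor_fwdArc p hl ht]
      by_contra h
      exact hS (hp _ h).2
  · rcases Nat.lt_or_ge (t + 1) T with h1 | h1
    · rw [hor_fwdArc p hl h1]
      by_contra h
      exact hS (hp _ h).1
    · have : t + 1 = T := by omega
      rw [this, hor_last p hl]
  · cases l with
    | zero => rfl
    | succ l =>
      rw [ver_downArc p hl ht]
      by_contra h
      exact hS (hp _ h).2
  · rcases Nat.lt_or_ge (l + 1) L with h1 | h1
    · rw [ver_downArc p h1 ht]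
      by_contra h
      exact hS (hp _ h).1
    · have : l + 1 = L := by omega
      rw [this, ver_last p]

/-- The rows from `r₁` to `r₂`. -/
def strip (r₁ r₂ : ℕ) : Set (Vertex L T) := {v | r₁ ≤ v.1.val ∧ v.1.val ≤ r₂}

/-- A flow inside `S`, between vertices in the first and the last row of a strip, has a potential
that is constant on the connected complement of `S` in the strip. -/
theorem exists_potential {r₁ r₂ : ℕ} (hr : r₁ < r₂) (hr₂ : r₂ < L) {S : Set (Vertex L T)}
    (hS : S ⊆ strip r₁ r₂) {p : Arc L T → ℝ} (hp : ∀ a, p a ≠ 0 → a.tail ∈ S ∧ a.head ∈ S)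
    (hdiv : ∀ l t, l < L → t < T → l ≠ r₁ → l ≠ r₂ → netOut p l t = 0)
    {c₀ : Vertex L T} (hc : ∀ v ∈ strip r₁ r₂ \ S,
      Linked {a : Arc L T | a.tail ∈ strip r₁ r₂ \ S ∧ a.head ∈ strip r₁ r₂ \ S} c₀ v) :
    ∃ κ : ℝ, (∀ t (ht : t < T), ((⟨r₁, by omega⟩, ⟨t, ht⟩) : Vertex L T) ∉ S →
        -∑ j ∈ Finset.range (t + 1), netOut p r₁ j = κ) ∧
      ∀ t (ht : t < T), ((⟨r₂, hr₂⟩, ⟨t, ht⟩) : Vertex L T) ∉ S →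
        ∑ j ∈ Finset.range (t + 1), netOut p r₂ j = κ := by
  -- The potential is the flow from column `t` to the next one above row `l`, minus what row `r₁`
  -- has emitted up to column `t`. Neighbouring vertices outside `S` have the same potential because
  -- no flow touches them; this is the discrete form of the Jordan curve theorem.
  let h : ℕ → ℕ → ℝ := fun l t =>
    ∑ i ∈ Finset.range l, hor p i (t + 1) - ∑ j ∈ Finset.range (t + 1), netOut p r₁ j
  have hlow : ∀ i t, i < L → t < T → (i < r₁ ∨ r₂ < i) → hor p i (t + 1) = 0 := by
    intro i t hi ht h
    refine (flow_eq_zero_of_notMem hp hi ht fun hmem => ?_).2.1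
    have : r₁ ≤ i ∧ i ≤ r₂ := hS hmem
    omega
  have hedge : ∀ a : Arc L T, a.tail ∈ strip r₁ r₂ \ S → a.head ∈ strip r₁ r₂ \ S →
      h a.tail.1 a.tail.2 = h a.head.1 a.head.2 := by
    intro a h1 h2
    rcases a.eq_fwdArc_or_downArc with ⟨l, t, hl, ht, rfl⟩ | ⟨l, t, hl, ht, rfl⟩
    · simp only [Arc.tail, Arc.head, fwdArc, h] at h1 h2 ⊢
      have hz := flow_eq_zero_of_notMem hp hl ht h2.2
      have hcol := sum_netOut_column p l (t + 1)
      rw [hz.2.2.1] at hcol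
      have hstrip : r₁ ≤ l ∧ l ≤ r₂ := h1.1
      -- Among the rows above `l` only `r₁` can emit flow, as `l ≤ r₂`; and if `l` is itself `r₁`,
      -- the vertex outside `S` emits nothing.
      have hsum : ∑ i ∈ Finset.range l, netOut p i (t + 1) = netOut p r₁ (t + 1) := by
        rcases hstrip.1.lt_or_eq with hlt | heq
        · refine Finset.sum_eq_single r₁ (fun i hi hne => ?_) fun hn => ?_
          · rw [Finset.mem_range] at hi
            exact hdiv i (t + 1) (by omega) ht hne (by omega)
          · exact absurd (Finset.mem_range.2 hlt) hn
        · subst heq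
          rw [Finset.sum_eq_zero, netOut, hz.1, hz.2.1, hz.2.2.1, hz.2.2.2]
          · ring
          · intro i hi
            rw [Finset.mem_range] at hi
            exact hdiv i (t + 1) (by omega) ht (by omega) (by omega)
      rw [Finset.sum_range_succ _ (t + 1)]
      linarith
    · simp only [Arc.tail, Arc.head, downArc, h] at h1 h2 ⊢
      rw [Finset.sum_range_succ _ l, (flow_eq_zero_of_notMem hp (by omega) ht h1.2).2.1, add_zero]
  have hconst : ∀ v ∈ strip r₁ r₂ \ S, h v.1 v.2 = h c₀.1 c₀.2 := by
    intro v hv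
    have hl := hc v hv
    clear hv
    induction hl with
    | refl => rfl
    | tail _ hstep ih =>
      obtain ⟨a, ⟨ha1, ha2⟩, ⟨h1, h2⟩ | ⟨h1, h2⟩⟩ := hstep
      · rw [← h2, ← hedge a ha1 ha2, h1, ih]
      · rw [← h1, hedge a ha1 ha2, h2, ih]
  refine ⟨h c₀.1 c₀.2, fun t ht hn => ?_, fun t ht hn => ?_⟩
  · rw [← hconst _ ⟨⟨le_rfl, hr.le⟩, hn⟩]
    simp only [h]
    have h0 : ∑ i ∈ Finset.range r₁, hor p i (t + 1) = 0 := by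
      refine Finset.sum_eq_zero fun i hi => ?_
      rw [Finset.mem_range] at hi
      exact hlow i t (by omega) ht (Or.inl hi)
    rw [h0, zero_sub]
  · rw [← hconst _ ⟨⟨hr.le, le_rfl⟩, hn⟩]
    simp only [h]
    -- On the last row of the strip the sum covers the entire cut, hence equals the net outflow of
    -- both rows up to column `t`; the part of `r₁` cancels.
    have h1 : ∑ i ∈ Finset.range r₂, hor p i (t + 1) = ∑ i ∈ Finset.range L, hor p i (t + 1) := by
      refine Finset.sum_subset (Finset.range_subset_range.2 hr₂.le) fun i hi hi' => ?_
      rw [Finset.mem_range] at hi hi'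
      rcases (not_lt.1 hi').lt_or_eq with h2 | h2
      · exact hlow i t hi ht (Or.inr h2)
      · subst h2
        exact (flow_eq_zero_of_notMem hp hr₂ ht hn).2.1
    rw [h1, ← sum_netOut_columns, ← Finset.sum_sub_distrib]
    refine Finset.sum_congr rfl fun j hj => ?_
    rw [Finset.mem_range] at hj
    rw [Finset.sum_eq_add_of_mem r₁ r₂ (Finset.mem_range.2 (by omega)) (Finset.mem_range.2 hr₂) hr.ne
      fun i hi hne => hdiv i j (Finset.mem_range.1 hi) (by omega) hne.1 hne.2]
    ring

end GridFlow

namespace GridFlow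

/-! ### Sums over noncrossing sets -/

theorem sum_filter_of_convex {T : ℕ} (b : ℕ → ℝ) {Q : ℕ → Prop} [DecidablePred Q]
    (hQ : ∀ i j t, i < t → t < j → j < T → Q i → Q j → Q t) :
    ∃ m ≤ T, ∃ n ≤ T, ∑ t ∈ Finset.range T with Q t, b t =
      ∑ t ∈ Finset.range n, b t - ∑ t ∈ Finset.range m, b t := by
  rcases (Finset.filter Q (Finset.range T)).eq_empty_or_nonempty with h | h
  · exact ⟨0, by omega, 0, by omega, by rw [h]; simp⟩
  · set F := Finset.filter Q (Finset.range T)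
    have hmin := Finset.mem_filter.1 (F.min'_mem h)
    have hmax := Finset.mem_filter.1 (F.max'_mem h)
    have hle : F.min' h ≤ F.max' h := F.min'_le _ (F.max'_mem h)
    simp only [Finset.mem_range] at hmin hmax
    refine ⟨F.min' h, hmin.1.le, F.max' h + 1, hmax.1, ?_⟩
    rw [← Finset.sum_Ico_eq_sub _ (by omega)]
    refine Finset.sum_congr ?_ fun _ _ => rfl
    ext t
    rw [Finset.mem_Ico]
    constructor
    · intro ht
      exact ⟨F.min'_le t ht, Nat.lt_succ_of_le (F.le_max' t ht)⟩
    · rintro ⟨h1, h2⟩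
      refine Finset.mem_filter.2 ⟨Finset.mem_range.2 (by omega), ?_⟩
      rcases h1.lt_or_eq with h1 | h1
      · rcases (Nat.lt_succ_iff.1 h2).lt_or_eq with h2 | h2
        · exact hQ _ _ t h1 h2 hmax.1 hmin.2 hmax.2
        · rw [h2]; exact hmax.2
      · rw [← h1]; exact hmin.2

theorem sum_filter_of_down {T : ℕ} (b : ℕ → ℝ) {Q : ℕ → Prop} [DecidablePred Q]
    (hQ : ∀ i t, t < i → i < T → Q i → Q t) :
    ∃ n ≤ T, ∑ t ∈ Finset.range T with Q t, b t = ∑ t ∈ Finset.range n, b t := by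
  induction T with
  | zero => exact ⟨0, le_rfl, by simp⟩
  | succ T ih =>
    by_cases h : Q T
    · refine ⟨T + 1, le_rfl, ?_⟩
      rw [Finset.filter_true_of_mem]
      intro t ht
      rw [Finset.mem_range] at ht
      rcases Nat.lt_succ_iff_lt_or_eq.1 ht with ht | rfl
      · exact hQ T t ht (by omega) h
      · exact h
    · obtain ⟨n, hn, hs⟩ := ih fun i t h1 h2 => hQ i t h1 (by omega)
      refine ⟨n, by omega, ?_⟩
      rw [Finset.range_add_one, Finset.filter_insert, if_neg h, hs]

theorem sum_filter_not {T : ℕ} (b : ℕ → ℝ) (Q : ℕ → Prop) [DecidablePred Q] :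
    ∑ t ∈ Finset.range T with Q t, b t =
      ∑ t ∈ Finset.range T, b t - ∑ t ∈ Finset.range T with ¬ Q t, b t := by
  rw [← Finset.sum_filter_add_sum_filter_not (Finset.range T) Q]
  ring

open Classical in
/-- The sets `U` and `V` of columns are the traces of a connected set with connected complement on
the first and the last row of a strip. Their supplies sum up to a sum of two prefix sums. -/
theorem sum_of_noncrossing {T : ℕ} {b₁ b₂ : ℕ → ℝ} {U V : ℕ → Prop} {Pf : ℝ → Prop}
    (htot : ∑ t ∈ Finset.range T, b₁ t + ∑ t ∈ Finset.range T, b₂ t = 0)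
    (hU : ∀ i i' t, i < t → t < i' → i' < T → U i → U i' → ¬ U t → ∀ t' < T, V t')
    (hV : ∀ i i' t, i < t → t < i' → i' < T → V i → V i' → ¬ V t → ∀ t' < T, U t')
    (hUU : ∀ i j t t', i < T → j < T → t < T → t' < T → U i → V j → ¬ U t → ¬ U t' →
      i ≤ t → i ≤ t')
    (hUV : ∀ i j t t', i < T → j < T → t < T → t' < T → U i → V j → ¬ U t → ¬ V t' →
      (i ≤ t ↔ j ≤ t'))
    (hVV : ∀ i j t t', i < T → j < T → t < T → t' < T → U i → V j → ¬ V t → ¬ V t' →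
      j ≤ t → j ≤ t')
    (h₁ : ∀ m ≤ T, Pf (∑ t ∈ Finset.range m, b₁ t) ∧ Pf (-∑ t ∈ Finset.range m, b₁ t))
    (h₂ : ∀ m ≤ T, Pf (∑ t ∈ Finset.range m, b₂ t) ∧ Pf (-∑ t ∈ Finset.range m, b₂ t)) :
    ∃ x y, Pf x ∧ Pf y ∧
      ∑ t ∈ Finset.range T with U t, b₁ t + ∑ t ∈ Finset.range T with V t, b₂ t = x + y := by
  -- If `V` is everything, then no element of `U` has gaps of `U` on both sides. So the complement
  -- of `U` is an interval, and since the total supply is zero it may replace `U`.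
  by_cases hVall : ∀ t < T, V t
  · have hconv : ∀ i j t, i < t → t < j → j < T → ¬ U i → ¬ U j → ¬ U t := by
      intro i j t hit htj hj hi hj' ht
      have := hUU t t j i (by omega) (by omega) hj (by omega) ht (hVall t (by omega)) hj' hi htj.le
      omega
    obtain ⟨m, hm, n, hn, hs⟩ := sum_filter_of_convex (T := T) b₁ hconv
    refine ⟨_, _, (h₁ m hm).1, (h₁ n hn).2, ?_⟩
    rw [sum_filter_not, hs, Finset.filter_true_of_mem fun t ht => hVall t (Finset.mem_range.1 ht)]
    linarith
  by_cases hUall : ∀ t < T, U t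
  · have hconv : ∀ i j t, i < t → t < j → j < T → ¬ V i → ¬ V j → ¬ V t := by
      intro i j t hit htj hj hi hj' ht
      have := hVV t t j i (by omega) (by omega) hj (by omega) (hUall t (by omega)) ht hj' hi htj.le
      omega
    obtain ⟨m, hm, n, hn, hs⟩ := sum_filter_of_convex (T := T) b₂ hconv
    refine ⟨_, _, (h₂ m hm).1, (h₂ n hn).2, ?_⟩
    rw [sum_filter_not b₂, hs, Finset.filter_true_of_mem fun t ht => hUall t (Finset.mem_range.1 ht)]
    linarith
  -- As neither set is everything, `hU` and `hV` exclude inner gaps, and both sets are intervals.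
  have hUc : ∀ i j t, i < t → t < j → j < T → U i → U j → U t := by
    intro i j t h1 h2 h3 h4 h5
    by_contra h6
    exact hVall (hU i j t h1 h2 h3 h4 h5 h6)
  have hVc : ∀ i j t, i < t → t < j → j < T → V i → V j → V t := by
    intro i j t h1 h2 h3 h4 h5
    by_contra h6
    exact hUall (hV i j t h1 h2 h3 h4 h5 h6)
  push Not at hVall hUall
  obtain ⟨v₀, hv₀, hv₀'⟩ := hVall
  obtain ⟨u₀, hu₀, hu₀'⟩ := hUall
  by_cases hVe : ∀ t < T, ¬ V t
  · obtain ⟨m, hm, n, hn, hs⟩ := sum_filter_of_convex (T := T) b₁ hUc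
    refine ⟨_, _, (h₁ n hn).1, (h₁ m hm).2, ?_⟩
    rw [hs, Finset.filter_false_of_mem fun t ht => hVe t (Finset.mem_range.1 ht)]
    simp; ring
  by_cases hUe : ∀ t < T, ¬ U t
  · obtain ⟨m, hm, n, hn, hs⟩ := sum_filter_of_convex (T := T) b₂ hVc
    refine ⟨_, _, (h₂ n hn).1, (h₂ m hm).2, ?_⟩
    rw [hs, Finset.filter_false_of_mem fun t ht => hUe t (Finset.mem_range.1 ht)]
    simp; ring
  push Not at hVe hUe
  obtain ⟨j₀, hj₀, hj₀'⟩ := hVe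
  obtain ⟨i₀, hi₀, hi₀'⟩ := hUe
  -- Now both sets are nonempty and proper. By `hUV` their gaps lie on a common side, so both are
  -- initial segments or both are final segments; final ones are replaced by their complements.
  have h0 := hUV i₀ j₀ u₀ v₀ hi₀ hj₀ hu₀ hv₀ hi₀' hj₀' hu₀' hv₀'
  by_cases hcase : i₀ ≤ u₀
  · obtain ⟨m, hm, hs⟩ := sum_filter_of_down (T := T) (Q := U) b₁ (by
      intro i t hti hi hUi
      by_contra ht
      have := hUV i j₀ t v₀ hi hj₀ (by omega) hv₀ hUi hj₀' ht hv₀'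
      omega)
    obtain ⟨n, hn, hs'⟩ := sum_filter_of_down (T := T) (Q := V) b₂ (by
      intro j t htj hj hVj
      by_contra ht
      have := hUV i₀ j u₀ t hi₀ hj hu₀ (by omega) hi₀' hVj hu₀' ht
      omega)
    exact ⟨_, _, (h₁ m hm).1, (h₂ n hn).1, by rw [hs, hs']⟩
  · obtain ⟨m, hm, hs⟩ := sum_filter_of_down (T := T) (Q := fun t => ¬ U t) b₁ (by
      intro i t hti hi hUi hUt
      have := hUV t j₀ i v₀ (by omega) hj₀ hi hv₀ hUt hj₀' hUi hv₀'
      omega)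
    obtain ⟨n, hn, hs'⟩ := sum_filter_of_down (T := T) (Q := fun t => ¬ V t) b₂ (by
      intro j t htj hj hVj hVt
      have := hUV i₀ t u₀ j hi₀ (by omega) hu₀ hj hi₀' hVt hu₀' hVj
      omega)
    refine ⟨_, _, (h₁ m hm).2, (h₂ n hn).2, ?_⟩
    rw [sum_filter_not b₁, sum_filter_not b₂, hs, hs']
    linarith

/-! ### Connected sets in a strip -/

variable {L T : ℕ}

/-- The indicator of the event that `s` lies in row `r`, in a column up to `t`. -/
noncomputable def rowInd (s : Vertex L T) (r t : ℕ) : ℝ :=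
  if s.1.val = r ∧ s.2.val ≤ t then 1 else 0

theorem rowInd_mk {l t' : ℕ} (hl : l < L) (ht : t' < T) (r t : ℕ) :
    rowInd ((⟨l, hl⟩, ⟨t', ht⟩) : Vertex L T) r t = if l = r ∧ t' ≤ t then 1 else 0 := rfl

theorem sum_indicator_row (s : Vertex L T) (r t : ℕ) (ht : t < T) (hr : r < L) :
    ∑ j ∈ Finset.range (t + 1), (if h : j < T then
      (if s = (⟨r, hr⟩, ⟨j, h⟩) then (1 : ℝ) else 0) else 0) = rowInd s r t := by
  have h : ∀ j ∈ Finset.range (t + 1), (if h : j < T then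
      (if s = (⟨r, hr⟩, ⟨j, h⟩) then (1 : ℝ) else 0) else 0) =
      if s.2.val = j then (if s.1.val = r then 1 else 0) else 0 := by
    intro j hj
    rw [Finset.mem_range] at hj
    rw [dif_pos (by omega)]
    obtain ⟨⟨l, hl⟩, ⟨t', ht'⟩⟩ := s
    simp only [Prod.mk.injEq, Fin.mk.injEq]
    split_ifs <;> simp_all
  rw [Finset.sum_congr rfl h, Finset.sum_ite_eq, rowInd]
  simp only [Finset.mem_range, Nat.lt_succ_iff]
  split_ifs <;> simp_all

/-- The arcs with both ends in `S`. -/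
def inside (S : Set (Vertex L T)) : Set (Arc L T) := {a | a.tail ∈ S ∧ a.head ∈ S}

/-- Apply `exists_potential` to a unit flow along a path inside `S`. The partial sums of its net
outflow only record which ends of the path lie to the left of a column, so all gaps of `S` in the
two rows must see the ends in compatible positions. -/
theorem noncrossing {r₁ r₂ : ℕ} (hr : r₁ < r₂) (hr₂ : r₂ < L) {S : Set (Vertex L T)}
    (hS : S ⊆ strip r₁ r₂) {c₀ : Vertex L T}
    (hc : ∀ v ∈ strip r₁ r₂ \ S, Linked (inside (strip r₁ r₂ \ S)) c₀ v)
    {s s' : Vertex L T} (hs : s.1.val = r₁ ∨ s.1.val = r₂) (hs' : s'.1.val = r₁ ∨ s'.1.val = r₂)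
    (hl : Linked (inside S) s s') :
    ∃ κ : ℝ, (∀ t (ht : t < T), ((⟨r₁, by omega⟩, ⟨t, ht⟩) : Vertex L T) ∉ S →
        rowInd s' r₁ t - rowInd s r₁ t = κ) ∧
      ∀ t (ht : t < T), ((⟨r₂, hr₂⟩, ⟨t, ht⟩) : Vertex L T) ∉ S →
        rowInd s r₂ t - rowInd s' r₂ t = κ := by
  obtain ⟨p, hp, hdiv⟩ := hl.exists_flow
  have hnet : ∀ l t (hl : l < L) (ht : t < T), netOut p l t =
      (if s = (⟨l, hl⟩, ⟨t, ht⟩) then 1 else 0) - (if s' = (⟨l, hl⟩, ⟨t, ht⟩) then 1 else 0) := by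
    intro l t hl ht
    rw [← hdiv, div_eq, netOut]
  have hsum : ∀ r t (hr : r < L), t < T → ∑ j ∈ Finset.range (t + 1), netOut p r j =
      rowInd s r t - rowInd s' r t := by
    intro r t hr ht
    rw [← sum_indicator_row s r t ht hr, ← sum_indicator_row s' r t ht hr,
      ← Finset.sum_sub_distrib]
    refine Finset.sum_congr rfl fun j hj => ?_
    rw [Finset.mem_range] at hj
    have hj' : j < T := by omega
    rw [dif_pos hj', dif_pos hj', hnet r j hr hj']
  obtain ⟨κ, h1, h2⟩ := exists_potential hr hr₂ hS hp (fun l t hl ht hne hne' => by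
    rw [hnet l t hl ht, if_neg, if_neg, sub_zero]
    · rintro rfl
      simp only at hs'
      omega
    · rintro rfl
      simp only at hs
      omega) hc
  refine ⟨κ, fun t ht hn => ?_, fun t ht hn => ?_⟩
  · rw [← h1 t ht hn, hsum r₁ t (by omega) ht, neg_sub]
  · rw [← h2 t ht hn, hsum r₂ t hr₂ ht]

/-- The supplies of a connected set with connected complement in a strip. -/
theorem sum_of_connected {r₁ r₂ : ℕ} (hr : r₁ < r₂) (hr₂ : r₂ < L) {S : Set (Vertex L T)}
    (hS : S ⊆ strip r₁ r₂) {c₀ s₀ : Vertex L T}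
    (hc : ∀ v ∈ strip r₁ r₂ \ S, Linked (inside (strip r₁ r₂ \ S)) c₀ v)
    (hs : ∀ v ∈ S, Linked (inside S) s₀ v) {b₁ b₂ : ℕ → ℝ} {Pf : ℝ → Prop}
    (htot : ∑ t ∈ Finset.range T, b₁ t + ∑ t ∈ Finset.range T, b₂ t = 0)
    (h₁ : ∀ m ≤ T, Pf (∑ t ∈ Finset.range m, b₁ t) ∧ Pf (-∑ t ∈ Finset.range m, b₁ t))
    (h₂ : ∀ m ≤ T, Pf (∑ t ∈ Finset.range m, b₂ t) ∧ Pf (-∑ t ∈ Finset.range m, b₂ t))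
    {U V : ℕ → Prop} [DecidablePred U] [DecidablePred V]
    (hU : ∀ t (ht : t < T), U t ↔ ((⟨r₁, by omega⟩, ⟨t, ht⟩) : Vertex L T) ∈ S)
    (hV : ∀ t (ht : t < T), V t ↔ ((⟨r₂, hr₂⟩, ⟨t, ht⟩) : Vertex L T) ∈ S) :
    ∃ x y, Pf x ∧ Pf y ∧
      ∑ t ∈ Finset.range T with U t, b₁ t + ∑ t ∈ Finset.range T with V t, b₂ t = x + y := by
  have hlink : ∀ v ∈ S, ∀ w ∈ S, Linked (inside S) v w :=
    fun v hv w hw => (hs v hv).symm.trans (hs w hw)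
  have key := fun (s s' : Vertex L T) hs hs' h => noncrossing hr hr₂ hS hc (s := s) (s' := s') hs hs' h
  -- A path from the upper to the lower row separates the strip, so all gaps lie on one side: `κ` is
  -- 0 if they are to the left and -1 if they are to the right.
  have hF3 : ∀ i j, i < T → j < T → U i → V j → ∃ κ : ℝ,
      (∀ t < T, ¬ U t → -(if i ≤ t then 1 else 0) = κ) ∧
      ∀ t < T, ¬ V t → -(if j ≤ t then 1 else 0) = κ := by
    intro i j hi hj hUi hVj
    obtain ⟨κ, k1, k2⟩ := key _ _ (Or.inl rfl) (Or.inr rfl)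
      (hlink _ ((hU i hi).1 hUi) _ ((hV j hj).1 hVj))
    refine ⟨κ, fun t ht hn => ?_, fun t ht hn => ?_⟩
    · rw [← k1 t ht (fun h => hn ((hU t ht).2 h)), rowInd_mk, rowInd_mk]
      simp [hr.ne']
    · rw [← k2 t ht (fun h => hn ((hV t ht).2 h)), rowInd_mk, rowInd_mk]
      simp [hr.ne]
  have hiff : ∀ (i t j t' : ℕ), (-(if i ≤ t then 1 else 0) : ℝ) = -(if j ≤ t' then 1 else 0) →
      (i ≤ t ↔ j ≤ t') := by
    intro i t j t' h
    split_ifs at h with h1 h2 h2 <;> first | omega | norm_num at h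
  have := sum_of_noncrossing (T := T) (b₁ := b₁) (b₂ := b₂) (U := U) (V := V) (Pf := Pf) htot
    ?_ ?_ ?_ ?_ ?_ h₁ h₂
  · convert this
  -- A gap enclosed between two ends in the upper row gives `κ = -1`, while any gap in the lower row
  -- would give `κ = 0`.
  · intro i i' t h1 h2 h3 hi hi' hn t' ht'
    by_contra hv
    obtain ⟨κ, k1, k2⟩ := key _ _ (Or.inl rfl) (Or.inl rfl)
      (hlink _ ((hU i (by omega)).1 hi) _ ((hU i' h3).1 hi'))
    have e1 := k1 t (by omega) (fun h => hn ((hU t (by omega)).2 h))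
    have e2 := k2 t' ht' (fun h => hv ((hV t' ht').2 h))
    rw [rowInd_mk, rowInd_mk, if_neg (by omega), if_pos (by omega)] at e1
    rw [rowInd_mk, rowInd_mk, if_neg (by omega), if_neg (by omega)] at e2
    linarith
  · intro i i' t h1 h2 h3 hi hi' hn t' ht'
    by_contra hv
    obtain ⟨κ, k1, k2⟩ := key _ _ (Or.inr rfl) (Or.inr rfl)
      (hlink _ ((hV i (by omega)).1 hi) _ ((hV i' h3).1 hi'))
    have e1 := k2 t (by omega) (fun h => hn ((hV t (by omega)).2 h))
    have e2 := k1 t' ht' (fun h => hv ((hU t' ht').2 h))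
    rw [rowInd_mk, rowInd_mk, if_pos (by omega), if_neg (by omega)] at e1
    rw [rowInd_mk, rowInd_mk, if_neg (by omega), if_neg (by omega)] at e2
    linarith
  · intro i j t t' hi hj ht ht' hUi hVj hn hn'
    obtain ⟨κ, k1, k2⟩ := hF3 i j hi hj hUi hVj
    exact (hiff i t i t' ((k1 t ht hn).trans (k1 t' ht' hn').symm)).1
  · intro i j t t' hi hj ht ht' hUi hVj hn hn'
    obtain ⟨κ, k1, k2⟩ := hF3 i j hi hj hUi hVj
    exact hiff i t j t' ((k1 t ht hn).trans (k2 t' ht' hn').symm)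
  · intro i j t t' hi hj ht ht' hUi hVj hn hn'
    obtain ⟨κ, k1, k2⟩ := hF3 i j hi hj hUi hVj
    exact (hiff j t j t' ((k2 t ht hn).trans (k2 t' ht' hn').symm)).1

theorem strip_linked {r₁ r₂ : ℕ} {v w : Vertex L T} (hv : v ∈ strip r₁ r₂)
    (hw : w ∈ strip r₁ r₂) : Linked (inside (strip r₁ r₂)) v w := by
  have h1 : ∀ l t t' (hl : l < L) (ht : t < T) (ht' : t' < T), t ≤ t' → r₁ ≤ l → l ≤ r₂ →
      Linked (inside (strip r₁ r₂)) ((⟨l, hl⟩, ⟨t, ht⟩) : Vertex L T) (⟨l, hl⟩, ⟨t', ht'⟩) := by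
    intro l t t' hl ht ht' htt h2 h3
    induction t', htt using Nat.le_induction with
    | base => exact .refl
    | succ t' _ ih =>
      exact .tail (ih (by omega)) ⟨fwdArc l t' hl ht', ⟨⟨h2, h3⟩, ⟨h2, h3⟩⟩, Or.inl ⟨rfl, rfl⟩⟩
  have h2 : ∀ l l' t (hl : l < L) (hl' : l' < L) (ht : t < T), l ≤ l' → r₁ ≤ l → l' ≤ r₂ →
      Linked (inside (strip r₁ r₂)) ((⟨l, hl⟩, ⟨t, ht⟩) : Vertex L T) (⟨l', hl'⟩, ⟨t, ht⟩) := by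
    intro l l' t hl hl' ht hll h2 h3
    induction l', hll using Nat.le_induction with
    | base => exact .refl
    | succ l' hle ih =>
      exact .tail (ih (by omega) (by omega)) ⟨downArc l' t hl' ht,
        ⟨⟨h2.trans hle, (Nat.le_succ _).trans h3⟩, ⟨(h2.trans hle).trans (Nat.le_succ _), h3⟩⟩,
        Or.inl ⟨rfl, rfl⟩⟩
  obtain ⟨⟨l, hl⟩, ⟨t, ht⟩⟩ := v
  obtain ⟨⟨l', hl'⟩, ⟨t', ht'⟩⟩ := w
  have hv' : r₁ ≤ l ∧ l ≤ r₂ := hv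
  have hw' : r₁ ≤ l' ∧ l' ≤ r₂ := hw
  have e1 : Linked (inside (strip r₁ r₂)) ((⟨l, hl⟩, ⟨t, ht⟩) : Vertex L T) (⟨l', hl'⟩, ⟨t, ht⟩) := by
    rcases le_total l l' with h | h
    · exact h2 l l' t hl hl' ht h hv'.1 hw'.2
    · exact (h2 l' l t hl' hl ht h hw'.1 hv'.2).symm
  refine e1.trans ?_
  rcases le_total t t' with h | h
  · exact h1 l' t t' hl' ht ht' h hw'.1 hw'.2
  · exact (h1 l' t' t hl' ht' ht h hw'.1 hw'.2).symm

end GridFlow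

namespace GridFlow

variable {L T : ℕ}

/-! ### The flow values of rigid flows -/

namespace MFG

variable (P : MFG L T)

/-- The supplies, as they are stored in the input. -/
noncomputable def supply : ℕ → ℝ := P.input.val 0

/-- The different finite capacities, as they are stored in the input. -/
noncomputable def caps : Finset ℝ := capsBelow (P.input.idx 1) (P.input.val 1) (2 * (T * L))

variable {P}

theorem supply_eq {l t : ℕ} (hl : l < L) (ht : t < T) :
    P.supply (t * L + l) = P.b (⟨l, hl⟩, ⟨t, ht⟩) := by
  have h : t * L + l = vertexCode ((⟨l, hl⟩, ⟨t, ht⟩) : Vertex L T) := rfl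
  rw [h]
  exact vertexCode_injective.extend_apply (fun v => (P.b v : ℝ)) 0 _

theorem input_flag (a : Arc L T) : P.input.idx 1 (arcCode a) = if P.U a = ⊤ then 0 else 1 :=
  arcCode_injective.extend_apply (fun a => if P.U a = ⊤ then 0 else 1) 0 a

theorem input_cap (a : Arc L T) : P.input.val 1 (arcCode a) = ((P.U a).toNat : ℝ) :=
  arcCode_injective.extend_apply (fun a => ((P.U a).toNat : ℝ)) 0 a

theorem mem_caps {x : ℝ} : x ∈ P.caps ↔ ∃ a, P.U a ≠ ⊤ ∧ ((P.U a).toNat : ℝ) = x := by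
  rw [caps, mem_capsBelow]
  constructor
  · rintro ⟨r, hr, h1, rfl⟩
    by_cases h : ∃ a : Arc L T, arcCode a = r
    · obtain ⟨a, rfl⟩ := h
      rw [input_flag] at h1
      refine ⟨a, fun hU => ?_, (input_cap a).symm⟩
      simp [hU] at h1
    · have h0 : P.input.idx 1 r = 0 :=
        Function.extend_apply' (fun a => if P.U a = ⊤ then 0 else 1) (0 : ℕ → ℕ) r h
      omega
  · rintro ⟨a, ha, rfl⟩
    exact ⟨arcCode a, arcCode_lt a, by rw [input_flag, if_neg ha], input_cap a⟩

theorem card_caps : P.caps.card = P.K := by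
  have h : P.caps = ((Finset.univ.image P.U).filter (· < ⊤)).image fun u => (u.toNat : ℝ) := by
    ext x
    rw [mem_caps]
    simp only [Finset.mem_image, Finset.mem_filter, Finset.mem_univ, true_and, lt_top_iff_ne_top]
    constructor
    · rintro ⟨a, ha, h⟩
      exact ⟨_, ⟨⟨a, rfl⟩, ha⟩, h⟩
    · rintro ⟨_, ⟨⟨a, rfl⟩, ha⟩, h⟩
      exact ⟨a, ha, h⟩
  rw [h, Finset.card_image_of_injOn, K]
  intro u hu v hv huv
  simp only [Finset.coe_filter, Set.mem_ofPred_eq, lt_top_iff_ne_top] at hu hv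
  have h' : u.toNat = v.toNat := Nat.cast_injective (R := ℝ) huv
  rw [← ENat.natCast_toNat hu.2, ← ENat.natCast_toNat hv.2, h']

/-- The strip argument needs two different rows; if the given ones coincide, an arbitrary further
row is added. -/
theorem InTwoRows.exists_lt (h : P.InTwoRows) (hL : 2 ≤ L) :
    ∃ r₁ r₂, r₁ < r₂ ∧ r₂ < L ∧ ∀ v, P.b v ≠ 0 → v.1.val = r₁ ∨ v.1.val = r₂ := by
  obtain ⟨⟨r₁, h₁⟩, ⟨r₂, h₂⟩, h⟩ := h
  simp only [Fin.ext_iff] at h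
  rcases lt_trichotomy r₁ r₂ with hlt | rfl | hlt
  · exact ⟨r₁, r₂, hlt, h₂, h⟩
  · rcases Nat.eq_zero_or_pos r₁ with rfl | h0
    · exact ⟨0, 1, by omega, by omega, fun v hv => Or.inl (by simpa using h v hv)⟩
    · exact ⟨0, r₁, h0, h₂, fun v hv => Or.inr (by simpa using h v hv)⟩
  · exact ⟨r₂, r₁, hlt, h₁, fun v hv => (h v hv).symm⟩

/-- In the summation by parts all terms have the same sign and the total is zero, so each term
vanishes. -/
theorem eq_zero_of_potential {f : Arc L T → ℝ} (hf : f ∈ P.feasible) {φ : Vertex L T → ℝ}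
    (hφ : ∀ a : Arc L T, φ a.tail ≤ φ a.head) (h0 : ∀ v, φ v * P.b v = 0) {a : Arc L T}
    (ha : φ a.tail < φ a.head) : f a = 0 := by
  have h := sum_mul_div φ f
  rw [Finset.sum_congr rfl fun v _ => by rw [div_of_feasible hf, h0], Finset.sum_const_zero] at h
  have h1 := (Finset.sum_eq_zero_iff_of_nonpos (fun e _ =>
    mul_nonpos_of_nonneg_of_nonpos (hf.2 e).1 (by linarith [hφ e]))).1 h.symm a (Finset.mem_univ a)
  rcases mul_eq_zero.1 h1 with h2 | h2
  · exact h2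
  · linarith

/-- Arcs never go up, so flow above the first supply row would need a source there, and flow below
the last one a sink. -/
theorem mem_inside_strip {r₁ r₂ : ℕ} (hb : ∀ v, P.b v ≠ 0 → v.1.val = r₁ ∨ v.1.val = r₂)
    (hr : r₁ ≤ r₂) {f : Arc L T → ℝ} (hf : f ∈ P.feasible) {a : Arc L T} (ha : f a ≠ 0) :
    a ∈ inside (strip r₁ r₂) := by
  have key : ∀ φ : ℕ → ℕ → ℝ, (∀ l t, l + 1 < L → t < T → φ l t ≤ φ (l + 1) t) →
      (∀ l t, l < L → t + 1 < T → φ l t ≤ φ l (t + 1)) →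
      (∀ l t, r₁ ≤ l → l ≤ r₂ → φ l t = 0) →
      φ a.tail.1 a.tail.2 = φ a.head.1 a.head.2 := by
    intro φ hdown hfwd h0
    have hle : ∀ e : Arc L T, φ e.tail.1 e.tail.2 ≤ φ e.head.1 e.head.2 := by
      intro e
      rcases e.eq_fwdArc_or_downArc with ⟨l, t, hl, ht, rfl⟩ | ⟨l, t, hl, ht, rfl⟩
      · exact hfwd l t hl ht
      · exact hdown l t hl ht
    refine (hle a).eq_of_not_lt fun hlt => ha ?_
    refine eq_zero_of_potential hf (φ := fun v => φ v.1 v.2) hle (fun v => ?_) hlt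
    by_cases h : P.b v = 0
    · simp [h]
    · rw [h0 v.1 v.2, zero_mul] <;> rcases hb v h with h | h <;> omega
  -- This potential is negative and strictly increasing along arcs above the strip, and zero from
  -- row `r₁` on; it excludes tails above the strip.
  have h1 := key (fun l t => if l < r₁ then (l + t : ℝ) - (L + T) else 0) (by
      intro l t hl ht
      have : (l : ℝ) + 1 < L := by exact_mod_cast hl
      have : (t : ℝ) < T := by exact_mod_cast ht
      split_ifs <;> first | omega | (push_cast; linarith)) (by
      intro l t hl ht
      split_ifs <;> (push_cast; linarith)) (by
      intro l t h1 h2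
      simp [h1])
  -- Symmetrically, this one is zero down to row `r₂`, and positive and strictly increasing below;
  -- it excludes heads below the strip.
  have h2 := key (fun l t => if r₂ < l then (l + t : ℝ) + 1 else 0) (by
      intro l t hl ht
      split_ifs <;> first | omega | (push_cast; linarith)) (by
      intro l t hl ht
      split_ifs <;> (push_cast; linarith)) (by
      intro l t h1 h2
      simp [h2])
  rcases a.eq_fwdArc_or_downArc with ⟨l, t, hl, ht, rfl⟩ | ⟨l, t, hl, ht, rfl⟩
  · have e1 : ¬ l < r₁ := by
      intro h
      simp [fwdArc, Arc.tail, Arc.head, h] at h1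
    have e2 : ¬ r₂ < l := by
      intro h
      simp [fwdArc, Arc.tail, Arc.head, h] at h2
    exact ⟨⟨not_lt.1 e1, not_lt.1 e2⟩, ⟨not_lt.1 e1, not_lt.1 e2⟩⟩
  · have e1 : ¬ l < r₁ := by
      intro h
      have : (l : ℝ) + 1 < L := by exact_mod_cast hl
      have : (t : ℝ) < T := by exact_mod_cast ht
      change (if l < r₁ then (l + t : ℝ) - (L + T) else 0) =
        if l + 1 < r₁ then ((l + 1 : ℕ) + t : ℝ) - (L + T) else 0 at h1
      rw [if_pos h] at h1
      push_cast at h1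
      split_ifs at h1 <;> linarith
    have e2 : ¬ r₂ < l + 1 := by
      intro h
      have : (0 : ℝ) ≤ l := by positivity
      have : (0 : ℝ) ≤ t := by positivity
      change (if r₂ < l then (l + t : ℝ) + 1 else 0) =
        if r₂ < l + 1 then ((l + 1 : ℕ) + t : ℝ) + 1 else 0 at h2
      rw [if_pos h] at h2
      push_cast at h2
      by_cases h3 : r₂ < l
      · rw [if_pos h3] at h2
        linarith
      · rw [if_neg h3] at h2
        linarith
    refine ⟨⟨not_lt.1 e1, ?_⟩, ⟨?_, not_lt.1 e2⟩⟩
    · change l ≤ r₂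
      omega
    · change r₁ ≤ l + 1
      omega

theorem eq_of_not_free {f : Arc L T → ℝ} (hf : f ∈ P.feasible) {a : Arc L T} (h : ¬ P.Free f a) :
    f a = 0 ∨ P.U a ≠ ⊤ ∧ f a = (P.U a).toNat := by
  rcases (hf.2 a).1.eq_or_lt with h0 | h0
  · exact Or.inl h0.symm
  · right
    simp only [Free, not_and, not_forall] at h
    obtain ⟨n, hn, hle⟩ := h h0
    refine ⟨by simp [hn], ?_⟩
    rw [hn, ENat.toNat_natCast]
    exact le_antisymm ((hf.2 a).2 n hn) (not_lt.1 hle)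

end MFG

theorem sum_two_rows {r₁ r₂ : ℕ} (hr : r₁ < r₂) (hr₂ : r₂ < L) {g : Vertex L T → ℝ}
    (hg : ∀ v, g v ≠ 0 → v.1.val = r₁ ∨ v.1.val = r₂) :
    ∑ v, g v = ∑ t : Fin T, g (⟨r₁, by omega⟩, t) + ∑ t : Fin T, g (⟨r₂, hr₂⟩, t) := by
  rw [Fintype.sum_prod_type, ← Finset.sum_subset (Finset.subset_univ
    {(⟨r₁, by omega⟩ : Fin L), ⟨r₂, hr₂⟩}), Finset.sum_pair]
  · simp [hr.ne]
  · intro l _ hl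
    refine Finset.sum_eq_zero fun t _ => ?_
    by_contra h
    apply hl
    rcases hg _ h with h | h
    · simp [Fin.ext_iff, ← h]
    · simp [Fin.ext_iff, ← h]

theorem Linked.inside_reachable {E : Set (Arc L T)} {u v : Vertex L T} (h : Linked E u v) :
    Linked (inside {w | Linked E u w}) u v := by
  induction h with
  | refl => exact .refl
  | @tail v w hv hstep ih =>
    refine ih.tail ?_
    have hw : Linked E u w := hv.tail hstep
    obtain ⟨a, ha, ⟨rfl, rfl⟩ | ⟨rfl, rfl⟩⟩ := hstep
    · exact ⟨a, ⟨hv, hw⟩, Or.inl ⟨rfl, rfl⟩⟩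
    · exact ⟨a, ⟨hw, hv⟩, Or.inr ⟨rfl, rfl⟩⟩

theorem inside_mono {S S' : Set (Vertex L T)} (h : S ⊆ S') : inside S ⊆ inside S' :=
  fun _ ha => ⟨h ha.1, h ha.2⟩

/-- A set of vertices of a strip that is connected by `E` has a connected superset whose
complement is the component of a given vertex `c`; arcs of `E` do not leave it. -/
theorem exists_cut {r₁ r₂ : ℕ} {E : Set (Arc L T)} (hE : E ⊆ inside (strip r₁ r₂))
    {u c : Vertex L T} (hu : u ∈ strip r₁ r₂) (hc : c ∈ strip r₁ r₂) (huc : ¬ Linked E u c) :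
    ∃ S ⊆ strip r₁ r₂, u ∈ S ∧ c ∉ S ∧ (∀ v ∈ S, Linked (inside S) u v) ∧
      (∀ v ∈ strip r₁ r₂ \ S, Linked (inside (strip r₁ r₂ \ S)) c v) ∧
      ∀ a ∈ E, (a.tail ∈ S ↔ a.head ∈ S) := by
  -- `S₀` is the component of `u`, and `C` is the component of `c` in the rest of the strip. The cut
  -- is the complement of `C`, that is, `S₀` with its holes filled.
  set S₀ : Set (Vertex L T) := {w | Linked E u w} with hS₀
  set C : Set (Vertex L T) := {w | Linked (inside (strip r₁ r₂ \ S₀)) c w} with hC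
  have hSE : S₀ ⊆ strip r₁ r₂ := by
    intro w hw
    induction hw with
    | refl => exact hu
    | tail _ hstep =>
      obtain ⟨a, ha, ⟨rfl, rfl⟩ | ⟨rfl, rfl⟩⟩ := hstep
      · exact (hE ha).2
      · exact (hE ha).1
  have hCS : C ⊆ strip r₁ r₂ \ S₀ := by
    intro w hw
    induction hw with
    | refl => exact ⟨hc, huc⟩
    | tail _ hstep =>
      obtain ⟨a, ha, ⟨rfl, rfl⟩ | ⟨rfl, rfl⟩⟩ := hstep
      · exact ha.2
      · exact ha.1
  have hsub : S₀ ⊆ strip r₁ r₂ \ C := fun w hw => ⟨hSE hw, fun h => (hCS h).2 hw⟩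
  have hcompl : strip r₁ r₂ \ (strip r₁ r₂ \ C) = C := by
    rw [Set.sdiff_sdiff_cancel_left fun w hw => (hCS hw).1]
  have hstepC : ∀ v w, (∃ a ∈ inside (strip r₁ r₂), a.tail = v ∧ a.head = w ∨
      a.tail = w ∧ a.head = v) → w ∈ C → v ∉ S₀ → v ∈ C := by
    rintro v w ⟨a, ha, h⟩ hw hv
    refine Relation.ReflTransGen.tail hw ?_
    obtain ⟨rfl, rfl⟩ | ⟨rfl, rfl⟩ := h
    · exact ⟨a, ⟨⟨ha.1, hv⟩, hCS hw⟩, Or.inr ⟨rfl, rfl⟩⟩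
    · exact ⟨a, ⟨hCS hw, ⟨ha.2, hv⟩⟩, Or.inl ⟨rfl, rfl⟩⟩
  have hstepS : ∀ v w, (∃ a ∈ E, a.tail = v ∧ a.head = w ∨ a.tail = w ∧ a.head = v) →
      v ∈ strip r₁ r₂ \ C → w ∈ C → False := by
    intro v w hvw hv hw
    have hv0 : v ∉ S₀ := fun h => (hCS hw).2 (Relation.ReflTransGen.tail h hvw)
    obtain ⟨a, ha, h⟩ := hvw
    exact hv.2 (hstepC v w ⟨a, hE ha, h⟩ hw hv0)
  refine ⟨strip r₁ r₂ \ C, Set.sdiff_subset, hsub .refl, fun h => h.2 .refl, ?_, ?_, ?_⟩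
  · have h0 : ∀ v ∈ S₀, Linked (inside (strip r₁ r₂ \ C)) u v := fun v hv =>
      (Linked.inside_reachable hv).mono (inside_mono hsub)
    intro v hv
    -- A walk in the strip towards `u` cannot pass from a hole into `C` before it meets `S₀`; so
    -- every hole is attached to `S₀`.
    have hvu := strip_linked hv.1 hu
    induction hvu using Relation.ReflTransGen.head_induction_on with
    | refl => exact .refl
    | @head v w hstep _ ih =>
      by_cases hv0 : v ∈ S₀
      · exact h0 v hv0
      have hwC : w ∉ C := fun hw => hv.2 (hstepC v w hstep hw hv0)
      obtain ⟨a, ha, h⟩ := hstep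
      have hw : w ∈ strip r₁ r₂ := by
        obtain ⟨rfl, rfl⟩ | ⟨rfl, rfl⟩ := h
        · exact ha.2
        · exact ha.1
      refine (ih ⟨hw, hwC⟩).tail ?_
      obtain ⟨rfl, rfl⟩ | ⟨rfl, rfl⟩ := h
      · exact ⟨a, ⟨hv, ⟨hw, hwC⟩⟩, Or.inr ⟨rfl, rfl⟩⟩
      · exact ⟨a, ⟨⟨hw, hwC⟩, hv⟩, Or.inl ⟨rfl, rfl⟩⟩
  · rw [hcompl]
    exact fun v hv => Linked.inside_reachable hv
  · intro a ha
    constructor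
    · intro h
      refine ⟨(hE ha).2, fun hC' => hstepS _ _ ⟨a, ha, Or.inl ⟨rfl, rfl⟩⟩ h hC'⟩
    · intro h
      refine ⟨(hE ha).1, fun hC' => hstepS _ _ ⟨a, ha, Or.inr ⟨rfl, rfl⟩⟩ h hC'⟩

theorem isPrefix_row {b : ℕ → ℝ} {l m : ℕ} (hl : l < L) (hm : m ≤ T) :
    IsPrefix b L T (∑ t ∈ Finset.range m, b (t * L + l)) ∧
      IsPrefix b L T (-∑ t ∈ Finset.range m, b (t * L + l)) := by
  rcases m with _ | t
  · exact ⟨Or.inl (by simp), Or.inl (by simp)⟩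
  · exact ⟨Or.inr ⟨l, hl, t, hm, Or.inl rfl⟩, Or.inr ⟨l, hl, t, hm, Or.inr rfl⟩⟩

/-- The supply of a connected set with connected complement in the strip between the two rows. -/
theorem MFG.sum_supply {P : MFG L T} {r₁ r₂ : ℕ} (hr : r₁ < r₂) (hr₂ : r₂ < L)
    (hb : ∀ v, P.b v ≠ 0 → v.1.val = r₁ ∨ v.1.val = r₂) {S : Set (Vertex L T)}
    [DecidablePred (· ∈ S)] (hS : S ⊆ strip r₁ r₂) {c₀ s₀ : Vertex L T}
    (hc : ∀ v ∈ strip r₁ r₂ \ S, Linked (inside (strip r₁ r₂ \ S)) c₀ v)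
    (hs : ∀ v ∈ S, Linked (inside S) s₀ v) :
    ∃ x y, IsPrefix P.supply L T x ∧ IsPrefix P.supply L T y ∧
      ∑ v, (if v ∈ S then (1 : ℝ) else 0) * P.b v = x + y := by
  classical
  have hb' : ∀ v : Vertex L T, (P.b v : ℝ) ≠ 0 → v.1.val = r₁ ∨ v.1.val = r₂ :=
    fun v hv => hb v (by exact_mod_cast hv)
  have hrow : ∀ r (h : r < L) (W : Set (Vertex L T)) (_ : DecidablePred (· ∈ W)),
      ∑ t : Fin T, (if ((⟨r, h⟩, t) : Vertex L T) ∈ W then (1 : ℝ) else 0) * P.b (⟨r, h⟩, t) =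
        ∑ t ∈ Finset.range T with ∃ ht : t < T, ((⟨r, h⟩, ⟨t, ht⟩) : Vertex L T) ∈ W,
          P.supply (t * L + r) := by
    intro r h W _
    rw [Finset.sum_filter, Finset.sum_range]
    refine Finset.sum_congr rfl fun t _ => ?_
    rw [supply_eq h t.2]
    simp
  obtain ⟨x, y, hx, hy, hxy⟩ := sum_of_connected hr hr₂ hS hc hs
    (b₁ := fun t => P.supply (t * L + r₁)) (b₂ := fun t => P.supply (t * L + r₂))
    (Pf := IsPrefix P.supply L T) (U := fun t => ∃ ht : t < T,
      ((⟨r₁, by omega⟩, ⟨t, ht⟩) : Vertex L T) ∈ S)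
    (V := fun t => ∃ ht : t < T, ((⟨r₂, hr₂⟩, ⟨t, ht⟩) : Vertex L T) ∈ S)
    (by
      have h := sum_two_rows (L := L) (T := T) hr hr₂ (g := fun v => (P.b v : ℝ)) hb'
      rw [← Int.cast_sum, P.sum_b, Int.cast_zero] at h
      rw [h, Finset.sum_range, Finset.sum_range]
      congr 1 <;> refine Finset.sum_congr rfl fun t _ => ?_
      · rw [supply_eq _ t.2]
      · rw [supply_eq _ t.2])
    (fun m hm => isPrefix_row (by omega) hm) (fun m hm => isPrefix_row hr₂ hm)
    (fun t ht => ⟨fun h => h.2, fun h => ⟨ht, h⟩⟩) (fun t ht => ⟨fun h => h.2, fun h => ⟨ht, h⟩⟩)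
  refine ⟨x, y, hx, hy, ?_⟩
  rw [← hxy, sum_two_rows hr hr₂ (g := fun v => (if v ∈ S then (1 : ℝ) else 0) * P.b v)
    (fun v hv => hb' v (right_ne_zero_of_mul hv)), hrow r₁ (by omega) S inferInstance,
    hrow r₂ hr₂ S inferInstance]

/-- The value of a rigid flow on an arc is a sum of two prefix sums and of multiples of the
capacities. -/
theorem MFG.Rigid.exists_eq {P : MFG L T} (hL : 2 ≤ L) (h2 : P.InTwoRows) {f : Arc L T → ℝ}
    (hf : f ∈ P.feasible) (hr : P.Rigid f) (a : Arc L T) :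
    ∃ x y, IsPrefix P.supply L T x ∧ IsPrefix P.supply L T y ∧ ∃ c : ℝ → ℤ,
      (∀ u, |c u| ≤ (2 * (T * L) : ℕ)) ∧ f a = x + y + ∑ u ∈ P.caps, c u * u := by
  classical
  obtain ⟨r₁, r₂, hrr, hr₂, hb⟩ := h2.exists_lt hL
  by_cases ha : P.Free f a
  · have hfree : ∀ e, P.Free f e → e ∈ inside (strip r₁ r₂) := fun e he =>
      mem_inside_strip hb hrr.le hf he.1.ne'
    set E : Set (Arc L T) := {e | P.Free f e ∧ e ≠ a} with hE
    -- Otherwise `a` would close a cycle of free arcs, against rigidity.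
    have hlink : ¬ Linked E a.tail a.head := by
      intro h
      obtain ⟨p, hp, hdiv⟩ := h.exists_flow
      have hz := hr (p - Pi.single a 1) (fun v => by rw [div_sub, hdiv, div_single, sub_self])
        (fun e he => by
          by_cases hea : e = a
          · rw [hea]; exact ha
          · exact (hp e (by simpa [hea] using he)).1)
      have hpa : p a = 0 := by
        by_contra h'
        exact (hp a h').2 rfl
      have := congrFun hz a
      simp [hpa] at this
    obtain ⟨S, hS, hu, hv, hs, hc, hcut⟩ := exists_cut (fun e he => hfree e he.1) (hfree a ha).1
      (hfree a ha).2 hlink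
    obtain ⟨x, y, hx, hy, hxy⟩ := MFG.sum_supply hrr hr₂ hb hS hc hs
    -- The sign with which an arc crosses the boundary of `S`.
    let ε : Arc L T → ℤ := fun e =>
      (if e.tail ∈ S then 1 else 0) - (if e.head ∈ S then 1 else 0)
    have hε : ∀ e, |ε e| ≤ 1 := by
      intro e
      simp only [ε]
      split_ifs <;> simp
    let N : Finset (Arc L T) := Finset.univ.filter fun e =>
      e ≠ a ∧ P.U e ≠ ⊤ ∧ f e = (P.U e).toNat
    -- The coefficient of a capacity `u` collects the crossings of the saturated arcs that carry
    -- exactly `u`; it is bounded by the number of arcs.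
    refine ⟨x, y, hx, hy, fun u => -∑ e ∈ N with f e = u, ε e, fun u => ?_, ?_⟩
    · rw [abs_neg]
      refine (Finset.abs_sum_le_sum_abs _ _).trans ((Finset.sum_le_card_nsmul _ _ 1
        fun e _ => hε e).trans ?_)
      rw [nsmul_one]
      exact_mod_cast (Finset.card_le_univ _).trans card_arc_le
    -- The supply of `S` equals its net outflow. Free arcs other than `a` do not cross the cut and
    -- empty arcs carry nothing, so only `a` and saturated arcs remain.
    · have h1 := sum_mul_div (fun v => if v ∈ S then (1 : ℝ) else 0) f
      simp only [div_of_feasible hf] at h1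
      rw [hxy] at h1
      have h3 : ∑ e, f e * ((if e.tail ∈ S then (1 : ℝ) else 0) - (if e.head ∈ S then 1 else 0)) =
          f a + ∑ e ∈ N, f e * ε e := by
        have haN : a ∉ N := by simp [N]
        rw [← Finset.sum_subset (Finset.subset_univ (insert a N)), Finset.sum_insert haN]
        · simp only [hu, hv, if_true, if_false, ε]
          push_cast
          ring
        · intro e _ he
          simp only [Finset.mem_insert, not_or] at he
          by_cases hef : P.Free f e
          · simp only [hcut e ⟨hef, he.1⟩, sub_self, mul_zero]
          · rcases eq_of_not_free hf hef with h | h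
            · rw [h, zero_mul]
            · exact absurd (Finset.mem_filter.2 ⟨Finset.mem_univ _, he.1, h⟩) he.2
      have h4 : ∑ u ∈ P.caps, ((-∑ e ∈ N with f e = u, ε e : ℤ) : ℝ) * u =
          -∑ e ∈ N, f e * ε e := by
        rw [← Finset.sum_fiberwise_of_maps_to (g := f) (t := P.caps), ← Finset.sum_neg_distrib]
        · refine Finset.sum_congr rfl fun u _ => ?_
          push_cast
          rw [neg_mul, Finset.sum_mul]
          congr 1
          refine Finset.sum_congr rfl fun e he => ?_
          rw [(Finset.mem_filter.1 he).2, mul_comm]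
        · intro e he
          obtain ⟨-, -, h5, h6⟩ := Finset.mem_filter.1 he
          exact mem_caps.2 ⟨e, h5, h6.symm⟩
      rw [h4]
      linarith
  · have hpos : 1 ≤ 2 * (T * L) := by have := arcCode_lt a; omega
    rcases eq_of_not_free hf ha with h | ⟨h, h'⟩
    · exact ⟨0, 0, Or.inl rfl, Or.inl rfl, 0, fun u => by simp; positivity, by simp [h]⟩
    · refine ⟨0, 0, Or.inl rfl, Or.inl rfl, fun u => if u = f a then 1 else 0, fun u => ?_, ?_⟩
      · dsimp only
        split_ifs
        · rw [abs_one]; exact_mod_cast hpos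
        · rw [abs_zero]; positivity
      · have hmem : f a ∈ P.caps := mem_caps.2 ⟨a, h, h'.symm⟩
        simp [hmem]

theorem rowPrefix_eq_zero {P : MFG L T} {r₁ r₂ l : ℕ}
    (hb : ∀ v, P.b v ≠ 0 → v.1.val = r₁ ∨ v.1.val = r₂) (hl : l < L) (h₁ : l ≠ r₁) (h₂ : l ≠ r₂)
    {t : ℕ} (ht : t ≤ T) : rowPrefix P.supply L l t = 0 := by
  refine Finset.sum_eq_zero fun t' ht' => ?_
  rw [Finset.mem_range] at ht'
  rw [MFG.supply_eq hl (by omega : t' < T)]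
  by_contra h
  have := hb (⟨l, hl⟩, ⟨t', by omega⟩) (by exact_mod_cast h)
  simp only at this
  omega

/-- Two rows, at most `T` nonzero prefix sums in each, and two signs. -/
theorem prefixCount_le {P : MFG L T} (hL : 2 ≤ L) (h2 : P.InTwoRows) :
    prefixCount P.supply L T ≤ 4 * T := by
  classical
  obtain ⟨r₁, r₂, hrr, hr₂, hb⟩ := h2.exists_lt hL
  have h : ∀ l ∈ Finset.range L, ∑ t ∈ Finset.range T,
      (if rowPrefix P.supply L l (t + 1) = 0 then 0 else 2) ≤
      if l = r₁ ∨ l = r₂ then 2 * T else 0 := by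
    intro l hl
    rw [Finset.mem_range] at hl
    split_ifs with h
    · refine (Finset.sum_le_card_nsmul _ _ 2 fun t _ => by split_ifs <;> omega).trans ?_
      simp [mul_comm]
    · refine (Finset.sum_eq_zero fun t ht => ?_).le
      rw [Finset.mem_range] at ht
      rw [if_pos (rowPrefix_eq_zero hb hl (by omega) (by omega) ht)]
  refine (Finset.sum_le_sum h).trans ?_
  rw [← Finset.sum_filter, Finset.sum_const, smul_eq_mul]
  have : ((Finset.range L).filter fun l => l = r₁ ∨ l = r₂).card ≤ 2 := by
    refine (Finset.card_le_card (t := {r₁, r₂}) fun l hl => ?_).trans Finset.card_le_two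
    simpa using (Finset.mem_filter.1 hl).2
  nlinarith

end GridFlow

namespace GridFlow

/-! ### Sequences of states and flows -/

theorem exists_digits {M : ℕ} (d : ℕ → ℕ) (hd : ∀ l, d l < M) (n : ℕ) :
    ∃ s < M ^ n, ∀ l < n, digit M s l = d l := by
  induction n generalizing d with
  | zero => exact ⟨0, by simp, by simp⟩
  | succ n ih =>
    obtain ⟨s, hs, h⟩ := ih (fun l => d (l + 1)) fun l => hd (l + 1)
    have h0 := hd 0
    refine ⟨d 0 + M * s, ?_, fun l hl => ?_⟩
    · calc d 0 + M * s < M * (s + 1) := by rw [mul_add]; omega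
        _ ≤ M * M ^ n := Nat.mul_le_mul_left _ hs
        _ = _ := by rw [pow_succ']
    · rcases l with _ | l
      · simp [digit, Nat.mod_eq_of_lt h0]
      · rw [← h l (by omega), digit, digit, pow_succ', ← Nat.div_div_eq_div_mul,
          Nat.add_mul_div_left _ _ (by omega), Nat.div_eq_of_lt h0, zero_add]

theorem digit_zero (M l : ℕ) : digit M 0 l = 0 := by simp [digit]

variable {L T : ℕ}

/-- The dynamic program for the instance `P`, with the candidate list `R` of length `M`. -/
structure Tables.Models (D : Tables) (P : MFG L T) (R : ℕ → ℝ) (M : ℕ) : Prop where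
  hL : D.L = L
  hb : D.b = P.supply
  hflag : D.flag = P.input.idx 1
  hcap : D.cap = P.input.val 1
  hO : D.O = P.oracle
  ready : D.Ready R M (M ^ (L - 1)) T
  one_le_L : 1 ≤ L
  one_le_M : 1 ≤ M
  zero : R 0 = 0

namespace Tables.Models

variable {D : Tables} {P : MFG L T} {R : ℕ → ℝ} {M : ℕ}

theorem entry_of_lt (h : D.Models P R M) {t k l : ℕ} (ht : t ≤ T) (hk : k < M ^ (L - 1)) (hl : l < L - 1) :
    D.entry t k l = R (digit M k l) := by
  have h1 := (h.ready.hV k hk).1 l (by rw [h.hL]; exact hl)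
  have h2 := h.ready.hA t ht l (by rw [h.hL]; omega)
  rw [entry, h1, h2, if_neg (by rw [h.hL]; omega), add_zero]

theorem sum_entry (h : D.Models P R M) {t k : ℕ} (ht : t ≤ T) (hk : k < M ^ (L - 1)) :
    ∑ l ∈ Finset.range L, D.entry t k l = ∑ q ∈ Finset.range (t * L), P.supply q := by
  have h1 := (h.ready.hV k hk).2
  have h2 := h.ready.hA t ht (L - 1) (by rw [h.hL]; have := h.one_le_L; omega)
  rw [h.hL] at h1 h2
  rw [if_pos rfl, h.hb] at h2
  have hL : L = L - 1 + 1 := by have := h.one_le_L; omega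
  rw [show Finset.range L = Finset.range (L - 1 + 1) by rw [← hL], Finset.sum_range_succ,
    Finset.sum_congr rfl fun l hl => h.entry_of_lt ht hk (Finset.mem_range.1 hl), entry, h.hL, h1,
    h2]
  ring

end Tables.Models

theorem MFG.sum_supply_column (P : MFG L T) :
    ∑ q ∈ Finset.range (T * L), P.supply q = 0 := by
  have h : ∑ v, (P.b v : ℝ) = 0 := by rw [← Int.cast_sum, P.sum_b, Int.cast_zero]
  rw [sum_range_mul_eq, ← h, Fintype.sum_prod_type_right, Finset.sum_range]
  refine Finset.sum_congr rfl fun t _ => ?_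
  rw [Finset.sum_range]
  exact Finset.sum_congr rfl fun l _ => supply_eq l.2 t.2

namespace Tables.Models

variable {D : Tables} {P : MFG L T} {R : ℕ → ℝ} {M : ℕ}

/-- State 0 has all its listed entries equal to `R 0 = 0`, and at both ends of the grid the offset
vanishes as well, because the total supply is zero. -/
theorem entry_eq_zero (h : D.Models P R M) {t l : ℕ} (ht : t = 0 ∨ t = T) (hl : l < L) : D.entry t 0 l = 0 := by
  have hk : 0 < M ^ (L - 1) := Nat.pow_pos h.one_le_M
  have htT : t ≤ T := by omega
  have hlow : ∀ l < L - 1, D.entry t 0 l = 0 := fun l hl => by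
    rw [h.entry_of_lt htT hk hl, digit_zero, h.zero]
  by_cases hl' : l < L - 1
  · exact hlow l hl'
  · have hs := h.sum_entry htT hk
    have htot : ∑ q ∈ Finset.range (t * L), P.supply q = 0 := by
      rcases ht with rfl | rfl
      · simp
      · exact P.sum_supply_column
    rw [htot, show L = l + 1 by omega, Finset.sum_range_succ, Finset.sum_eq_zero, zero_add] at hs
    · exact hs
    · intro i hi
      exact hlow i (by rw [Finset.mem_range] at hi; omega)

/-- The totals of two consecutive cuts differ exactly by the supply of the column in between, so
nothing leaves the grid at the bottom. -/
theorem vert_last (h : D.Models P R M) {t s s' : ℕ} (ht : t < T) (hs : s < M ^ (L - 1)) (hs' : s' < M ^ (L - 1))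
    {l : ℕ} (hl : l + 1 = L) : D.vert t s s' l = 0 := by
  rw [vert, hl, Finset.sum_sub_distrib, Finset.sum_add_distrib, h.sum_entry ht.le hs,
    h.sum_entry ht hs', Nat.succ_mul, Finset.sum_range_add, h.hL, h.hb]
  ring

theorem hor_eq (h : D.Models P R M) {ρ : ℕ → ℕ} (hρ : D.IsPath (M ^ (L - 1)) T ρ) {X : ℕ → ℝ}
    (hX : ∀ t < T, ∀ l < L, X (2 * (t * L + l)) = D.entry (t + 1) (ρ (t + 1)) l)
    {t l : ℕ} (ht : t ≤ T) (hl : l < L) :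
    hor (fun a : Arc L T => X (arcCode a)) l t = D.entry t (ρ t) l := by
  rcases t with _ | t
  · rw [hρ.first, h.entry_eq_zero (Or.inl rfl) hl, hor]
  · by_cases ht' : t + 1 < T
    · rw [hor_fwdArc _ hl ht', arcCode_fwdArc, hX t ht l hl]
    · obtain rfl : t + 1 = T := by omega
      rw [hor_last _ hl, hρ.last, h.entry_eq_zero (Or.inr rfl) hl]

theorem ver_eq (h : D.Models P R M) {ρ : ℕ → ℕ} (hρ : D.IsPath (M ^ (L - 1)) T ρ) {X : ℕ → ℝ}
    (hX : ∀ t < T, ∀ l < L, X (2 * (t * L + l) + 1) = D.vert t (ρ t) (ρ (t + 1)) l)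
    {t l : ℕ} (ht : t < T) (hl : l ≤ L) :
    ver (fun a : Arc L T => X (arcCode a)) l t = ∑ i ∈ Finset.range l,
      (D.b (t * D.L + i) + D.entry t (ρ t) i - D.entry (t + 1) (ρ (t + 1)) i) := by
  rcases l with _ | l
  · simp [ver]
  · change _ = D.vert t (ρ t) (ρ (t + 1)) l
    by_cases hl' : l + 1 < L
    · rw [ver_downArc _ hl' ht, arcCode_downArc, hX t ht l hl]
    · rw [h.vert_last ht (hρ.lt t ht.le) (hρ.lt (t + 1) ht) (by omega),
        show l + 1 = L by omega, ver_last]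

/-- A feasible sequence of states yields a feasible flow. -/
theorem feasible (h : D.Models P R M) {ρ : ℕ → ℕ} (hρ : D.IsPath (M ^ (L - 1)) T ρ) {X : ℕ → ℝ}
    (hX : ∀ t < T, ∀ l < L, X (2 * (t * L + l)) = D.entry (t + 1) (ρ (t + 1)) l ∧
      X (2 * (t * L + l) + 1) = D.vert t (ρ t) (ρ (t + 1)) l) :
    (fun a : Arc L T => X (arcCode a)) ∈ P.feasible := by
  have hX1 := fun t ht l hl => (hX t ht l hl).1
  have hX2 := fun t ht l hl => (hX t ht l hl).2
  constructor
  · rintro ⟨⟨l, hl⟩, ⟨t, ht⟩⟩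
    change div _ _ = _
    rw [div_eq, h.hor_eq hρ hX1 ht hl, h.hor_eq hρ hX1 ht.le hl, h.ver_eq hρ hX2 ht hl,
      h.ver_eq hρ hX2 ht hl.le, Finset.sum_range_succ, h.hb, h.hL, MFG.supply_eq hl ht]
    ring
  · intro a
    have hcap : D.InCap (arcCode a) (X (arcCode a)) := by
      rcases a.eq_fwdArc_or_downArc with ⟨l, t, hl, ht, rfl⟩ | ⟨l, t, hl, ht, rfl⟩
      · rw [arcCode_fwdArc, hX1 t (by omega) l hl]
        have := (hρ.trans t (by omega) l (by rw [h.hL]; exact hl)).1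
        rwa [h.hL] at this
      · rw [arcCode_downArc, hX2 t ht l (by omega)]
        have := (hρ.trans t ht l (by rw [h.hL]; omega)).2
        rwa [h.hL] at this
    refine ⟨hcap.1, fun n hn => ?_⟩
    have h1 := hcap.2 (by rw [h.hflag, MFG.input_flag, hn]; simp)
    rwa [h.hcap, MFG.input_cap, hn, ENat.toNat_natCast] at h1

theorem cost_eq (h : D.Models P R M) {ρ : ℕ → ℕ} {x : Arc L T → ℝ} {X : ℕ → ℝ} (hx : ∀ a, X (arcCode a) = x a)
    (hX : ∀ t < T, ∀ l < L, X (2 * (t * L + l)) = D.entry (t + 1) (ρ (t + 1)) l ∧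
      X (2 * (t * L + l) + 1) = D.vert t (ρ t) (ρ (t + 1)) l) :
    P.cost x = D.pathCost T ρ := by
  rw [P.cost_eq x X hx, pathCost]
  refine Finset.sum_congr rfl fun t ht => ?_
  rw [transCost, h.hL]
  refine Finset.sum_congr rfl fun l hl => ?_
  rw [Finset.mem_range] at ht hl
  rw [vertexCost, (hX t ht l hl).1, (hX t ht l hl).2, h.hO, h.hL]

/-- The program also tests numbers that belong to no arc; there the flow and the capacity flag are
both zero, so the test succeeds. -/
theorem inCap_code (h : D.Models P R M) {y : Arc L T → ℝ} (hy : y ∈ P.feasible) (q : ℕ) : D.InCap q (code y q) := by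
  by_cases hq : ∃ a : Arc L T, arcCode a = q
  · obtain ⟨a, rfl⟩ := hq
    rw [code_arcCode]
    refine ⟨(hy.2 a).1, fun hflag => ?_⟩
    rw [h.hflag, MFG.input_flag] at hflag
    rw [h.hcap, MFG.input_cap]
    refine (hy.2 a).2 _ (ENat.natCast_toNat ?_).symm
    intro htop
    simp [htop] at hflag
  · rw [code_of_notMem y fun a ha => hq ⟨a, ha⟩]
    refine ⟨le_rfl, fun hflag => ?_⟩
    have h0 : P.input.idx 1 q = 0 :=
      Function.extend_apply' (fun a => if P.U a = ⊤ then 0 else 1) (0 : ℕ → ℕ) q hq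
    rw [h.hflag, h0] at hflag
    omega

/-- A flow with values in the candidate list yields a sequence of states of the same cost. -/
theorem exists_path (h : D.Models P R M) {y : Arc L T → ℝ} (hy : y ∈ P.feasible)
    (hR : ∀ l < L - 1, ∀ t, Listed R M (hor y l t)) :
    ∃ σ, D.IsPath (M ^ (L - 1)) T σ ∧ D.pathCost T σ = P.cost y := by
  have hM := h.one_le_M
  -- Different numbers may describe the same tuple if the list has repetitions; the first and the
  -- last layer must use number 0.
  have hex : ∀ t, ∃ s < M ^ (L - 1), (t = 0 ∨ t = T → s = 0) ∧
      ∀ l < L - 1, R (digit M s l) = hor y l t := by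
    intro t
    by_cases ht : t = 0 ∨ t = T
    · refine ⟨0, Nat.pow_pos hM, fun _ => rfl, fun l hl => ?_⟩
      rw [digit_zero, h.zero]
      rcases ht with rfl | rfl
      · rfl
      · rw [hor_last y (by omega)]
    · have hd : ∀ l, ∃ d < M, l < L - 1 → R d = hor y l t := by
        intro l
        by_cases hl : l < L - 1
        · obtain ⟨d, hd, h1⟩ := hR l hl t
          exact ⟨d, hd, fun _ => h1⟩
        · exact ⟨0, hM, fun h1 => absurd h1 hl⟩
      choose d hd hd' using hd
      obtain ⟨s, hs, hdig⟩ := exists_digits d hd (L - 1)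
      exact ⟨s, hs, fun h1 => absurd h1 ht, fun l hl => by rw [hdig l hl, hd' l hl]⟩
  choose σ hσ hσ0 hσR using hex
  have hnet : ∀ l < L, ∀ t < T, netOut y l t = P.supply (t * L + l) := by
    intro l hl t ht
    rw [MFG.supply_eq hl ht, ← MFG.div_of_feasible hy, div_eq, netOut]
  -- The first rows agree by the choice of the digits, and the last row by conservation over the
  -- cut.
  have hentry : ∀ t ≤ T, ∀ l < L, D.entry t (σ t) l = hor y l t := by
    intro t ht l hl
    have hlow : ∀ l < L - 1, D.entry t (σ t) l = hor y l t := fun l hl => by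
      rw [h.entry_of_lt ht (hσ t) hl, hσR t l hl]
    by_cases hl' : l < L - 1
    · exact hlow l hl'
    · have h1 := h.sum_entry ht (hσ t)
      have h2 := sum_netOut_columns y t
      rw [Finset.sum_congr rfl fun j hj => Finset.sum_congr rfl fun i hi =>
        hnet i (Finset.mem_range.1 hi) j ((Finset.mem_range.1 hj).trans_le ht),
        ← sum_range_mul_eq, ← h1] at h2
      have hL : L = l + 1 := by omega
      rw [show Finset.range L = Finset.range (l + 1) by rw [← hL], Finset.sum_range_succ,
        Finset.sum_range_succ, Finset.sum_congr rfl fun i hi =>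
        hlow i (by rw [Finset.mem_range] at hi; omega)] at h2
      exact add_left_cancel h2
  have hvert : ∀ t < T, ∀ l < L, D.vert t (σ t) (σ (t + 1)) l = ver y (l + 1) t := by
    intro t ht l hl
    have h1 := sum_netOut_column y (l + 1) t
    rw [Finset.sum_congr rfl fun i hi =>
      hnet i ((Finset.mem_range.1 hi).trans_le hl) t ht] at h1
    rw [vert, Finset.sum_sub_distrib, Finset.sum_add_distrib, h.hb, h.hL, h1,
      Finset.sum_congr rfl fun i hi => hentry t ht.le i ((Finset.mem_range.1 hi).trans_le hl),
      Finset.sum_congr rfl fun i hi => hentry (t + 1) ht i ((Finset.mem_range.1 hi).trans_le hl)]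
    ring
  refine ⟨σ, ⟨hσ0 0 (Or.inl rfl), hσ0 T (Or.inr rfl), fun t _ => hσ t, ?_⟩, ?_⟩
  · intro t ht l hl
    rw [h.hL] at hl
    rw [VertexOk, hentry (t + 1) ht l hl, hvert t ht l hl, h.hL]
    exact ⟨h.inCap_code hy _, h.inCap_code hy _⟩
  · refine (h.cost_eq (code_arcCode y) fun t ht l hl => ?_).symm
    exact ⟨(hentry (t + 1) ht l hl).symm, (hvert t ht l hl).symm⟩

end Tables.Models

end GridFlow

namespace GridFlow

variable {L T : ℕ}

/-! ### The algorithm -/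

/-- Sequences of states give feasible flows of equal cost, and every rigid flow is such a sequence.
As each feasible flow is matched by a rigid one that is no more expensive, the best sequence is
optimal among all flows. -/
theorem optimizeP_solves {P : MFG L T} {s : Store} {M : ℕ} (hL1 : 1 ≤ L) (hT1 : 1 ≤ T)
    (hi0 : s.idx 0 = P.input.idx 0) (hi1 : s.idx 1 = P.input.idx 1)
    (hv0 : s.val 0 = P.input.val 0) (hv1 : s.val 1 = P.input.val 1)
    (hM : s.idx 2 0 = M) (hM1 : 1 ≤ M) (hMS : M ≤ M ^ (L - 1)) (h19 : s.idx 19 = 0)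
    (h20 : s.idx 20 = 0) (h27 : s.idx 27 = 0) (h28 : s.idx 28 = 0) (h29 : s.idx 29 = 0)
    (h7 : s.val 7 = 0) (h11 : s.val 11 = 0) (hR0 : s.val 3 0 = 0)
    (hR : ∀ y ∈ P.feasible, P.Rigid y → ∀ l < L - 1, ∀ t, Listed (s.val 3) M (hor y l t))
    (hne : P.feasible.Nonempty) :
    Ht P.oracle optimizeP s (20000 * (T * L * (M ^ (L - 1)) ^ 2))
      (fun w => P.IsOptimal (output L T w)) := by
  have hmodel : ∀ D : Tables, D.L = L → D.b = s.val 0 → D.flag = s.idx 1 → D.cap = s.val 1 →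
      D.O = P.oracle → D.Ready (s.val 3) M (M ^ (L - 1)) T → D.Models P (s.val 3) M :=
    fun D e1 e2 e3 e4 e5 e6 => ⟨e1, e2.trans hv0, e3.trans hi1, e4.trans hv1, e5, e6, hL1, hM1, hR0⟩
  refine Ht.mono (optimizeP_spec (L := L) (T := T) (by rw [hi0]; rfl) (by rw [hi0]; rfl) hL1 hT1
    hM hM1 rfl hMS h19 (by rw [h20]; rfl) (by rw [h27]; rfl) (by rw [h28]; rfl) h29 h7
    (by rw [h11]; rfl) ?_) le_rfl ?_
  · intro D e1 e2 e3 e4 e5 e6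
    obtain ⟨x, hx⟩ := hne
    obtain ⟨y, hy, hrig, -⟩ := MFG.exists_rigid_le hx
    obtain ⟨σ, hσ, -⟩ := (hmodel D e1 e2 e3 e4 e5 e6).exists_path hy (hR y hy hrig)
    exact ⟨σ, hσ⟩
  · rintro w - ⟨D, e1, e2, e3, e4, e5, e6, ρ, hρ, hbest, hw⟩
    have hD := hmodel D e1 e2 e3 e4 e5 e6
    refine ⟨hD.feasible hρ hw, fun x hx => ?_⟩
    obtain ⟨y, hy, hrig, hle⟩ := MFG.exists_rigid_le hx
    obtain ⟨σ, hσ, hcost⟩ := hD.exists_path hy (hR y hy hrig)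
    refine le_trans ?_ hle
    rw [hD.cost_eq (x := output L T w) (fun _ => rfl) hw, ← hcost]
    exact hbest σ hσ

/-- The length of the list of candidate values. -/
noncomputable def MFG.listSize (P : MFG L T) : ℕ :=
  (prefixCount P.supply L T + 1) ^ 2 * (2 * (2 * (T * L)) + 1) ^ P.K

theorem candidatesP_input {P : MFG L T} (hL : 2 ≤ L) (hT : 1 ≤ T) (hK : 1 ≤ P.K)
    (h2 : P.InTwoRows) :
    Ht P.oracle candidatesP P.input (10000 * (T * L * P.listSize)) (fun s => s.idx 2 0 = P.listSize ∧
      s.val 3 0 = 0 ∧ ∀ f ∈ P.feasible, P.Rigid f → ∀ a, Listed (s.val 3) P.listSize (f a)) := by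
  have hcaps : (capsBelow (P.input.idx 1) (P.input.val 1) (2 * (T * L))).card = P.K :=
    MFG.card_caps
  refine Ht.mono (candidatesP_spec (L := L) (T := T) rfl rfl hL rfl rfl hT rfl
    (by rw [hcaps]; exact hK) (by rw [hcaps]; rfl)) le_rfl ?_
  rintro s - ⟨h1, h3, h4⟩
  refine ⟨h1, h3, fun f hf hr a => ?_⟩
  obtain ⟨x, y, hx, hy, c, hc, hfa⟩ := hr.exists_eq hL h2 hf a
  rw [hfa]
  exact h4 x y hx hy c hc

theorem MFG.exists_arc {P : MFG L T} (hK : 1 ≤ P.K) : Nonempty (Arc L T) := by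
  obtain ⟨u, hu⟩ := Finset.card_pos.1 hK
  obtain ⟨a, -, -⟩ := Finset.mem_image.1 (Finset.mem_filter.1 hu).1
  exact ⟨a⟩

theorem MFG.K_le (P : MFG L T) : P.K ≤ 2 * (T * L) :=
  ((Finset.card_filter_le _ _).trans Finset.card_image_le).trans card_arc_le

/-- The list of candidate values is followed by the dynamic program. -/
def solveP : Prog := .seq candidatesP optimizeP

theorem one_le_listSize (P : MFG L T) : 1 ≤ P.listSize := by
  have : 0 < P.listSize := by unfold MFG.listSize; positivity
  exact this

theorem solveP_spec {P : MFG L T} (hL : 2 ≤ L) (hT : 1 ≤ T) (hK : 1 ≤ P.K) (h2 : P.InTwoRows)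
    (hne : P.feasible.Nonempty) :
    SolvesWithin solveP P (30000 * (T * L * P.listSize ^ (2 * (L - 1)))) := by
  have hM1 := one_le_listSize P
  have hMS : P.listSize ≤ P.listSize ^ (L - 1) := Nat.le_self_pow (by omega) _
  refine Ht.le (Ht.seq (candidatesP_input hL hT hK h2) ?_
    (n := 20000 * (T * L * (P.listSize ^ (L - 1)) ^ 2))) ?_
  · rintro s hF ⟨h1, h3, h4⟩
    refine optimizeP_solves (by omega) hT (hF.idx 0 rfl) (hF.idx 1 rfl) (hF.val 0 rfl) (hF.val 1 rfl) h1 hM1 hMS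
      (hF.idx 19 rfl) (hF.idx 20 rfl) (hF.idx 27 rfl) (hF.idx 28 rfl) (hF.idx 29 rfl) (hF.val 7 rfl) (hF.val 11 rfl) h3 ?_ hne
    intro y hy hr l hl t
    -- Outside the grid the horizontal flow is zero, which is the first candidate.
    rcases t with _ | t
    · exact ⟨0, hM1, h3⟩
    · by_cases ht : t + 1 < T
      · rw [hor_fwdArc y (by omega) ht]
        exact h4 y hy hr _
      · rw [hor, code_fwd_last y (by omega) (by omega)]
        exact ⟨0, hM1, h3⟩
  · have h5 : P.listSize ≤ P.listSize ^ (2 * (L - 1)) := Nat.le_self_pow (by omega) _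
    have h6 := Nat.mul_le_mul_left (T * L) h5
    rw [← pow_mul, mul_comm (L - 1) 2]
    omega

theorem solveP_spec_one {P : MFG 1 T} (hT : 1 ≤ T) (hne : P.feasible.Nonempty) :
    SolvesWithin solveP P (20 + 20000 * T) := by
  refine Ht.le (Ht.seq (candidatesP_spec_one (by exact le_rfl)) ?_
    (n := 20000 * (T * 1 * (1 ^ (1 - 1)) ^ 2))) (by simp)
  rintro s hF ⟨h1, h3⟩
  exact optimizeP_solves le_rfl hT (hF.idx 0 rfl) (hF.idx 1 rfl) (hF.val 0 rfl) (hF.val 1 rfl) h1 le_rfl (by simp)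
    (hF.idx 19 rfl) (hF.idx 20 rfl) (hF.idx 27 rfl) (hF.idx 28 rfl) (hF.idx 29 rfl) (hF.val 7 rfl) (hF.val 11 rfl) h3
    (fun y _ _ l hl => absurd hl (by omega)) hne

/-! ### Counting -/

/-- The specification of the program doubles as the count: the store it reaches holds a list of this
length that contains every value of every extreme point. -/
theorem encard_extremeValues_le {P : MFG L T} (hL : 2 ≤ L) (hT : 1 ≤ T) (hK : 1 ≤ P.K)
    (h2 : P.InTwoRows) (a : Arc L T) : (P.extremeValues a).encard ≤ P.listSize := by
  obtain ⟨-, s, -, -, -, -, h⟩ := candidatesP_input hL hT hK h2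
  have hsub : P.extremeValues a ⊆ ((Finset.range P.listSize).image (s.val 3) : Finset ℝ) := by
    rintro _ ⟨f, hf, rfl⟩
    obtain ⟨j, hj, hj'⟩ := h f hf.1 (MFG.rigid_of_extreme hf) a
    simp only [Finset.coe_image, Finset.coe_range]
    exact ⟨j, hj, hj'⟩
  refine (Set.encard_le_encard hsub).trans ?_
  rw [Set.encard_coe_eq_coe_finsetCard]
  exact_mod_cast Finset.card_image_le.trans (Finset.card_range _).le

theorem encard_extremeValues_le_one {P : MFG 1 T} (a : Arc 1 T) :
    (P.extremeValues a).encard ≤ 1 := by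
  rw [Set.encard_le_one_iff]
  rintro _ _ ⟨x, hx, rfl⟩ ⟨y, hy, rfl⟩
  have hhor : ∀ z ∈ P.feasible, ∀ t ≤ T, hor z 0 t =
      ∑ j ∈ Finset.range t, P.supply (j * 1 + 0) := by
    intro z hz t ht
    have h := sum_netOut_columns z t
    rw [Finset.sum_range_one] at h
    rw [← h]
    refine Finset.sum_congr rfl fun j hj => ?_
    rw [Finset.mem_range] at hj
    rw [Finset.sum_range_one, MFG.supply_eq (by omega) (by omega), ← MFG.div_of_feasible hz, div_eq,
      netOut]
  rcases a.eq_fwdArc_or_downArc with ⟨l, t, hl, ht, rfl⟩ | ⟨l, t, hl, ht, rfl⟩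
  · obtain rfl : l = 0 := by omega
    simp only
    rw [← hor_fwdArc x hl ht, ← hor_fwdArc y hl ht, hhor x hx.1 _ (by omega), hhor y hy.1 _ (by omega)]
  · omega

theorem listSize_le {P : MFG L T} (hL : 2 ≤ L) (h2 : P.InTwoRows) :
    P.listSize ≤ (4 * T + 1) ^ 2 * (4 * (T * L) + 1) ^ P.K := by
  have h := prefixCount_le hL h2
  rw [MFG.listSize, show 2 * (2 * (T * L)) = 4 * (T * L) by ring]
  exact Nat.mul_le_mul_right _ (Nat.pow_le_pow_left (by omega) 2)

/-- The surplus factor `(T * L) ^ K` of the right side swallows `25 * 5 ^ K ≤ 125 ^ K`, so no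
constant is left that could later be raised to a power growing with `L`. -/
theorem size_le_of_le {L T K : ℕ} (hT : 1 ≤ T) (hK : 1 ≤ K) (h : 125 ≤ T * L) :
    (4 * T + 1) ^ 2 * (4 * (T * L) + 1) ^ K ≤ L ^ (2 * K) * T ^ (2 * K + 2) := by
  calc (4 * T + 1) ^ 2 * (4 * (T * L) + 1) ^ K ≤ (5 * T) ^ 2 * (5 * (T * L)) ^ K :=
        Nat.mul_le_mul (Nat.pow_le_pow_left (by omega) _) (Nat.pow_le_pow_left (by omega) _)
    _ = T ^ 2 * (T * L) ^ K * (25 * 5 ^ K) := by ring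
    _ ≤ T ^ 2 * (T * L) ^ K * (25 ^ K * 5 ^ K) :=
        Nat.mul_le_mul_left _ (Nat.mul_le_mul_right _ (Nat.le_self_pow (by omega) _))
    _ = T ^ 2 * (T * L) ^ K * 125 ^ K := by rw [← mul_pow (25 : ℕ) 5]; norm_num
    _ ≤ T ^ 2 * (T * L) ^ K * (T * L) ^ K :=
        Nat.mul_le_mul_left _ (Nat.pow_le_pow_left h _)
    _ = _ := by ring

theorem exists_size_le : ∃ B, 1 ≤ B ∧ ∀ L T K : ℕ, 1 ≤ T → 1 ≤ L → K ≤ 2 * (T * L) →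
    T * L < 125 → (4 * T + 1) ^ 2 * (4 * (T * L) + 1) ^ K ≤ B := by
  -- For `T * L < 125` both bases are at most `501`, and `K`, bounded by the number of arcs, is less
  -- than `250`.
  refine ⟨501 ^ 2 * 501 ^ 250, Nat.succ_le_of_lt (by positivity), fun L T K hT hL hK h => ?_⟩
  have hTL : T ≤ T * L := Nat.le_mul_of_pos_right _ hL
  exact Nat.mul_le_mul (Nat.pow_le_pow_left (by omega) _)
    ((Nat.pow_le_pow_left (by omega) _).trans (Nat.pow_le_pow_right (by omega) (by omega)))

theorem time_eq {L K : ℕ} (T : ℕ) (hL : 1 ≤ L) :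
    T * L * (L ^ (2 * K) * T ^ (2 * K + 2)) ^ (2 * (L - 1)) =
      L ^ (4 * K * L - 4 * K + 1) * T ^ (4 * K * L + 4 * L - 4 * K - 3) := by
  obtain ⟨n, rfl⟩ : ∃ n, L = n + 1 := ⟨L - 1, by omega⟩
  rw [show 4 * K * (n + 1) - 4 * K = 4 * K * n by rw [mul_add, mul_one, Nat.add_sub_cancel],
    show 4 * K * (n + 1) + 4 * (n + 1) - 4 * K - 3 = (2 * K + 2) * (2 * n) + 1 by
      have h1 : 4 * K * (n + 1) = 4 * K * n + 4 * K := by ring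
      have h2 : (2 * K + 2) * (2 * n) = 4 * K * n + 4 * n := by ring
      omega, Nat.add_sub_cancel, mul_pow, ← pow_mul, ← pow_mul, pow_succ T,
    show 2 * K * (2 * n) = 4 * K * n by ring, pow_succ (n + 1) (4 * K * n)]
  ring

theorem MFG.one_le {P : MFG L T} (hK : 1 ≤ P.K) : 1 ≤ L ∧ 1 ≤ T := by
  obtain ⟨a⟩ := MFG.exists_arc hK
  exact ⟨Nat.one_le_of_lt a.tail.1.2, Nat.one_le_of_lt a.tail.2.2⟩

theorem exists_solvesWithin : ∃ (p : Prog) (C : ℕ), ∀ (L T : ℕ) (P : MFG L T),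
    1 ≤ P.K → P.InTwoRows → P.feasible.Nonempty → SolvesWithin p P
      (C * (L ^ (4 * P.K * L - 4 * P.K + 1) * T ^ (4 * P.K * L + 4 * L - 4 * P.K - 3))) := by
  obtain ⟨B, hB1, hB⟩ := exists_size_le
  -- The factor `30000` comes from `solveP_spec`; the other one covers the grids with `T * L < 125`,
  -- where the exponent `2 * (L - 1)` is less than `250`.
  refine ⟨solveP, 30000 * (125 * B ^ 250), fun L T P hK h2 hne => ?_⟩
  obtain ⟨hL, hT⟩ := MFG.one_le hK
  have hBp : 1 ≤ B ^ 250 := Nat.one_le_pow _ _ hB1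
  rcases hL.eq_or_lt with rfl | hL2
  · refine Ht.le (solveP_spec_one hT hne) ?_
    -- For a single row the claimed bound is linear in `T`, and this is what the trivial state space
    -- achieves.
    rw [show 4 * P.K * 1 + 4 * 1 - 4 * P.K - 3 = 1 by omega, one_pow, pow_one, one_mul]
    generalize B ^ 250 = Y at hBp ⊢
    nlinarith
  · refine Ht.le (solveP_spec hL2 hT hK h2 hne) ?_
    rw [← time_eq T hL]
    have hle := listSize_le hL2 h2
    rw [mul_assoc 30000]
    refine Nat.mul_le_mul_left _ ?_
    by_cases hTL : 125 ≤ T * L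
    · calc T * L * P.listSize ^ (2 * (L - 1))
          ≤ T * L * (L ^ (2 * P.K) * T ^ (2 * P.K + 2)) ^ (2 * (L - 1)) :=
            Nat.mul_le_mul_left _ (Nat.pow_le_pow_left
              (hle.trans (size_le_of_le hT hK hTL)) _)
        _ ≤ _ := Nat.le_mul_of_pos_left _ (by positivity)
    · have hL125 : L < 125 := (Nat.le_mul_of_pos_left L hT).trans_lt (not_le.1 hTL)
      have hsmall := hB L T P.K hT hL P.K_le (not_le.1 hTL)
      calc T * L * P.listSize ^ (2 * (L - 1)) ≤ 125 * B ^ 250 :=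
            Nat.mul_le_mul (not_le.1 hTL).le ((Nat.pow_le_pow_left (hle.trans hsmall) _).trans
              (Nat.pow_le_pow_right hB1 (by omega)))
        _ ≤ _ := Nat.le_mul_of_pos_right _ (by positivity)

theorem exists_encard_extremeValues_le : ∃ C : ℕ, ∀ (L T : ℕ) (P : MFG L T),
    1 ≤ P.K → P.InTwoRows → ∀ a : Arc L T,
      (P.extremeValues a).encard ≤ (C * (L ^ (2 * P.K) * T ^ (2 * P.K + 2)) : ℕ) := by
  obtain ⟨B, hB1, hB⟩ := exists_size_le
  refine ⟨B, fun L T P hK h2 a => ?_⟩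
  obtain ⟨hL, hT⟩ := MFG.one_le hK
  rcases hL.eq_or_lt with rfl | hL2
  · refine (encard_extremeValues_le_one a).trans ?_
    have : 1 ≤ B * (1 ^ (2 * P.K) * T ^ (2 * P.K + 2)) := Nat.succ_le_of_lt (by positivity)
    exact_mod_cast this
  · refine (encard_extremeValues_le hL2 hT hK h2 a).trans ?_
    have hle := listSize_le hL2 h2
    have : P.listSize ≤ B * (L ^ (2 * P.K) * T ^ (2 * P.K + 2)) := by
      by_cases hTL : 125 ≤ T * L
      · exact (hle.trans (size_le_of_le hT hK hTL)).trans (Nat.le_mul_of_pos_left _ hB1)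
      · exact (hle.trans (hB L T P.K hT hL P.K_le (not_le.1 hTL))).trans
          (Nat.le_mul_of_pos_right _ (by positivity))
    exact_mod_cast this

end GridFlow

theorem mainTheorem1 :
    (∃ (p : GridFlow.Prog) (C : ℕ), ∀ (L T : ℕ) (P : GridFlow.MFG L T),
      1 ≤ P.K → P.InTwoRows → P.feasible.Nonempty →
        GridFlow.SolvesWithin p P
          (C * (L ^ (4 * P.K * L - 4 * P.K + 1) *
            T ^ (4 * P.K * L + 4 * L - 4 * P.K - 3)))) ∧
    (∃ C : ℕ, ∀ (L T : ℕ) (P : GridFlow.MFG L T),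
      1 ≤ P.K → P.InTwoRows →
        ∀ a : GridFlow.Arc L T,
          (P.extremeValues a).encard ≤ (C * (L ^ (2 * P.K) * T ^ (2 * P.K + 2)) : ℕ)) := by
  exact ⟨GridFlow.exists_solvesWithin, GridFlow.exists_encard_extremeValues_le⟩
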